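/- **Conventions.** Let $\mathbb k$ be a field with an embedding $\mathbb k\to\mathbb C$ (e.g. $\mathbb R$ or $\mathbb C$), $\mathfrak g$ a Lie algebra over $\mathbb k$; all functions are smooth and complex-valued, and $\otimes=\otimes_{\mathbb k}$. Spinor indices $\alpha,\dot\alpha\in\{1,2\}$; $\varepsilon_{12}=1$, $\varepsilon_{\alpha\gamma}\varepsilon^{\gamma\beta}=\delta_\alpha^\beta$, $v^\alpha=\varepsilon^{\alpha\beta}v_\beta$, and likewise for dotted indices; parentheses around indices denote normalised symmetrisation over the dotted (resp. undotted) indices enclosed. On $\mathbb R^4$ use $x^{1\dot1}=x^0+\mathrm ix^1$, $x^{2\dot2}=x^0-\mathrm ix^1$, $x^{1\dot2}=x^2+\mathrm ix^3$, $x^{2\dot1}=-(x^2-\mathrm ix^3)$, $\partial_{\alpha\dot\alpha}=\partial/\partial x^{\alpha\dot\alpha}$ and $\Box=2\partial^{\alpha\dot\alpha}\partial_{\alpha\dot\alpha}$. For $\lambda=(\lambda_{\dot\alpha})$, $\mu=(\mu_\alpha)\in\mathbb C^2\setminus0$ put $\hat\lambda=(-\bar\lambda_{\dot2},\bar\lambda_{\dot1})$,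 $\hat\mu=(-\bar\mu_2,\bar\mu_1)$, $|\lambda|^2=\lambda_{\dot\alpha}\hat\lambda^{\dot\alpha}$, $|\mu|^2=\mu_\alpha\hat\mu^\alpha$. Let $\eta_i,\theta^i$ ($i=1,2,3$) be anticommuting, $u=\theta^i\eta_i$, $\eta^{(k)}=\frac12\varepsilon^{ijk}\eta_i\eta_j$, $\theta_{(k)}=\frac12\varepsilon_{ijk}\theta^i\theta^j$. **Reduced twisted CR complex $\mathfrak L_{\rm CR,tw,red}$.** Let $S(k,l)$ be the space of smooth functions $f$ of $(x,\lambda,\mu)\in\mathbb R^4\times(\mathbb C^2\setminus0)^2$, polynomial in $\eta_i,\theta^i$, with $f(x,t\lambda,s\mu,t\eta,s\theta)=t^ks^lf(x,\lambda,\mu,\eta,\theta)$ for all $t,s\in\mathbb C^\times$ (superfunctions over $\mathbb R^4\times\mathbb CP^1\times\mathbb CP^1$ with values in $\mathcal O(k,l)$). Put $$\hat V_F=\mu^\alpha\lambda^{\dot\alpha}\partial_{\alpha\dot\alpha},\quad \hat V_L=|\lambda|^2\lambda_{\dot\alpha}\frac{\partial}{\partial\hat\lambda_{\dot\alpha}}-u\frac{\hat\mu^\alpha\lambda^{\dot\alpha}}{|\mu|^2}\partial_{\alpha\dot\alpha},\quad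 \hat V_R=|\mu|^2\mu_\alpha\frac{\partial}{\partial\hat\mu_\alpha}+u\frac{\mu^\alpha\hat\lambda^{\dot\alpha}}{|\lambda|^2}\partial_{\alpha\dot\alpha},$$ with $[\hat V_L,\hat V_R]=2u\hat V_F$, the other commutators being zero, and let $\hat v^F,\hat v^L,\hat v^R$ be the dual forms, of weights $(-1,-1),(-2,0),(0,-2)$, so that $\mathrm d\hat v^F=-2u\,\hat v^L\wedge\hat v^R$, $\mathrm d\hat v^L=\mathrm d\hat v^R=0$. Forms have total weight zero: the coefficients of $\hat v^F,\hat v^L,\hat v^R$, of $\hat v^L\wedge\hat v^R,\hat v^F\wedge\hat v^L,\hat v^F\wedge\hat v^R$ and of $\hat v^F\wedge\hat v^L\wedge\hat v^R$ lie in $S(1,1),S(2,0),S(0,2)$, in $S(2,2),S(3,1),S(1,3)$ and in $S(3,3)$. These forms, in degrees $0,\dots,3$, tensored with $\mathfrak g$ and with $\bar\partial=\hat v^F\hat V_F+\hat v^L\hat V_L+\hat v^R\hat V_R$, form the complex. **First-order Yang–Mills complex $\mathfrak L_{\rm YM_1}$.** Fields on $\mathbb R^4$ with values in $\mathfrak g$: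 $c$ in degree 0; $A_{\alpha\dot\alpha}$, $B_{\dot\alpha\dot\beta}=B_{\dot\beta\dot\alpha}$, $B_{\alpha\beta}=B_{\beta\alpha}$ in degree 1; $A^+_{\alpha\dot\alpha}$, $B^+_{\dot\alpha\dot\beta}=B^+_{\dot\beta\dot\alpha}$, $B^+_{\alpha\beta}=B^+_{\beta\alpha}$ in degree 2; $c^+$ in degree 3. The differential $\mu_1$ is: $c\mapsto A_{\alpha\dot\alpha}=\partial_{\alpha\dot\alpha}c$ (and $B=0$); $$(A,B)\mapsto\ A^+_{\alpha\dot\alpha}=\varepsilon^{\dot\beta\dot\gamma}\partial_{\alpha\dot\beta}B_{\dot\gamma\dot\alpha}+\varepsilon^{\beta\gamma}\partial_{\beta\dot\alpha}B_{\gamma\alpha},\quad B^+_{\dot\alpha\dot\beta}=\varepsilon^{\alpha\beta}\partial_{\alpha(\dot\alpha}A_{\beta\dot\beta)}-B_{\dot\alpha\dot\beta},\quad B^+_{\alpha\beta}=\varepsilon^{\dot\alpha\dot\beta}\partial_{(\alpha\dot\alpha}A_{\beta)\dot\beta}-B_{\alpha\beta};$$ and $(A^+,B^+)\mapsto c^+=\partial^{\alpha\dot\alpha}A^+_{\alpha\dot\alpha}$.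 **The map $\mathsf e$.** $\mathsf e(c)=c$, $\ \mathsf e(c^+)=\hat v^F\wedge\hat v^L\wedge\hat v^R\,u^3\,\frac23c^+$, $$\begin{aligned}\mathsf e(A,B)={}&\hat v^F\Big\{A_{\alpha\dot\alpha}\mu^\alpha\lambda^{\dot\alpha}-u\Big(\tfrac{B_{\dot\alpha\dot\beta}\lambda^{\dot\alpha}\hat\lambda^{\dot\beta}}{|\lambda|^2}-\tfrac{B_{\alpha\beta}\mu^\alpha\hat\mu^\beta}{|\mu|^2}\Big)-u^2\Big(\tfrac{\partial_{\alpha(\dot\alpha}B_{\dot\beta\dot\gamma)}\hat\mu^\alpha\lambda^{\dot\alpha}\hat\lambda^{\dot\beta}\hat\lambda^{\dot\gamma}}{2|\mu|^2|\lambda|^4}+\tfrac{\partial_{(\alpha\dot\alpha}B_{\beta\gamma)}\mu^\alpha\hat\mu^\beta\hat\mu^\gamma\hat\lambda^{\dot\alpha}}{2|\mu|^4|\lambda|^2}\Big)\\&\quad-u^3\Big(\tfrac{\partial_{\alpha(\dot\alpha}\partial_{\beta\dot\beta}B_{\dot\gamma\dot\delta)}\hat\mu^\alpha\hat\mu^\beta\lambda^{\dot\alpha}\hat\lambda^{\dot\beta}\hat\lambda^{\dot\gamma}\hat\lambda^{\dot\delta}}{6|\mu|^4|\lambda|^6}-\tfrac{\partial_{(\alpha\dot\alpha}\partial_{\beta\dot\beta}B_{\gamma\delta)}\mu^\alpha\hat\mu^\beta\hat\mu^\gamma\hat\mu^\delta\hat\lambda^{\dot\alpha}\hat\lambda^{\dot\beta}}{6|\mu|^6|\lambda|^4}\Big)\Big\}\\&+\hat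 v^L\Big\{-u\tfrac{A_{\alpha\dot\alpha}\hat\mu^\alpha\lambda^{\dot\alpha}}{|\mu|^2}-u^2\tfrac{3B_{\alpha\beta}\hat\mu^\alpha\hat\mu^\beta}{2|\mu|^4}+u^3\tfrac{5\partial_{(\alpha\dot\alpha}B_{\beta\gamma)}\hat\mu^\alpha\hat\mu^\beta\hat\mu^\gamma\hat\lambda^{\dot\alpha}}{6|\mu|^6|\lambda|^2}\Big\}\\&+\hat v^R\Big\{u\tfrac{A_{\alpha\dot\alpha}\mu^\alpha\hat\lambda^{\dot\alpha}}{|\lambda|^2}-u^2\tfrac{3B_{\dot\alpha\dot\beta}\hat\lambda^{\dot\alpha}\hat\lambda^{\dot\beta}}{2|\lambda|^4}-u^3\tfrac{5\partial_{\alpha(\dot\alpha}B_{\dot\beta\dot\gamma)}\hat\mu^\alpha\hat\lambda^{\dot\alpha}\hat\lambda^{\dot\beta}\hat\lambda^{\dot\gamma}}{6|\mu|^2|\lambda|^6}\Big\},\end{aligned}$$ and, with $B^+_{\alpha\dot\alpha}=\varepsilon^{\dot\beta\dot\gamma}\partial_{\alpha\dot\beta}B^+_{\dot\gamma\dot\alpha}-\varepsilon^{\beta\gamma}\partial_{\beta\dot\alpha}B^+_{\gamma\alpha}$,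 $$\begin{aligned}\mathsf e(A^+,B^+)={}&\hat v^L\wedge\hat v^R\Big\{u^2\Big(\tfrac{B^+_{\dot\alpha\dot\beta}\lambda^{\dot\alpha}\hat\lambda^{\dot\beta}}{|\lambda|^2}-\tfrac{B^+_{\alpha\beta}\mu^\alpha\hat\mu^\beta}{|\mu|^2}\Big)+u^3\tfrac{A^+_{\alpha\dot\alpha}\hat\mu^\alpha\hat\lambda^{\dot\alpha}}{|\mu|^2|\lambda|^2}\Big\}\\&+\hat v^F\wedge\hat v^L\Big\{-uB^+_{\dot\alpha\dot\beta}\lambda^{\dot\alpha}\lambda^{\dot\beta}+u^2\tfrac{\hat\mu^\alpha\lambda^{\dot\alpha}}{|\mu|^2}\big(-\tfrac56A^+_{\alpha\dot\alpha}-\tfrac12B^+_{\alpha\dot\alpha}\big)\\&\quad+u^3\tfrac{\hat\mu^\alpha\hat\mu^\beta\lambda^{\dot\alpha}\hat\lambda^{\dot\beta}}{|\mu|^4|\lambda|^2}\Big(\tfrac14\varepsilon_{\dot\alpha\dot\beta}\varepsilon^{\dot\gamma\dot\delta}\partial_{(\alpha\dot\gamma}(A^+_{\beta)\dot\delta}+B^+_{\beta)\dot\delta})+\tfrac16\partial_{(\alpha(\dot\alpha}(A^+_{\beta)\dot\beta)}+2B^+_{\beta)\dot\beta)})\Big)\Big\}\\&+\hat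 v^F\wedge\hat v^R\Big\{uB^+_{\alpha\beta}\mu^\alpha\mu^\beta+u^2\tfrac{\mu^\alpha\hat\lambda^{\dot\alpha}}{|\lambda|^2}\big(-\tfrac56A^+_{\alpha\dot\alpha}+\tfrac12B^+_{\alpha\dot\alpha}\big)\\&\quad-u^3\tfrac{\mu^\alpha\hat\mu^\beta\hat\lambda^{\dot\alpha}\hat\lambda^{\dot\beta}}{|\mu|^2|\lambda|^4}\Big(\tfrac14\varepsilon_{\alpha\beta}\varepsilon^{\gamma\delta}\partial_{\gamma(\dot\alpha}(A^+_{\delta\dot\beta)}-B^+_{\delta\dot\beta)})+\tfrac16\partial_{(\alpha(\dot\alpha}(A^+_{\beta)\dot\beta)}-2B^+_{\beta)\dot\beta)})\Big)\Big\}.\end{aligned}$$ **The $\mathcal N=3$ extension.** Add in degree 1 the fields $\chi^i_\alpha$, $\chi_{i\dot\alpha}$ ($i=1,2,3$), $\chi_{\dot\alpha}$, $\chi_\alpha$, $\phi_k$, $\phi^k$ ($k=1,2,3$), and in degree 2 their anti-fields $\chi^{+i}_{\dot\alpha}$, $\chi^+_{i\alpha}$, $\chi^+_\alpha$, $\chi^+_{\dot\alpha}$,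 $\phi^+_k$, $\phi^{+k}$, with the additional differential $$\chi^{+i}_{\dot\alpha}=\varepsilon^{\alpha\beta}\partial_{\alpha\dot\alpha}\chi^i_\beta,\quad\chi^+_{i\alpha}=\varepsilon^{\dot\alpha\dot\beta}\partial_{\alpha\dot\alpha}\chi_{i\dot\beta},\quad\chi^+_\alpha=\varepsilon^{\dot\alpha\dot\beta}\partial_{\alpha\dot\alpha}\chi_{\dot\beta},\quad\chi^+_{\dot\alpha}=\varepsilon^{\alpha\beta}\partial_{\alpha\dot\alpha}\chi_\beta,\quad\phi^+_k=\Box\phi_k,\quad\phi^{+k}=\Box\phi^k.$$ Write $\lambda'^{\dot\alpha}=\hat\lambda^{\dot\alpha}/|\lambda|^2$, $\mu'^\alpha=\hat\mu^\alpha/|\mu|^2$. The map $\mathsf e$ is extended by adding in degree 1 $$\begin{aligned}&\hat v^F\Big\{\eta_i\big(\mu^\alpha\chi^i_\alpha-u\lambda'^{\dot\alpha}\mu^\alpha\mu'^\beta\partial_{(\alpha\dot\alpha}\chi^i_{\beta)}+\tfrac12u^2\lambda'^{\dot\alpha}\lambda'^{\dot\beta}\mu^\alpha\mu'^\beta\m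u'^\gamma\partial_{(\alpha\dot\alpha}\partial_{\beta\dot\beta}\chi^i_{\gamma)}\big)\\&\quad+\theta^i\big(\lambda^{\dot\alpha}\chi_{i\dot\alpha}+u\mu'^\alpha\lambda^{\dot\alpha}\lambda'^{\dot\beta}\partial_{\alpha(\dot\alpha}\chi_{i\dot\beta)}+\tfrac12u^2\mu'^\alpha\mu'^\beta\lambda^{\dot\alpha}\lambda'^{\dot\beta}\lambda'^{\dot\gamma}\partial_{\alpha(\dot\alpha}\partial_{\beta\dot\beta}\chi_{i\dot\gamma)}\big)\\&\quad+\tfrac12\eta_1\eta_2\eta_3\,\mu^\alpha\lambda'^{\dot\alpha}\lambda'^{\dot\beta}\partial_{\alpha(\dot\alpha}\chi_{\dot\beta)}+\tfrac12\theta^1\theta^2\theta^3\lambda^{\dot\alpha}\mu'^\alpha\mu'^\beta\partial_{(\alpha\dot\alpha}\chi_{\beta)}\\&\quad+\eta^{(k)}\big(\mu^\alpha\lambda'^{\dot\alpha}\partial_{\alpha\dot\alpha}\phi_k-u\,\mu'^\alpha\lambda'^{\dot\alpha}\mu^\beta\lambda'^{\dot\beta}\partial_{\alpha\dot\alpha}\partial_{\beta\dot\beta}\phi_k\big)+\theta_{(k)}\big(\mu'^\alpha\lambda^{\dot\alpha}\partial_{\alpha\dot\alpha}\phi^k+u\,\mu'^\alpha\lambda'^{\dot\alpha}\mu'^\beta\lambda^{\dot\beta}\partial_{\alpha\dot\alpha}\partial_{\beta\dot\beta}\phi^k\big)\Big\}\\&+\hat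 v^L\Big\{\eta_i\big(-2u\mu'^\alpha\chi^i_\alpha+2u^2\lambda'^{\dot\alpha}\mu'^\alpha\mu'^\beta\partial_{(\alpha\dot\alpha}\chi^i_{\beta)}\big)+\eta_1\eta_2\eta_3\lambda'^{\dot\alpha}\chi_{\dot\alpha}+\eta^{(k)}\big(\phi_k-3u\,\mu'^\alpha\lambda'^{\dot\alpha}\partial_{\alpha\dot\alpha}\phi_k\big)\Big\}\\&+\hat v^R\Big\{\theta^i\big(2u\lambda'^{\dot\alpha}\chi_{i\dot\alpha}+2u^2\mu'^\alpha\lambda'^{\dot\alpha}\lambda'^{\dot\beta}\partial_{\alpha(\dot\alpha}\chi_{i\dot\beta)}\big)+\theta^1\theta^2\theta^3\mu'^\alpha\chi_\alpha+\theta_{(k)}\big(\phi^k+3u\,\mu'^\alpha\lambda'^{\dot\alpha}\partial_{\alpha\dot\alpha}\phi^k\big)\Big\}\end{aligned}$$ and in degree 2 $$\begin{aligned}&\hat v^L\wedge\hat v^R\,u^2\big\{\eta_i\lambda'^{\dot\alpha}\chi^{+i}_{\dot\alpha}-\theta^i\mu'^\alpha\chi^+_{i\alpha}\big\}\\&+\hat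 v^F\wedge\hat v^L\Big\{\eta_i\Big(-\tfrac32u\lambda^{\dot\alpha}\chi^{+i}_{\dot\alpha}+u^2\big(\tfrac56\mu'^\alpha\lambda^{\dot\alpha}\lambda'^{\dot\beta}\partial_{\alpha(\dot\alpha}\chi^{+i}_{\dot\beta)}-\tfrac54\mu'^\alpha\varepsilon^{\dot\alpha\dot\beta}\partial_{\alpha\dot\alpha}\chi^{+i}_{\dot\beta}\big)\Big)+\tfrac16\theta^iu^2\lambda^{\dot\alpha}\mu'^\alpha\mu'^\beta\partial_{(\alpha\dot\alpha}\chi^+_{i\beta)}\\&\qquad+\tfrac12\eta_1\eta_2\eta_3\mu^\alpha\chi^+_\alpha-\tfrac12\eta^{(k)}u\,\phi^+_k\Big\}\\&+\hat v^F\wedge\hat v^R\Big\{\tfrac16\eta_iu^2\mu^\alpha\lambda'^{\dot\alpha}\lambda'^{\dot\beta}\partial_{\alpha(\dot\alpha}\chi^{+i}_{\dot\beta)}+\theta^i\Big(\tfrac32u\mu^\alpha\chi^+_{i\alpha}+u^2\big(\tfrac56\lambda'^{\dot\alpha}\mu^\alpha\mu'^\beta\partial_{(\alpha\dot\alpha}\chi^+_{i\beta)}-\tfrac54\lambda'^{\dot\alpha}\varepsilon^{\alpha\beta}\partial_{\alpha\dot\alpha}\chi^+_{i\beta}\big)\Big)\\&\qquad+\tfrac12\theta^1\theta^2\theta^3\lambda^{\dot\alpha}\chi^+_{\dot\alpha}+\tfrac12\theta_{(k)}u\,\phi^{+k}\Big\}.\end{aligned}$$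 **Proposition.** $\mathfrak L_{\rm CR,tw,red}$, $\mathfrak L_{\rm YM_1}$ and its $\mathcal N=3$ extension are cochain complexes. The map $\mathsf e:\mathfrak L_{\rm YM_1}\to\mathfrak L_{\rm CR,tw,red}$ is an injective morphism of cochain complexes: it is injective in every degree and $\bar\partial\circ\mathsf e=\mathsf e\circ\mu_1$. The same holds for its $\mathcal N=3$ supersymmetric extension. -/

import Mathlib

open scoped TensorProduct ContDiff

noncomputable section

namespace CRAmbitwistor

/-! ### Spaces and smooth functions -/

/-- Euclidean `ℝ⁴`. -/
abbrev E4 : Type := EuclideanSpace ℝ (Fin 4)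

/-- Triples `(x, λ, μ)` with `x ∈ ℝ⁴` and spinors `λ = (λ_α̇)`, `μ = (μ_α)` in `ℂ²`. -/
abbrev Amb : Type := E4 × (Fin 2 → ℂ) × (Fin 2 → ℂ)

/-- The total space `ℝ⁴ × (ℂ² ∖ 0) × (ℂ² ∖ 0)` of homogeneous coordinates for
`ℝ⁴ × ℂP¹ × ℂP¹`. -/
def dom : Set Amb := {p | p.2.1 ≠ 0 ∧ p.2.2 ≠ 0}

theorem isOpen_dom : IsOpen dom := by
  have h1 : IsOpen {p : Amb | p.2.1 ≠ 0} := isOpen_ne_fun (by fun_prop) (by fun_prop)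
  have h2 : IsOpen {p : Amb | p.2.2 ≠ 0} := isOpen_ne_fun (by fun_prop) (by fun_prop)
  exact h1.inter h2

/-- Extension by zero of a function on `dom`; it is only used to speak about smoothness and
derivatives at points of the open set `dom`. -/
def ext (f : dom → ℂ) : Amb → ℂ := Function.extend Subtype.val f 0

theorem ext_apply (f : dom → ℂ) (p : dom) : ext f p = f p :=
  Subtype.val_injective.extend_apply f 0 p

theorem ext_eqOn (F : Amb → ℂ) : Set.EqOn (ext fun p : dom => F p) F dom :=
  fun p hp => ext_apply (fun p : dom => F p) ⟨p, hp⟩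

/-- The algebra `Ω⁰(ℝ⁴)` of smooth complex-valued functions on `ℝ⁴`. -/
def SpaceFn : Subalgebra ℂ (E4 → ℂ) where
  carrier := {f | ContDiff ℝ ∞ f}
  mul_mem' {f g} (hf : ContDiff ℝ ∞ f) (hg : ContDiff ℝ ∞ g) := (hf.mul hg :)
  add_mem' {f g} (hf : ContDiff ℝ ∞ f) (hg : ContDiff ℝ ∞ g) := (hf.add hg :)
  algebraMap_mem' c := (contDiff_const : ContDiff ℝ ∞ fun _ : E4 => c)

/-- The algebra of smooth complex-valued functions on `ℝ⁴ × (ℂ² ∖ 0) × (ℂ² ∖ 0)`. -/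
def AmbFn : Subalgebra ℂ (dom → ℂ) where
  carrier := {f | ContDiffOn ℝ ∞ (ext f) dom}
  mul_mem' {f g} hf hg := (ContDiffOn.mul hf hg).congr fun p hp => by
    simp only [ext_apply _ (⟨p, hp⟩ : dom), Pi.mul_apply]
  add_mem' {f g} hf hg := (ContDiffOn.add hf hg).congr fun p hp => by
    simp only [ext_apply _ (⟨p, hp⟩ : dom), Pi.add_apply]
  algebraMap_mem' c := (contDiffOn_const (c := c)).congr fun p hp =>
    ext_apply _ (⟨p, hp⟩ : dom)

/-- The restriction to `dom` of a function that is smooth there. -/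
def AmbFn.of (F : Amb → ℂ) (hF : ContDiffOn ℝ ∞ F dom) : AmbFn :=
  ⟨fun p => F p, hF.congr (ext_eqOn F)⟩

theorem contDiffOn_ext (f : AmbFn) : ContDiffOn ℝ ∞ (ext f) dom := f.2

theorem differentiableAt_ext (f : AmbFn) (p : dom) : DifferentiableAt ℝ (ext f) p :=
  ((contDiffOn_ext f).contDiffAt (isOpen_dom.mem_nhds p.2)).differentiableAt (by simp)

theorem ext_add (f g : AmbFn) : ext ((f : dom → ℂ) + (g : dom → ℂ)) = ext f + ext g := by
  funext p
  by_cases hp : p ∈ dom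
  · have := fun h => ext_apply h (⟨p, hp⟩ : dom)
    simp_all
  · simp [ext, hp]

theorem ext_smul (c : ℂ) (f : AmbFn) : ext (c • (f : dom → ℂ)) = c • ext f := by
  funext p
  by_cases hp : p ∈ dom
  · have := fun h => ext_apply h (⟨p, hp⟩ : dom)
    simp_all
  · simp [ext, hp]

/-- The derivative of functions on `ℝ⁴` in the (real) direction `v`. -/
def SpaceFn.dir (v : E4) : SpaceFn →ₗ[ℂ] SpaceFn where
  toFun f := ⟨fun x => fderiv ℝ (f : E4 → ℂ) x v,
    (ContDiff.fderiv_right (m := ∞) (show ContDiff ℝ ∞ (f : E4 → ℂ) from f.2)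
      (by simp)).clm_apply contDiff_const⟩
  map_add' f g := by
    ext x
    have hf := (show ContDiff ℝ ∞ (f : E4 → ℂ) from f.2).differentiable (by simp) x
    have hg := (show ContDiff ℝ ∞ (g : E4 → ℂ) from g.2).differentiable (by simp) x
    simp [fderiv_add hf hg]
  map_smul' c f := by
    ext x
    have hf := (show ContDiff ℝ ∞ (f : E4 → ℂ) from f.2).differentiable (by simp) x
    simp [fderiv_const_smul hf c]

/-- The derivative of functions on `ℝ⁴ × (ℂ² ∖ 0) × (ℂ² ∖ 0)` in the (real) direction `v`. -/
def AmbFn.dir (v : Amb) : AmbFn →ₗ[ℂ] AmbFn where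
  toFun f := AmbFn.of (fun p => fderiv ℝ (ext f) p v)
    (((contDiffOn_ext f).fderiv_of_isOpen isOpen_dom (m := ∞) (by simp)).clm_apply contDiffOn_const)
  map_add' f g := by
    ext p
    simp [AmbFn.of, ext_add, fderiv_add (differentiableAt_ext f p) (differentiableAt_ext g p)]
  map_smul' c f := by
    ext p
    simp [AmbFn.of, ext_smul, fderiv_const_smul (differentiableAt_ext f p) c]

/-- The pull-back of functions along the projection to `ℝ⁴`. -/
def pull : SpaceFn →ₐ[ℂ] AmbFn where
  toFun f := AmbFn.of (fun p => (f : E4 → ℂ) p.1)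
    ((show ContDiff ℝ ∞ (f : E4 → ℂ) from f.2).comp contDiff_fst).contDiffOn
  map_one' := rfl
  map_mul' _ _ := rfl
  map_zero' := rfl
  map_add' _ _ := rfl
  commutes' _ := rfl

/-! ### Spinor calculus -/

/-- `ε_{αβ}` with `ε_{12} = 1`. -/
def epsLow : Fin 2 → Fin 2 → ℂ := !![0, 1; -1, 0]

/-- `ε^{αβ}`, determined by `ε_{αγ} ε^{γβ} = δ_α^β`. -/
def epsUp : Fin 2 → Fin 2 → ℂ := !![0, -1; 1, 0]

/-- Raising an index: `v^α = ε^{αβ} v_β`. -/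
def raise {M : Type*} [AddCommGroup M] [Module ℂ M] (v : Fin 2 → M) (α : Fin 2) : M :=
  ∑ β, epsUp α β • v β

/-- The derivatives `∂_{αα̇} = ∂/∂x^{αα̇}` in terms of the partial derivatives `D₀, …, D₃` with
respect to the real Cartesian coordinates of `ℝ⁴`, where
`x^{11̇} = x⁰ + i x¹`, `x^{12̇} = x² + i x³`, `x^{21̇} = -(x² - i x³)`, `x^{22̇} = x⁰ - i x¹`. -/
def spinD {M : Type*} [AddCommGroup M] [Module ℂ M] (D : Fin 4 → M) : Fin 2 → Fin 2 → M :=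
  ![![(1 / 2 : ℂ) • (D 0 - Complex.I • D 1), (1 / 2 : ℂ) • (D 2 - Complex.I • D 3)],
    ![-((1 / 2 : ℂ) • (D 2 + Complex.I • D 3)), (1 / 2 : ℂ) • (D 0 + Complex.I • D 1)]]

/-- `∂_{αα̇}` on functions on `ℝ⁴`. -/
def pd : Fin 2 → Fin 2 → SpaceFn →ₗ[ℂ] SpaceFn :=
  spinD fun i => SpaceFn.dir (EuclideanSpace.single i 1)

/-- `∂/∂x^{αα̇}` on functions on `ℝ⁴ × (ℂ² ∖ 0) × (ℂ² ∖ 0)`. -/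
def pdx : Fin 2 → Fin 2 → AmbFn →ₗ[ℂ] AmbFn :=
  spinD fun i => AmbFn.dir (EuclideanSpace.single i 1, 0, 0)

/-- The Wirtinger derivative `∂/∂(conj λ_α̇)`. -/
def dLamBar (k : Fin 2) : AmbFn →ₗ[ℂ] AmbFn :=
  (1 / 2 : ℂ) • (AmbFn.dir (0, Pi.single k 1, 0) +
    Complex.I • AmbFn.dir (0, Pi.single k Complex.I, 0))

/-- The Wirtinger derivative `∂/∂(conj μ_α)`. -/
def dMuBar (k : Fin 2) : AmbFn →ₗ[ℂ] AmbFn :=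
  (1 / 2 : ℂ) • (AmbFn.dir (0, 0, Pi.single k 1) +
    Complex.I • AmbFn.dir (0, 0, Pi.single k Complex.I))

/-- The quaternionic structure `(v₁, v₂) ↦ (-conj v₂, conj v₁)` on spinors. -/
def hat (v : Fin 2 → ℂ) : Fin 2 → ℂ := ![-(starRingEnd ℂ (v 1)), starRingEnd ℂ (v 0)]

/-- `|v|² = v_α v̂^α`. -/
def spinNorm (v : Fin 2 → ℂ) : ℂ := ∑ α, v α * raise (hat v) α

theorem spinNorm_eq (v : Fin 2 → ℂ) :
    spinNorm v = -((Complex.normSq (v 0) + Complex.normSq (v 1) : ℝ) : ℂ) := by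
  simp only [spinNorm, raise, hat, epsUp, Fin.sum_univ_two, Complex.ofReal_add,
    Complex.normSq_eq_conj_mul_self]
  simp
  ring

theorem spinNorm_ne_zero {v : Fin 2 → ℂ} (hv : v ≠ 0) : spinNorm v ≠ 0 := by
  rw [spinNorm_eq, neg_ne_zero, Complex.ofReal_ne_zero]
  intro h
  apply hv
  have h0 := Complex.normSq_nonneg (v 0)
  have h1 := Complex.normSq_nonneg (v 1)
  funext i
  fin_cases i
  · exact Complex.normSq_eq_zero.1 (by simp only [Fin.zero_eta]; linarith)
  · exact Complex.normSq_eq_zero.1 (by simp only [Fin.mk_one]; linarith)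

theorem contDiff_spinNorm : ContDiff ℝ ∞ spinNorm := by
  have : spinNorm = fun v => -(v 0 * Complex.conjCLE (v 0) + v 1 * Complex.conjCLE (v 1)) := by
    funext v
    simp only [spinNorm, raise, hat, epsUp, Fin.sum_univ_two]
    simp
    ring
  rw [this]
  fun_prop

theorem contDiff_hat (k : Fin 2) : ContDiff ℝ ∞ fun v => hat v k := by
  fin_cases k
  · have : (fun v => hat v 0) = fun v : Fin 2 → ℂ => -Complex.conjCLE (v 1) := by
      funext v; simp [hat]
    simp only [Fin.zero_eta, this]
    fun_prop
  · have : (fun v => hat v 1) = fun v : Fin 2 → ℂ => Complex.conjCLE (v 0) := by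
      funext v; simp [hat]
    simp only [Fin.mk_one, this]
    fun_prop

/-- The coordinate function `λ_α̇`. -/
def lam (k : Fin 2) : AmbFn := AmbFn.of (fun p => p.2.1 k) (by fun_prop)

/-- The coordinate function `μ_α`. -/
def mu (k : Fin 2) : AmbFn := AmbFn.of (fun p => p.2.2 k) (by fun_prop)

/-- The function `|λ|²`. -/
def nLam : AmbFn := AmbFn.of (fun p => spinNorm p.2.1)
  (contDiff_spinNorm.comp (contDiff_fst.comp contDiff_snd)).contDiffOn

/-- The function `|μ|²`. -/
def nMu : AmbFn := AmbFn.of (fun p => spinNorm p.2.2)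
  (contDiff_spinNorm.comp (contDiff_snd.comp contDiff_snd)).contDiffOn

/-- The function `λ̂_α̇ / |λ|²`. -/
def lamHatN (k : Fin 2) : AmbFn := AmbFn.of (fun p => hat p.2.1 k * (spinNorm p.2.1)⁻¹)
  (((contDiff_hat k).comp (contDiff_fst.comp contDiff_snd)).contDiffOn.mul
    ((contDiff_spinNorm.comp (contDiff_fst.comp contDiff_snd)).contDiffOn.inv
      fun _ hp => spinNorm_ne_zero hp.1))

/-- The function `μ̂_α / |μ|²`. -/
def muHatN (k : Fin 2) : AmbFn := AmbFn.of (fun p => hat p.2.2 k * (spinNorm p.2.2)⁻¹)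
  (((contDiff_hat k).comp (contDiff_snd.comp contDiff_snd)).contDiffOn.mul
    ((contDiff_spinNorm.comp (contDiff_snd.comp contDiff_snd)).contDiffOn.inv
      fun _ hp => spinNorm_ne_zero hp.2))

/-- `λ^α̇`. -/
def lu : Fin 2 → AmbFn := raise lam
/-- `μ^α`. -/
def mv : Fin 2 → AmbFn := raise mu
/-- `λ̂^α̇ / |λ|²`. -/
def lh : Fin 2 → AmbFn := raise lamHatN
/-- `μ̂^α / |μ|²`. -/
def mh : Fin 2 → AmbFn := raise muHatN

/-- `∂/∂λ̂_α̇`, where `λ̂ = (-conj λ₂, conj λ₁)`. -/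
def dLamHat : Fin 2 → AmbFn →ₗ[ℂ] AmbFn := ![-dLamBar 1, dLamBar 0]

/-- `∂/∂μ̂_α`, where `μ̂ = (-conj μ₂, conj μ₁)`. -/
def dMuHat : Fin 2 → AmbFn →ₗ[ℂ] AmbFn := ![-dMuBar 1, dMuBar 0]

/-! ### The vector fields -/

/-- `Ê_F = μ^α λ^α̇ ∂_{αα̇}`. -/
def hatEF : AmbFn →ₗ[ℂ] AmbFn := ∑ α, ∑ β, (mv α * lu β) • pdx α β

/-- `Ê_L = |λ|² λ_α̇ ∂/∂λ̂_α̇`. -/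
def hatEL : AmbFn →ₗ[ℂ] AmbFn := ∑ β, (nLam * lam β) • dLamHat β

/-- `Ê_R = |μ|² μ_α ∂/∂μ̂_α`. -/
def hatER : AmbFn →ₗ[ℂ] AmbFn := ∑ α, (nMu * mu α) • dMuHat α

/-- `E_W = |λ|⁻² μ^α λ̂^α̇ ∂_{αα̇}`. -/
def EW : AmbFn →ₗ[ℂ] AmbFn := ∑ α, ∑ β, (mv α * lh β) • pdx α β

/-- `E_Ŵ = -|μ|⁻² μ̂^α λ^α̇ ∂_{αα̇}`. -/
def EWhat : AmbFn →ₗ[ℂ] AmbFn := -∑ α, ∑ β, (mh α * lu β) • pdx α β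

/-! ### Superfunctions -/

/-- The Grassmann algebra on the six generators `η₁, η₂, η₃, θ¹, θ², θ³`. -/
abbrev Gr : Type := ExteriorAlgebra ℂ ((Fin 3 → ℂ) × (Fin 3 → ℂ))

/-- `η_i`. -/
def eta (i : Fin 3) : Gr := ExteriorAlgebra.ι ℂ (Pi.single i 1, 0)

/-- `θ^i`. -/
def theta (i : Fin 3) : Gr := ExteriorAlgebra.ι ℂ (0, Pi.single i 1)

/-- `θ^i η_i`. -/
def thEta : Gr := ∑ i, theta i * eta i

/-- Smooth functions of `(x, λ, μ, η_i, θ^i)`. -/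
abbrev SuperFn : Type := Gr ⊗[ℂ] AmbFn

/-- The substitution `(η, θ) ↦ (t η, s θ)`. -/
def scaleGr (t s : ℂˣ) : Gr →ₐ[ℂ] Gr :=
  ExteriorAlgebra.map (((t : ℂ) • LinearMap.id).prodMap ((s : ℂ) • LinearMap.id))

/-- The map `(x, λ, μ) ↦ (x, t λ, s μ)`. -/
def scalePt (t s : ℂˣ) : Amb →L[ℝ] Amb :=
  (ContinuousLinearMap.id ℝ E4).prodMap
    (((t : ℂ) • ContinuousLinearMap.id ℝ (Fin 2 → ℂ)).prodMap
      ((s : ℂ) • ContinuousLinearMap.id ℝ (Fin 2 → ℂ)))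

theorem scalePt_mem (t s : ℂˣ) {p : Amb} (hp : p ∈ dom) : scalePt t s p ∈ dom :=
  ⟨smul_ne_zero t.ne_zero hp.1, smul_ne_zero s.ne_zero hp.2⟩

/-- The substitution `(x, λ, μ) ↦ (x, t λ, s μ)`. -/
def scaleFn (t s : ℂˣ) : AmbFn →ₐ[ℂ] AmbFn where
  toFun f := ⟨fun p => f.1 ⟨scalePt t s p, scalePt_mem t s p.2⟩,
    ((contDiffOn_ext f).comp (scalePt t s).contDiff.contDiffOn fun _ hp => scalePt_mem t s hp).congr
      fun p hp => by
        rw [ext_apply _ (⟨p, hp⟩ : dom), Function.comp_apply,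
          ext_apply _ (⟨scalePt t s p, scalePt_mem t s hp⟩ : dom)]⟩
  map_one' := rfl
  map_mul' _ _ := rfl
  map_zero' := rfl
  map_add' _ _ := rfl
  commutes' _ := rfl

/-- The substitution `(x, λ, μ, η, θ) ↦ (x, t λ, s μ, t η, s θ)`. -/
def scale (t s : ℂˣ) : SuperFn →ₗ[ℂ] SuperFn :=
  TensorProduct.map (scaleGr t s).toLinearMap (scaleFn t s).toLinearMap

/-- Smooth functions on `ℝ⁴ × ℂP¹ × ℂP¹` with values in `𝒪(k, l)` that depend holomorphically on
the fermionic coordinates `η_i`, `θ^i`: superfunctions `f` with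
`f(x, t λ, s μ, t η, s θ) = t^k s^l f(x, λ, μ, η, θ)`. -/
def Sec (k l : ℤ) : Submodule ℂ SuperFn where
  carrier := {f | ∀ t s : ℂˣ, scale t s f = ((t : ℂ) ^ k * (s : ℂ) ^ l) • f}
  add_mem' {f g} hf hg t s := by rw [map_add, hf t s, hg t s, smul_add]
  zero_mem' t s := by simp
  smul_mem' c f hf t s := by rw [map_smul, hf t s, smul_comm]

/-- Multiplication by `θ^i η_i`. -/
def mulThEta : SuperFn →ₗ[ℂ] SuperFn :=
  TensorProduct.map (LinearMap.mulLeft ℂ thEta) LinearMap.id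

/-- `V̂_F = Ê_F`. -/
def hatVF : SuperFn →ₗ[ℂ] SuperFn := TensorProduct.map LinearMap.id hatEF

/-- `V̂_L = Ê_L + θ^i η_i E_Ŵ`. -/
def hatVL : SuperFn →ₗ[ℂ] SuperFn :=
  TensorProduct.map LinearMap.id hatEL + TensorProduct.map (LinearMap.mulLeft ℂ thEta) EWhat

/-- `V̂_R = Ê_R + θ^i η_i E_W`. -/
def hatVR : SuperFn →ₗ[ℂ] SuperFn :=
  TensorProduct.map LinearMap.id hatER + TensorProduct.map (LinearMap.mulLeft ℂ thEta) EW

/-! ### Homogeneity -/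

theorem dir_scaleFn (t s : ℂˣ) (v : Amb) (f : AmbFn) :
    AmbFn.dir v (scaleFn t s f) = scaleFn t s (AmbFn.dir (scalePt t s v) f) := by
  ext p
  have hq : scalePt t s p ∈ dom := scalePt_mem t s p.2
  have h : ext (scaleFn t s f : AmbFn) = ext f ∘ scalePt t s := by
    funext q
    by_cases hq : q ∈ dom
    · rw [ext_apply _ (⟨q, hq⟩ : dom), Function.comp_apply,
          ext_apply _ (⟨scalePt t s q, scalePt_mem t s hq⟩ : dom)]
      rfl
    · have hq' : scalePt t s q ∉ dom := fun h => hq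
        ⟨fun h0 => h.1 (by simp [scalePt, h0]), fun h0 => h.2 (by simp [scalePt, h0])⟩
      simp [ext, hq, hq']
  change fderiv ℝ (ext (scaleFn t s f : AmbFn)) p v =
    fderiv ℝ (ext f) (scalePt t s p) (scalePt t s v)
  rw [h, fderiv_comp (p : Amb) (differentiableAt_ext f ⟨_, hq⟩)
    (scalePt t s).differentiableAt, ContinuousLinearMap.fderiv]
  rfl

theorem dir_add (v w : Amb) : AmbFn.dir (v + w) = AmbFn.dir v + AmbFn.dir w := by
  ext f p
  simp [AmbFn.dir, AmbFn.of]

theorem dir_smul (r : ℝ) (v : Amb) : AmbFn.dir (r • v) = (r : ℂ) • AmbFn.dir v := by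
  ext f p
  simp [AmbFn.dir, AmbFn.of]

theorem dLamBar_scaleFn (t s : ℂˣ) (k : Fin 2) (f : AmbFn) :
    dLamBar k (scaleFn t s f) = starRingEnd ℂ (t : ℂ) • scaleFn t s (dLamBar k f) := by
  have h (z : ℂ) : scalePt t s (0, Pi.single k z, 0) =
      ((t : ℂ) * z).re • ((0, Pi.single k 1, 0) : Amb) +
      ((t : ℂ) * z).im • ((0, Pi.single k Complex.I, 0) : Amb) := by
    refine Prod.ext (by simp [scalePt]) (Prod.ext ?_ (by simp [scalePt]))
    funext j
    by_cases hj : j = k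
    · subst hj
      simp [scalePt, -Complex.mul_re, -Complex.mul_im, Complex.re_add_im]
    · simp [scalePt, hj]
  simp only [dLamBar, LinearMap.smul_apply, LinearMap.add_apply, dir_scaleFn, h, dir_add, dir_smul,
    map_add, map_smul]
  have ht : starRingEnd ℂ (t : ℂ) = ((t : ℂ).re : ℂ) - ((t : ℂ).im : ℂ) * Complex.I := by
    apply Complex.ext <;> simp
  rw [ht]
  match_scalars
  · simp
    ring
  · simp
    ring_nf
    rw [Complex.I_sq]
    ring

theorem dMuBar_scaleFn (t s : ℂˣ) (k : Fin 2) (f : AmbFn) :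
    dMuBar k (scaleFn t s f) = starRingEnd ℂ (s : ℂ) • scaleFn t s (dMuBar k f) := by
  have h (z : ℂ) : scalePt t s (0, 0, Pi.single k z) =
      ((s : ℂ) * z).re • ((0, 0, Pi.single k 1) : Amb) +
      ((s : ℂ) * z).im • ((0, 0, Pi.single k Complex.I) : Amb) := by
    refine Prod.ext (by simp [scalePt]) (Prod.ext (by simp [scalePt]) ?_)
    funext j
    by_cases hj : j = k
    · subst hj
      simp [scalePt, -Complex.mul_re, -Complex.mul_im, Complex.re_add_im]
    · simp [scalePt, hj]
  simp only [dMuBar, LinearMap.smul_apply, LinearMap.add_apply, dir_scaleFn, h, dir_add, dir_smul,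
    map_add, map_smul]
  have ht : starRingEnd ℂ (s : ℂ) = ((s : ℂ).re : ℂ) - ((s : ℂ).im : ℂ) * Complex.I := by
    apply Complex.ext <;> simp
  rw [ht]
  match_scalars
  · simp
    ring
  · simp
    ring_nf
    rw [Complex.I_sq]
    ring

theorem pdx_scaleFn (t s : ℂˣ) (α β : Fin 2) (f : AmbFn) :
    pdx α β (scaleFn t s f) = scaleFn t s (pdx α β f) := by
  have h (i : Fin 4) : scalePt t s (EuclideanSpace.single i 1, 0, 0) =
      ((EuclideanSpace.single i 1, 0, 0) : Amb) := by
    refine Prod.ext (by simp [scalePt]) (Prod.ext (by simp [scalePt]) (by simp [scalePt]))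
  fin_cases α <;> fin_cases β <;> simp [pdx, spinD, dir_scaleFn, h]

/-- Smooth functions on `ℝ⁴ × ℂP¹ × ℂP¹` with values in `𝒪(k, l)`. -/
def Homog (k l : ℤ) : Submodule ℂ AmbFn where
  carrier := {f | ∀ t s : ℂˣ, scaleFn t s f = ((t : ℂ) ^ k * (s : ℂ) ^ l) • f}
  add_mem' {f g} hf hg t s := by rw [map_add, hf t s, hg t s, smul_add]
  zero_mem' t s := by simp
  smul_mem' c f hf t s := by rw [map_smul, hf t s, smul_comm]

theorem Homog.mul {k l k' l' : ℤ} {f g : AmbFn} (hf : f ∈ Homog k l) (hg : g ∈ Homog k' l') :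
    f * g ∈ Homog (k + k') (l + l') := fun t s => by
  rw [map_mul, hf t s, hg t s, smul_mul_smul_comm, zpow_add₀ t.ne_zero, zpow_add₀ s.ne_zero]
  congr 1
  ring

theorem hat_smul (t : ℂ) (v : Fin 2 → ℂ) (k : Fin 2) :
    hat (t • v) k = starRingEnd ℂ t * hat v k := by
  fin_cases k <;> simp [hat]

theorem spinNorm_smul (t : ℂ) (v : Fin 2 → ℂ) :
    spinNorm (t • v) = t * starRingEnd ℂ t * spinNorm v := by
  simp only [spinNorm, raise, hat_smul, Fin.sum_univ_two, Pi.smul_apply, smul_eq_mul]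
  ring

theorem pull_mem (f : SpaceFn) : pull f ∈ Homog 0 0 := fun t s => by
  simp only [zpow_zero, mul_one, one_smul]
  rfl

theorem lam_mem (k : Fin 2) : lam k ∈ Homog 1 0 := fun t s => by
  simp only [zpow_zero, mul_one, zpow_one]
  rfl

theorem mu_mem (k : Fin 2) : mu k ∈ Homog 0 1 := fun t s => by
  simp only [zpow_zero, one_mul, zpow_one]
  rfl

theorem lamHatN_mem (k : Fin 2) : lamHatN k ∈ Homog (-1) 0 := fun t s => by
  ext p
  have hn := spinNorm_ne_zero p.2.1
  have ht := t.ne_zero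
  have ht' : starRingEnd ℂ (t : ℂ) ≠ 0 := by simp
  change hat ((t : ℂ) • p.1.2.1) k * (spinNorm ((t : ℂ) • p.1.2.1))⁻¹ =
    ((t : ℂ) ^ (-1 : ℤ) * (s : ℂ) ^ (0 : ℤ)) * (hat p.1.2.1 k * (spinNorm p.1.2.1)⁻¹)
  rw [hat_smul, spinNorm_smul, zpow_neg_one, zpow_zero]
  field_simp

theorem muHatN_mem (k : Fin 2) : muHatN k ∈ Homog 0 (-1) := fun t s => by
  ext p
  have hn := spinNorm_ne_zero p.2.2
  have hs := s.ne_zero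
  have hs' : starRingEnd ℂ (s : ℂ) ≠ 0 := by simp
  change hat ((s : ℂ) • p.1.2.2) k * (spinNorm ((s : ℂ) • p.1.2.2))⁻¹ =
    ((t : ℂ) ^ (0 : ℤ) * (s : ℂ) ^ (-1 : ℤ)) * (hat p.1.2.2 k * (spinNorm p.1.2.2)⁻¹)
  rw [hat_smul, spinNorm_smul, zpow_neg_one, zpow_zero]
  field_simp

theorem raise_mem {k l : ℤ} {v : Fin 2 → AmbFn} (hv : ∀ i, v i ∈ Homog k l) (i : Fin 2) :
    raise v i ∈ Homog k l :=
  sum_mem fun j _ => Submodule.smul_mem _ _ (hv j)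

theorem lu_mem (i : Fin 2) : lu i ∈ Homog 1 0 := raise_mem lam_mem i
theorem mv_mem (i : Fin 2) : mv i ∈ Homog 0 1 := raise_mem mu_mem i
theorem lh_mem (i : Fin 2) : lh i ∈ Homog (-1) 0 := raise_mem lamHatN_mem i
theorem mh_mem (i : Fin 2) : mh i ∈ Homog 0 (-1) := raise_mem muHatN_mem i

/-- Operators on functions which raise the weight by `(a, b)`. -/
def Shifts (a b : ℤ) (D : AmbFn →ₗ[ℂ] AmbFn) : Prop :=
  ∀ (t s : ℂˣ) (f : AmbFn), scaleFn t s (D f) = ((t : ℂ) ^ a * (s : ℂ) ^ b) • D (scaleFn t s f)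

theorem Shifts.sum {a b : ℤ} {ι : Type*} [Fintype ι] {D : ι → AmbFn →ₗ[ℂ] AmbFn}
    (h : ∀ i, Shifts a b (D i)) : Shifts a b (∑ i, D i) := fun t s f => by
  simp only [LinearMap.sum_apply, map_sum, Finset.smul_sum, h _ t s f]

theorem Shifts.neg {a b : ℤ} {D : AmbFn →ₗ[ℂ] AmbFn} (h : Shifts a b D) : Shifts a b (-D) :=
  fun t s f => by simp only [LinearMap.neg_apply, map_neg, h t s f, smul_neg]

theorem shifts_smul_pdx {a b : ℤ} {h : AmbFn} (hh : h ∈ Homog a b) (α β : Fin 2) :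
    Shifts a b (h • pdx α β) := fun t s f => by
  simp only [LinearMap.smul_apply, smul_eq_mul, map_mul, hh t s, pdx_scaleFn, smul_mul_assoc]

theorem shifts_hatEF : Shifts 1 1 hatEF :=
  .sum fun α => .sum fun β => shifts_smul_pdx (by simpa using Homog.mul (mv_mem α) (lu_mem β)) α β

theorem shifts_EW : Shifts (-1) 1 EW :=
  .sum fun α => .sum fun β => shifts_smul_pdx (by simpa using Homog.mul (mv_mem α) (lh_mem β)) α β

theorem shifts_EWhat : Shifts 1 (-1) EWhat :=
  .neg (.sum fun α => .sum fun β => shifts_smul_pdx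
    (by simpa using Homog.mul (mh_mem α) (lu_mem β)) α β)

theorem shifts_hatEL : Shifts 2 0 hatEL := .sum fun β => fun t s f => by
  have hl := lam_mem β t s
  have hn : scaleFn t s nLam = ((t : ℂ) * starRingEnd ℂ (t : ℂ)) • nLam := by
    ext p
    exact spinNorm_smul _ _
  have ht : starRingEnd ℂ (t : ℂ) ≠ 0 := by simp
  have hd : dLamHat β (scaleFn t s f) = starRingEnd ℂ (t : ℂ) • scaleFn t s (dLamHat β f) := by
    fin_cases β <;> simp [dLamHat, dLamBar_scaleFn]
  simp only [LinearMap.smul_apply, smul_eq_mul, map_mul, hn, hl, hd, smul_mul_assoc,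
    mul_smul_comm, smul_smul, zpow_ofNat]
  congr 1
  ring

theorem shifts_hatER : Shifts 0 2 hatER := .sum fun β => fun t s f => by
  have hl := mu_mem β t s
  have hn : scaleFn t s nMu = ((s : ℂ) * starRingEnd ℂ (s : ℂ)) • nMu := by
    ext p
    exact spinNorm_smul _ _
  have hd : dMuHat β (scaleFn t s f) = starRingEnd ℂ (s : ℂ) • scaleFn t s (dMuHat β f) := by
    fin_cases β <;> simp [dMuHat, dMuBar_scaleFn]
  simp only [LinearMap.smul_apply, smul_eq_mul, map_mul, hn, hl, hd, smul_mul_assoc,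
    mul_smul_comm, smul_smul, zpow_ofNat]
  congr 1
  ring

/-- Grassmann elements of degree `a` in `η` and `b` in `θ`. -/
def GrWt (a b : ℕ) (w : Gr) : Prop := ∀ t s : ℂˣ, scaleGr t s w = ((t : ℂ) ^ a * (s : ℂ) ^ b) • w

theorem GrWt.one : GrWt 0 0 1 := fun t s => by simp

theorem GrWt.mul {a b a' b' : ℕ} {w w' : Gr} (h : GrWt a b w) (h' : GrWt a' b' w') :
    GrWt (a + a') (b + b') (w * w') := fun t s => by
  rw [map_mul, h t s, h' t s, smul_mul_smul_comm, pow_add, pow_add]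
  congr 1
  ring

theorem GrWt.eta (i : Fin 3) : GrWt 1 0 (eta i) := fun t s => by
  rw [CRAmbitwistor.eta, scaleGr, ExteriorAlgebra.map_apply_ι, ← map_smul]
  simp

theorem GrWt.theta (i : Fin 3) : GrWt 0 1 (theta i) := fun t s => by
  rw [CRAmbitwistor.theta, scaleGr, ExteriorAlgebra.map_apply_ι, ← map_smul]
  simp

theorem GrWt.thEta : GrWt 1 1 thEta := fun t s => by
  rw [CRAmbitwistor.thEta, map_sum, Finset.smul_sum]
  exact Finset.sum_congr rfl fun i _ => (GrWt.theta i).mul (GrWt.eta i) t s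

theorem GrWt.pow (n : ℕ) : GrWt n n (CRAmbitwistor.thEta ^ n) := by
  induction n with
  | zero => simpa using GrWt.one
  | succ n ih => rw [pow_succ]; exact ih.mul GrWt.thEta

theorem tmul_mem {a b : ℕ} {k l k' l' : ℤ} {w : Gr} {f : AmbFn} (hw : GrWt a b w)
    (hf : f ∈ Homog k' l') (hk : k = a + k') (hl : l = b + l') : w ⊗ₜ[ℂ] f ∈ Sec k l := fun t s => by
  change scaleGr t s w ⊗ₜ[ℂ] scaleFn t s f = _
  rw [hw t s, hf t s, TensorProduct.smul_tmul_smul, hk, hl, zpow_add₀ t.ne_zero,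
    zpow_add₀ s.ne_zero]
  congr 1
  simp only [zpow_natCast]
  ring

theorem map_mem {a b : ℕ} {c d k l k' l' : ℤ} {w : Gr} {D : AmbFn →ₗ[ℂ] AmbFn} (hw : GrWt a b w)
    (hD : Shifts c d D) (hk : k' = k + a + c) (hl : l' = l + b + d) {f : SuperFn}
    (hf : f ∈ Sec k l) : TensorProduct.map (LinearMap.mulLeft ℂ w) D f ∈ Sec k' l' := fun t s => by
  have h : scale t s ∘ₗ TensorProduct.map (LinearMap.mulLeft ℂ w) D =
      ((t : ℂ) ^ (a + c) * (s : ℂ) ^ (b + d)) •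
        (TensorProduct.map (LinearMap.mulLeft ℂ w) D ∘ₗ scale t s) := by
    ext x y
    change scaleGr t s (w * x) ⊗ₜ[ℂ] scaleFn t s (D y) =
      ((t : ℂ) ^ (a + c) * (s : ℂ) ^ (b + d)) • ((w * scaleGr t s x) ⊗ₜ[ℂ] D (scaleFn t s y))
    rw [map_mul, hw t s, hD t s, smul_mul_assoc, TensorProduct.smul_tmul_smul,
      zpow_add₀ t.ne_zero, zpow_add₀ s.ne_zero]
    congr 1
    simp only [zpow_natCast]
    ring
  have h' := congrArg (fun F => F f) h
  simp only [LinearMap.comp_apply, LinearMap.smul_apply, hf t s, map_smul, smul_smul] at h'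
  rw [h', hk, hl]
  congr 1
  simp only [zpow_add₀ t.ne_zero, zpow_add₀ s.ne_zero]
  ring

theorem map_id_mem {c d k l k' l' : ℤ} {D : AmbFn →ₗ[ℂ] AmbFn} (hD : Shifts c d D)
    (hk : k' = k + c) (hl : l' = l + d) {f : SuperFn} (hf : f ∈ Sec k l) :
    TensorProduct.map LinearMap.id D f ∈ Sec k' l' := by
  have := map_mem GrWt.one hD (k' := k') (l' := l') (by simpa using hk) (by simpa using hl) hf
  rwa [LinearMap.mulLeft_one] at this

theorem mulThEta_mem {k l k' l' : ℤ} (hk : k' = k + 1) (hl : l' = l + 1) {f : SuperFn}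
    (hf : f ∈ Sec k l) : mulThEta f ∈ Sec k' l' :=
  map_mem (c := 0) (d := 0) GrWt.thEta (fun t s f => by simp) (by simpa using hk)
    (by simpa using hl) hf

theorem hatVF_mem {k l k' l' : ℤ} (hk : k' = k + 1) (hl : l' = l + 1) {f : SuperFn}
    (hf : f ∈ Sec k l) : hatVF f ∈ Sec k' l' := map_id_mem shifts_hatEF hk hl hf

theorem hatVL_mem {k l k' : ℤ} (hk : k' = k + 2) {f : SuperFn}
    (hf : f ∈ Sec k l) : hatVL f ∈ Sec k' l :=
  add_mem (map_id_mem shifts_hatEL hk (by ring) hf)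
    (map_mem GrWt.thEta shifts_EWhat (by rw [hk]; push_cast; ring) (by push_cast; ring) hf)

theorem hatVR_mem {k l l' : ℤ} (hl : l' = l + 2) {f : SuperFn}
    (hf : f ∈ Sec k l) : hatVR f ∈ Sec k l' :=
  add_mem (map_id_mem shifts_hatER (by ring) hl hf)
    (map_mem GrWt.thEta shifts_EW (by push_cast; ring) (by rw [hl]; push_cast; ring) hf)

/-! ### The reduced twisted CR complex

A `p`-form is given by its coefficients with respect to `v̂^F, v̂^L, v̂^R`, to
`v̂^L ∧ v̂^R, v̂^F ∧ v̂^L, v̂^F ∧ v̂^R`, and to `v̂^F ∧ v̂^L ∧ v̂^R`, respectively. Since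
`v̂^F, v̂^L, v̂^R` have weights `(-1, -1)`, `(-2, 0)`, `(0, -2)`, the coefficients have the
opposite weights. -/

/-- `(0,0)`-forms. -/
abbrev Form0 : Type := Sec 0 0
/-- `(0,1)`-forms `v̂^F f_F + v̂^L f_L + v̂^R f_R`, as triples `(f_F, f_L, f_R)`. -/
abbrev Form1 : Type := Sec 1 1 × Sec 2 0 × Sec 0 2
/-- `(0,2)`-forms `v̂^L ∧ v̂^R f_LR + v̂^F ∧ v̂^L f_FL + v̂^F ∧ v̂^R f_FR`, as triples
`(f_LR, f_FL, f_FR)`. -/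
abbrev Form2 : Type := Sec 2 2 × Sec 3 1 × Sec 1 3
/-- `(0,3)`-forms `v̂^F ∧ v̂^L ∧ v̂^R f_FLR`. -/
abbrev Form3 : Type := Sec 3 3

/-- The differential `v̂^F V̂_F + v̂^L V̂_L + v̂^R V̂_R` on functions. -/
def dbar0 : Form0 →ₗ[ℂ] Form1 where
  toFun f := (⟨hatVF f, hatVF_mem (by norm_num) (by norm_num) f.2⟩,
    ⟨hatVL f, hatVL_mem (by norm_num) f.2⟩, ⟨hatVR f, hatVR_mem (by norm_num) f.2⟩)
  map_add' f g := by
    refine Prod.ext ?_ (Prod.ext ?_ ?_) <;> apply Subtype.ext <;> simp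
  map_smul' c f := by
    refine Prod.ext ?_ (Prod.ext ?_ ?_) <;> apply Subtype.ext <;> simp

/-- The differential on one-forms. Because of `[V̂_L, V̂_R] = 2 θ^i η_i V̂_F`, the other
commutators being zero, one has `d v̂^F = -2 θ^i η_i v̂^L ∧ v̂^R` and `d v̂^L = 0 = d v̂^R`. -/
def dbar1 : Form1 →ₗ[ℂ] Form2 where
  toFun A :=
    (⟨hatVL A.2.2 - hatVR A.2.1 - (2 : ℂ) • mulThEta A.1,
      sub_mem (sub_mem (hatVL_mem (by norm_num) A.2.2.2) (hatVR_mem (by norm_num) A.2.1.2))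
        (Submodule.smul_mem _ _ (mulThEta_mem (by norm_num) (by norm_num) A.1.2))⟩,
     ⟨hatVF A.2.1 - hatVL A.1,
      sub_mem (hatVF_mem (by norm_num) (by norm_num) A.2.1.2) (hatVL_mem (by norm_num) A.1.2)⟩,
     ⟨hatVF A.2.2 - hatVR A.1,
      sub_mem (hatVF_mem (by norm_num) (by norm_num) A.2.2.2) (hatVR_mem (by norm_num) A.1.2)⟩)
  map_add' f g := by
    refine Prod.ext ?_ (Prod.ext ?_ ?_) <;> apply Subtype.ext <;> simp <;> module
  map_smul' c f := by
    refine Prod.ext ?_ (Prod.ext ?_ ?_) <;> apply Subtype.ext <;> simp <;> module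

/-- The differential on two-forms. -/
def dbar2 : Form2 →ₗ[ℂ] Form3 where
  toFun W := ⟨hatVF W.1 - hatVL W.2.2 + hatVR W.2.1,
    add_mem (sub_mem (hatVF_mem (by norm_num) (by norm_num) W.1.2)
      (hatVL_mem (by norm_num) W.2.2.2)) (hatVR_mem (by norm_num) W.2.1.2)⟩
  map_add' f g := by apply Subtype.ext; simp; module
  map_smul' c f := by apply Subtype.ext; simp; module

/-! ### Spinor-tensor fields on `ℝ⁴` -/

/-- Fields with one spinor index. -/
abbrev T1 : Type := Fin 2 → SpaceFn
/-- Fields with two spinor indices. -/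
abbrev T2 : Type := Fin 2 → T1
/-- Fields with three spinor indices. -/
abbrev T3 : Type := Fin 2 → T2
/-- Fields with four spinor indices. -/
abbrev T4 : Type := Fin 2 → T3
/-- Fields with five spinor indices. -/
abbrev T5 : Type := Fin 2 → T4
/-- Fields with six spinor indices. -/
abbrev T6 : Type := Fin 2 → T5

/-- Normalised symmetrisation in two indices. -/
def sym2 : T2 →ₗ[ℂ] T2 where
  toFun T a b := (1 / 2 : ℂ) • (T a b + T b a)
  map_add' S T := by funext a b; simp only [Pi.add_apply]; module
  map_smul' c T := by funext a b; simp only [Pi.smul_apply, RingHom.id_apply]; module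

/-- Normalised total symmetrisation in three indices. -/
def sym3 : T3 →ₗ[ℂ] T3 where
  toFun T a b c := (1 / 3 : ℂ) • (sym2 (T a) b c + sym2 (T b) a c + sym2 (T c) a b)
  map_add' S T := by funext a b c; simp only [Pi.add_apply, map_add]; module
  map_smul' c T := by
    funext a b d; simp only [Pi.smul_apply, map_smul, RingHom.id_apply]; module

/-- Normalised total symmetrisation in four indices. -/
def sym4 : T4 →ₗ[ℂ] T4 where
  toFun T a b c d :=
    (1 / 4 : ℂ) • (sym3 (T a) b c d + sym3 (T b) a c d + sym3 (T c) a b d + sym3 (T d) a b c)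
  map_add' S T := by funext a b c d; simp only [Pi.add_apply, map_add]; module
  map_smul' c T := by
    funext a b d e; simp only [Pi.smul_apply, map_smul, RingHom.id_apply]; module

/-- `∂_{αα̇} φ`. -/
def grad : SpaceFn →ₗ[ℂ] T2 where
  toFun f a x := pd a x f
  map_add' f g := by funext a x; simp
  map_smul' c f := by funext a x; simp

/-- `∂_{αα̇} ∂_{ββ̇} φ`, with indices in the order `α, α̇, β, β̇`. -/
def grad2 : SpaceFn →ₗ[ℂ] T4 where
  toFun f a x b y := pd a x (pd b y f)
  map_add' f g := by funext a x b y; simp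
  map_smul' c f := by funext a x b y; simp

/-- The Laplacian `2 ∂^{αα̇} ∂_{αα̇}`. -/
def box : SpaceFn →ₗ[ℂ] SpaceFn :=
  (2 : ℂ) • ∑ a, ∑ b, ∑ x, ∑ y, (epsUp a b * epsUp x y) • (pd b y ∘ₗ pd a x)

/-- `∂_{α(α̇} χ_{β̇)}`, with indices in the order `α, α̇, β̇`. -/
def gradDot : T1 →ₗ[ℂ] T3 where
  toFun f a := sym2 fun x y => pd a x (f y)
  map_add' f g := by
    funext a
    refine (congrArg sym2 ?_).trans (map_add sym2 _ _)
    funext x y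
    simp
  map_smul' r f := by
    funext a
    refine (congrArg sym2 ?_).trans (map_smul sym2 r _)
    funext x y
    simp

/-- `∂_{(αα̇} ψ_{β)}`, with indices in the order `α̇, α, β`. -/
def gradUnd : T1 →ₗ[ℂ] T3 where
  toFun f x := sym2 fun a b => pd a x (f b)
  map_add' f g := by
    funext x
    refine (congrArg sym2 ?_).trans (map_add sym2 _ _)
    funext a b
    simp
  map_smul' r f := by
    funext x
    refine (congrArg sym2 ?_).trans (map_smul sym2 r _)
    funext a b
    simp

/-- `∂_{α(α̇} ∂_{ββ̇} χ_{γ̇)}`, with indices in the order `α, β, α̇, β̇, γ̇`. -/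
def grad2Dot : T1 →ₗ[ℂ] T5 where
  toFun f a b := sym3 fun x y z => pd a x (pd b y (f z))
  map_add' f g := by
    funext a b
    refine (congrArg sym3 ?_).trans (map_add sym3 _ _)
    funext x y z
    simp
  map_smul' r f := by
    funext a b
    refine (congrArg sym3 ?_).trans (map_smul sym3 r _)
    funext x y z
    simp

/-- `∂_{(αα̇} ∂_{ββ̇} ψ_{γ)}`, with indices in the order `α̇, β̇, α, β, γ`. -/
def grad2Und : T1 →ₗ[ℂ] T5 where
  toFun f x y := sym3 fun a b c => pd a x (pd b y (f c))
  map_add' f g := by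
    funext x y
    refine (congrArg sym3 ?_).trans (map_add sym3 _ _)
    funext a b c
    simp
  map_smul' r f := by
    funext x y
    refine (congrArg sym3 ?_).trans (map_smul sym3 r _)
    funext a b c
    simp

/-- `ε^{α̇β̇} ∂_{αα̇} χ_β̇`. -/
def diracDot : T1 →ₗ[ℂ] T1 where
  toFun f a := ∑ x, ∑ y, epsUp x y • pd a x (f y)
  map_add' f g := by funext a; simp [Finset.sum_add_distrib]
  map_smul' c f := by funext a; simp [Finset.smul_sum, smul_comm c]

/-- `ε^{αβ} ∂_{αα̇} ψ_β`. -/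
def diracUnd : T1 →ₗ[ℂ] T1 where
  toFun f x := ∑ a, ∑ b, epsUp a b • pd a x (f b)
  map_add' f g := by funext a; simp [Finset.sum_add_distrib]
  map_smul' c f := by funext a; simp [Finset.smul_sum, smul_comm c]

/-- `∂_{α(α̇} B_{β̇γ̇)}`, with indices in the order `α, α̇, β̇, γ̇`. -/
def dDot : T2 →ₗ[ℂ] T4 where
  toFun B a := sym3 fun x y z => pd a x (B y z)
  map_add' f g := by
    funext a
    refine (congrArg sym3 ?_).trans (map_add sym3 _ _)
    funext x y z
    simp
  map_smul' r f := by
    funext a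
    refine (congrArg sym3 ?_).trans (map_smul sym3 r _)
    funext x y z
    simp

/-- `∂_{(αα̇} B_{βγ)}`, with indices in the order `α̇, α, β, γ`. -/
def dUnd : T2 →ₗ[ℂ] T4 where
  toFun B x := sym3 fun a b c => pd a x (B b c)
  map_add' f g := by
    funext x
    refine (congrArg sym3 ?_).trans (map_add sym3 _ _)
    funext a b c
    simp
  map_smul' r f := by
    funext x
    refine (congrArg sym3 ?_).trans (map_smul sym3 r _)
    funext a b c
    simp

/-- `∂_{α(α̇} ∂_{ββ̇} B_{γ̇δ̇)}`, with indices in the order `α, β, α̇, β̇, γ̇, δ̇`. -/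
def ddDot : T2 →ₗ[ℂ] T6 where
  toFun B a b := sym4 fun x y z w => pd a x (pd b y (B z w))
  map_add' f g := by
    funext a b
    refine (congrArg sym4 ?_).trans (map_add sym4 _ _)
    funext x y z w
    simp
  map_smul' r f := by
    funext a b
    refine (congrArg sym4 ?_).trans (map_smul sym4 r _)
    funext x y z w
    simp

/-- `∂_{(αα̇} ∂_{ββ̇} B_{γδ)}`, with indices in the order `α̇, β̇, α, β, γ, δ`. -/
def ddUnd : T2 →ₗ[ℂ] T6 where
  toFun B x y := sym4 fun a b c d => pd a x (pd b y (B c d))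
  map_add' f g := by
    funext x y
    refine (congrArg sym4 ?_).trans (map_add sym4 _ _)
    funext a b c d
    simp
  map_smul' r f := by
    funext x y
    refine (congrArg sym4 ?_).trans (map_smul sym4 r _)
    funext a b c d
    simp

/-- `ε^{β̇γ̇} ∂_{αβ̇} B_{γ̇α̇}`. -/
def divDot : T2 →ₗ[ℂ] T2 where
  toFun B a x := ∑ y, ∑ z, epsUp y z • pd a y (B z x)
  map_add' f g := by funext a x; simp [Finset.sum_add_distrib]
  map_smul' c f := by funext a x; simp [Finset.smul_sum, smul_comm c]

/-- `ε^{βγ} ∂_{βα̇} B_{γα}`. -/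
def divUnd : T2 →ₗ[ℂ] T2 where
  toFun B a x := ∑ b, ∑ c, epsUp b c • pd b x (B c a)
  map_add' f g := by funext a x; simp [Finset.sum_add_distrib]
  map_smul' c f := by funext a x; simp [Finset.smul_sum, smul_comm c]

/-- `ε^{αβ} ∂_{α(α̇} A_{ββ̇)}`. -/
def curvDot : T2 →ₗ[ℂ] T2 where
  toFun A := ∑ a, ∑ b, epsUp a b • sym2 (fun x y => pd a x (A b y))
  map_add' A A' := by
    simp only [← Finset.sum_add_distrib, ← smul_add]
    refine Finset.sum_congr rfl fun a _ => Finset.sum_congr rfl fun b _ => ?_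
    congr 1
    refine (congrArg sym2 ?_).trans (map_add sym2 _ _)
    funext x y
    simp
  map_smul' c A := by
    simp only [Finset.smul_sum, RingHom.id_apply, smul_comm c]
    refine Finset.sum_congr rfl fun a _ => Finset.sum_congr rfl fun b _ => ?_
    congr 1
    refine (congrArg sym2 ?_).trans (map_smul sym2 c _)
    funext x y
    simp

/-- `ε^{α̇β̇} ∂_{(αα̇} A_{β)β̇}`. -/
def curvUnd : T2 →ₗ[ℂ] T2 where
  toFun A := ∑ x, ∑ y, epsUp x y • sym2 (fun a b => pd a x (A b y))
  map_add' A A' := by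
    simp only [← Finset.sum_add_distrib, ← smul_add]
    refine Finset.sum_congr rfl fun x _ => Finset.sum_congr rfl fun y _ => ?_
    congr 1
    refine (congrArg sym2 ?_).trans (map_add sym2 _ _)
    funext a b
    simp
  map_smul' c A := by
    simp only [Finset.smul_sum, RingHom.id_apply, smul_comm c]
    refine Finset.sum_congr rfl fun x _ => Finset.sum_congr rfl fun y _ => ?_
    congr 1
    refine (congrArg sym2 ?_).trans (map_smul sym2 c _)
    funext a b
    simp

/-- `∂^{αα̇} A_{αα̇}`. -/
def divA : T2 →ₗ[ℂ] SpaceFn where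
  toFun A := ∑ a, ∑ b, ∑ x, ∑ y, (epsUp a b * epsUp x y) • pd b y (A a x)
  map_add' f g := by simp only [Pi.add_apply, map_add, smul_add, Finset.sum_add_distrib]
  map_smul' c f := by
    simp only [Pi.smul_apply, map_smul, Finset.smul_sum, smul_comm c, RingHom.id_apply]

/-- `∂_{(α(α̇} M_{β)β̇)}`, with indices in the order `α, β, α̇, β̇`. -/
def dSymSym : T2 →ₗ[ℂ] T4 where
  toFun M a b x y := (1 / 2 : ℂ) • (gradDot (M b) a x y + gradDot (M a) b x y)
  map_add' f g := by
    funext a b x y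
    simp only [Pi.add_apply, map_add]
    module
  map_smul' c f := by
    funext a b x y
    simp only [Pi.smul_apply, map_smul, RingHom.id_apply]
    module

/-- `ε_{α̇β̇} ε^{γ̇δ̇} ∂_{(αγ̇} M_{β)δ̇}`, with indices in the order `α, β, α̇, β̇`. -/
def dTraceDot : T2 →ₗ[ℂ] T4 where
  toFun M a b x y := epsLow x y • curvUnd M a b
  map_add' f g := by funext a b x y; simp
  map_smul' c f := by funext a b x y; simp [smul_comm c]

/-- `ε_{αβ} ε^{γδ} ∂_{γ(α̇} M_{δβ̇)}`, with indices in the order `α, β, α̇, β̇`. -/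
def dTraceUnd : T2 →ₗ[ℂ] T4 where
  toFun M a b x y := epsLow a b • curvDot M x y
  map_add' f g := by funext a b x y; simp
  map_smul' c f := by funext a b x y; simp [smul_comm c]

/-! ### Contraction with spinors -/

/-- `T_a v^a`. -/
def con1 (v : Fin 2 → AmbFn) : T1 →ₗ[ℂ] AmbFn where
  toFun T := ∑ a, pull (T a) * v a
  map_add' f g := by simp [Finset.sum_add_distrib, add_mul]
  map_smul' c f := by simp [Finset.smul_sum]

/-- `T_{ab} v₁^a v₂^b`. -/
def con2 (v₁ v₂ : Fin 2 → AmbFn) : T2 →ₗ[ℂ] AmbFn where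
  toFun T := ∑ a, con1 v₂ (T a) * v₁ a
  map_add' f g := by simp [Finset.sum_add_distrib, add_mul]
  map_smul' c f := by simp [Finset.smul_sum]

/-- `T_{abc} v₁^a v₂^b v₃^c`. -/
def con3 (v₁ v₂ v₃ : Fin 2 → AmbFn) : T3 →ₗ[ℂ] AmbFn where
  toFun T := ∑ a, con2 v₂ v₃ (T a) * v₁ a
  map_add' f g := by simp [Finset.sum_add_distrib, add_mul]
  map_smul' c f := by simp [Finset.smul_sum]

/-- `T_{abcd} v₁^a v₂^b v₃^c v₄^d`. -/
def con4 (v₁ v₂ v₃ v₄ : Fin 2 → AmbFn) : T4 →ₗ[ℂ] AmbFn where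
  toFun T := ∑ a, con3 v₂ v₃ v₄ (T a) * v₁ a
  map_add' f g := by simp [Finset.sum_add_distrib, add_mul]
  map_smul' c f := by simp [Finset.smul_sum]

/-- `T_{abcde} v₁^a v₂^b v₃^c v₄^d v₅^e`. -/
def con5 (v₁ v₂ v₃ v₄ v₅ : Fin 2 → AmbFn) : T5 →ₗ[ℂ] AmbFn where
  toFun T := ∑ a, con4 v₂ v₃ v₄ v₅ (T a) * v₁ a
  map_add' f g := by simp [Finset.sum_add_distrib, add_mul]
  map_smul' c f := by simp [Finset.smul_sum]

/-- `T_{abcdef} v₁^a v₂^b v₃^c v₄^d v₅^e v₆^f`. -/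
def con6 (v₁ v₂ v₃ v₄ v₅ v₆ : Fin 2 → AmbFn) : T6 →ₗ[ℂ] AmbFn where
  toFun T := ∑ a, con5 v₂ v₃ v₄ v₅ v₆ (T a) * v₁ a
  map_add' f g := by simp [Finset.sum_add_distrib, add_mul]
  map_smul' c f := by simp [Finset.smul_sum]

/-- The superfunction `w f₀ + w θ^i η_i f₁ + w (θ^i η_i)² f₂ + w (θ^i η_i)³ f₃`. -/
def ser (w : Gr) (f₀ f₁ f₂ f₃ : AmbFn) : SuperFn :=
  w ⊗ₜ f₀ + (w * thEta) ⊗ₜ f₁ + (w * thEta ^ 2) ⊗ₜ f₂ + (w * thEta ^ 3) ⊗ₜ f₃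

theorem ser_add (w : Gr) (f₀ f₁ f₂ f₃ g₀ g₁ g₂ g₃ : AmbFn) :
    ser w (f₀ + g₀) (f₁ + g₁) (f₂ + g₂) (f₃ + g₃) = ser w f₀ f₁ f₂ f₃ + ser w g₀ g₁ g₂ g₃ := by
  simp only [ser, TensorProduct.tmul_add]
  module

theorem ser_smul (w : Gr) (c : ℂ) (f₀ f₁ f₂ f₃ : AmbFn) :
    ser w (c • f₀) (c • f₁) (c • f₂) (c • f₃) = c • ser w f₀ f₁ f₂ f₃ := by
  simp only [ser, TensorProduct.tmul_smul]
  module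

/-- A spinor of weight `(k, l)`. -/
class SpinWt (v : Fin 2 → AmbFn) (k l : outParam ℤ) : Prop where
  mem : ∀ i, v i ∈ Homog k l

instance : SpinWt lu 1 0 := ⟨lu_mem⟩
instance : SpinWt mv 0 1 := ⟨mv_mem⟩
instance : SpinWt lh (-1) 0 := ⟨lh_mem⟩
instance : SpinWt mh 0 (-1) := ⟨mh_mem⟩

theorem con1_mem {v : Fin 2 → AmbFn} {k l k₁ l₁ : ℤ} [h : SpinWt v k₁ l₁] (T : T1)
    (hk : k = k₁) (hl : l = l₁) : con1 v T ∈ Homog k l :=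
  (sum_mem fun a _ => by
    simpa [hk, hl] using Homog.mul (pull_mem (T a)) (h.mem a) :
      (∑ a, pull (T a) * v a) ∈ Homog k l)

theorem con2_mem {v₁ v₂ : Fin 2 → AmbFn} {k l k₁ l₁ k₂ l₂ : ℤ} [h₁ : SpinWt v₁ k₁ l₁]
    [SpinWt v₂ k₂ l₂] (T : T2) (hk : k = k₂ + k₁) (hl : l = l₂ + l₁) :
    con2 v₁ v₂ T ∈ Homog k l :=
  (sum_mem fun a _ => by
    rw [hk, hl]
    exact Homog.mul (con1_mem (T a) rfl rfl) (h₁.mem a) :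
      (∑ a, con1 v₂ (T a) * v₁ a) ∈ Homog k l)

theorem con3_mem {v₁ v₂ v₃ : Fin 2 → AmbFn} {k l k₁ l₁ k₂ l₂ k₃ l₃ : ℤ} [h₁ : SpinWt v₁ k₁ l₁]
    [SpinWt v₂ k₂ l₂] [SpinWt v₃ k₃ l₃] (T : T3) (hk : k = k₃ + k₂ + k₁) (hl : l = l₃ + l₂ + l₁) :
    con3 v₁ v₂ v₃ T ∈ Homog k l :=
  (sum_mem fun a _ => by
    rw [hk, hl]
    exact Homog.mul (con2_mem (T a) rfl rfl) (h₁.mem a) :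
      (∑ a, con2 v₂ v₃ (T a) * v₁ a) ∈ Homog k l)

theorem con4_mem {v₁ v₂ v₃ v₄ : Fin 2 → AmbFn} {k l k₁ l₁ k₂ l₂ k₃ l₃ k₄ l₄ : ℤ}
    [h₁ : SpinWt v₁ k₁ l₁] [SpinWt v₂ k₂ l₂] [SpinWt v₃ k₃ l₃] [SpinWt v₄ k₄ l₄] (T : T4)
    (hk : k = k₄ + k₃ + k₂ + k₁) (hl : l = l₄ + l₃ + l₂ + l₁) :
    con4 v₁ v₂ v₃ v₄ T ∈ Homog k l :=
  (sum_mem fun a _ => by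
    rw [hk, hl]
    exact Homog.mul (con3_mem (T a) rfl rfl) (h₁.mem a) :
      (∑ a, con3 v₂ v₃ v₄ (T a) * v₁ a) ∈ Homog k l)

theorem con5_mem {v₁ v₂ v₃ v₄ v₅ : Fin 2 → AmbFn} {k l k₁ l₁ k₂ l₂ k₃ l₃ k₄ l₄ k₅ l₅ : ℤ}
    [h₁ : SpinWt v₁ k₁ l₁] [SpinWt v₂ k₂ l₂] [SpinWt v₃ k₃ l₃] [SpinWt v₄ k₄ l₄]
    [SpinWt v₅ k₅ l₅] (T : T5)
    (hk : k = k₅ + k₄ + k₃ + k₂ + k₁) (hl : l = l₅ + l₄ + l₃ + l₂ + l₁) :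
    con5 v₁ v₂ v₃ v₄ v₅ T ∈ Homog k l :=
  (sum_mem fun a _ => by
    rw [hk, hl]
    exact Homog.mul (con4_mem (T a) rfl rfl) (h₁.mem a) :
      (∑ a, con4 v₂ v₃ v₄ v₅ (T a) * v₁ a) ∈ Homog k l)

theorem con6_mem {v₁ v₂ v₃ v₄ v₅ v₆ : Fin 2 → AmbFn} {k l k₁ l₁ k₂ l₂ k₃ l₃ k₄ l₄ k₅ l₅ k₆ l₆ : ℤ}
    [h₁ : SpinWt v₁ k₁ l₁] [SpinWt v₂ k₂ l₂] [SpinWt v₃ k₃ l₃] [SpinWt v₄ k₄ l₄]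
    [SpinWt v₅ k₅ l₅] [SpinWt v₆ k₆ l₆] (T : T6)
    (hk : k = k₆ + k₅ + k₄ + k₃ + k₂ + k₁) (hl : l = l₆ + l₅ + l₄ + l₃ + l₂ + l₁) :
    con6 v₁ v₂ v₃ v₄ v₅ v₆ T ∈ Homog k l :=
  (sum_mem fun a _ => by
    rw [hk, hl]
    exact Homog.mul (con5_mem (T a) rfl rfl) (h₁.mem a) :
      (∑ a, con5 v₂ v₃ v₄ v₅ v₆ (T a) * v₁ a) ∈ Homog k l)

theorem ser_mem {a b : ℕ} {k l : ℤ} {w : Gr} (hw : GrWt a b w) {f₀ f₁ f₂ f₃ : AmbFn}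
    (h₀ : f₀ ∈ Homog (k - a) (l - b)) (h₁ : f₁ ∈ Homog (k - a - 1) (l - b - 1))
    (h₂ : f₂ ∈ Homog (k - a - 2) (l - b - 2)) (h₃ : f₃ ∈ Homog (k - a - 3) (l - b - 3)) :
    ser w f₀ f₁ f₂ f₃ ∈ Sec k l := by
  refine add_mem (add_mem (add_mem (tmul_mem hw h₀ ?_ ?_)
    (tmul_mem (hw.mul GrWt.thEta) h₁ ?_ ?_)) (tmul_mem (hw.mul (GrWt.pow 2)) h₂ ?_ ?_))
    (tmul_mem (hw.mul (GrWt.pow 3)) h₃ ?_ ?_) <;> push_cast <;> ring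

/-! ### First-order Yang--Mills theory -/

/-- Symmetric two-index fields. -/
def Sym : Submodule ℂ T2 where
  carrier := {B | ∀ a b, B a b = B b a}
  add_mem' hf hg a b := congrArg₂ (· + ·) (hf a b) (hg a b)
  zero_mem' _ _ := rfl
  smul_mem' c _ hf a b := congrArg (c • ·) (hf a b)

theorem curvDot_mem (A : T2) : curvDot A ∈ Sym := fun x y => by
  have h : ∀ T : T2, sym2 T x y = sym2 T y x := fun T =>
    congrArg (fun z => (1 / 2 : ℂ) • z) (add_comm (T x y) (T y x))
  simp only [curvDot, LinearMap.coe_mk, AddHom.coe_mk, Finset.sum_apply, Pi.smul_apply, h]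

theorem curvUnd_mem (A : T2) : curvUnd A ∈ Sym := fun x y => by
  have h : ∀ T : T2, sym2 T x y = sym2 T y x := fun T =>
    congrArg (fun z => (1 / 2 : ℂ) • z) (add_comm (T x y) (T y x))
  simp only [curvUnd, LinearMap.coe_mk, AddHom.coe_mk, Finset.sum_apply, Pi.smul_apply, h]

/-- Ghosts `c`. -/
abbrev YM0 : Type := SpaceFn
/-- Gauge potential and auxiliary two-form `(A_{αα̇}, B_{α̇β̇}, B_{αβ})`. -/
abbrev YM1 : Type := T2 × Sym × Sym
/-- Anti-fields `(A⁺_{αα̇}, B⁺_{α̇β̇}, B⁺_{αβ})`. -/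
abbrev YM2 : Type := T2 × Sym × Sym
/-- Anti-fields `c⁺` of the ghosts. -/
abbrev YM3 : Type := SpaceFn

/-- `c ↦ (∂_{αα̇} c, 0, 0)`. -/
def dYM0 : YM0 →ₗ[ℂ] YM1 := grad.prod 0

/-- `A⁺_{αα̇} = ε^{β̇γ̇} ∂_{αβ̇} B_{γ̇α̇} + ε^{βγ} ∂_{βα̇} B_{γα}`,
`B⁺_{α̇β̇} = ε^{αβ} ∂_{α(α̇} A_{ββ̇)} - B_{α̇β̇}`, `B⁺_{αβ} = ε^{α̇β̇} ∂_{(αα̇} A_{β)β̇} - B_{αβ}`. -/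
def dYM1 : YM1 →ₗ[ℂ] YM2 where
  toFun Φ := (divDot Φ.2.1 + divUnd Φ.2.2,
    ⟨curvDot Φ.1, curvDot_mem Φ.1⟩ - Φ.2.1, ⟨curvUnd Φ.1, curvUnd_mem Φ.1⟩ - Φ.2.2)
  map_add' Φ Ψ := by
    refine Prod.ext ?_ (Prod.ext (Subtype.ext ?_) (Subtype.ext ?_)) <;> simp <;> module
  map_smul' c Φ := by
    refine Prod.ext ?_ (Prod.ext (Subtype.ext ?_) (Subtype.ext ?_)) <;> simp <;> module

/-- `c⁺ = ∂^{αα̇} A⁺_{αα̇}`. -/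
def dYM2 : YM2 →ₗ[ℂ] YM3 := divA ∘ₗ LinearMap.fst ℂ _ _

/-! ### The map `e` for Yang--Mills theory -/

/-- `C = c`. -/
def e0 : YM0 →ₗ[ℂ] Form0 where
  toFun c := ⟨ser 1 (pull c) 0 0 0, ser_mem GrWt.one
    (by simpa using pull_mem c) (zero_mem _) (zero_mem _) (zero_mem _)⟩
  map_add' f g := Subtype.ext <| by
    simp only [Submodule.coe_add, ← ser_add, map_add, add_zero]
  map_smul' c f := Subtype.ext <| by
    simp only [Submodule.coe_smul, ← ser_smul, map_smul, smul_zero, RingHom.id_apply]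

/-- The component of `e` along `v̂^F`. -/
def e1F : YM1 →ₗ[ℂ] Sec 1 1 where
  toFun Φ := ⟨ser 1
    (con2 mv lu Φ.1)
    (-(con2 lu lh Φ.2.1 - con2 mv mh Φ.2.2))
    (-((1 / 2 : ℂ) • con4 mh lu lh lh (dDot Φ.2.1) + (1 / 2 : ℂ) • con4 lh mv mh mh (dUnd Φ.2.2)))
    (-((1 / 6 : ℂ) • con6 mh mh lu lh lh lh (ddDot Φ.2.1) -
      (1 / 6 : ℂ) • con6 lh lh mv mh mh mh (ddUnd Φ.2.2))),
    ser_mem GrWt.one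
      (con2_mem _ (by norm_num) (by norm_num))
      (neg_mem (sub_mem (con2_mem _ (by norm_num) (by norm_num))
        (con2_mem _ (by norm_num) (by norm_num))))
      (neg_mem (add_mem (Submodule.smul_mem _ _ (con4_mem _ (by norm_num) (by norm_num)))
        (Submodule.smul_mem _ _ (con4_mem _ (by norm_num) (by norm_num)))))
      (neg_mem (sub_mem (Submodule.smul_mem _ _ (con6_mem _ (by norm_num) (by norm_num)))
        (Submodule.smul_mem _ _ (con6_mem _ (by norm_num) (by norm_num)))))⟩
  map_add' Φ Ψ := Subtype.ext <| by
    simp only [Submodule.coe_add, ← ser_add, Prod.fst_add, Prod.snd_add, map_add]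
    congr 1 <;> module
  map_smul' c Φ := Subtype.ext <| by
    simp only [Submodule.coe_smul, ← ser_smul, Prod.smul_fst, Prod.smul_snd, map_smul,
      RingHom.id_apply]
    congr 1 <;> module

/-- The component of `e` along `v̂^L`. -/
def e1L : YM1 →ₗ[ℂ] Sec 2 0 where
  toFun Φ := ⟨ser 1
    0
    (-con2 mh lu Φ.1)
    (-((3 / 2 : ℂ) • con2 mh mh Φ.2.2))
    ((5 / 6 : ℂ) • con4 lh mh mh mh (dUnd Φ.2.2)),
    ser_mem GrWt.one
      (zero_mem _)
      (neg_mem (con2_mem _ (by norm_num) (by norm_num)))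
      (neg_mem (Submodule.smul_mem _ _ (con2_mem _ (by norm_num) (by norm_num))))
      (Submodule.smul_mem _ _ (con4_mem _ (by norm_num) (by norm_num)))⟩
  map_add' Φ Ψ := Subtype.ext <| by
    simp only [Submodule.coe_add, ← ser_add, Prod.fst_add, Prod.snd_add, map_add]
    congr 1 <;> module
  map_smul' c Φ := Subtype.ext <| by
    simp only [Submodule.coe_smul, ← ser_smul, Prod.smul_fst, Prod.smul_snd, map_smul,
      RingHom.id_apply]
    congr 1 <;> module

/-- The component of `e` along `v̂^R`. -/
def e1R : YM1 →ₗ[ℂ] Sec 0 2 where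
  toFun Φ := ⟨ser 1
    0
    (con2 mv lh Φ.1)
    (-((3 / 2 : ℂ) • con2 lh lh Φ.2.1))
    (-((5 / 6 : ℂ) • con4 mh lh lh lh (dDot Φ.2.1))),
    ser_mem GrWt.one
      (zero_mem _)
      (con2_mem _ (by norm_num) (by norm_num))
      (neg_mem (Submodule.smul_mem _ _ (con2_mem _ (by norm_num) (by norm_num))))
      (neg_mem (Submodule.smul_mem _ _ (con4_mem _ (by norm_num) (by norm_num))))⟩
  map_add' Φ Ψ := Subtype.ext <| by
    simp only [Submodule.coe_add, ← ser_add, Prod.fst_add, Prod.snd_add, map_add]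
    congr 1 <;> module
  map_smul' c Φ := Subtype.ext <| by
    simp only [Submodule.coe_smul, ← ser_smul, Prod.smul_fst, Prod.smul_snd, map_smul,
      RingHom.id_apply]
    congr 1 <;> module

/-- `e` in degree one. -/
def e1 : YM1 →ₗ[ℂ] Form1 := e1F.prod (e1L.prod e1R)

/-- `B⁺_{αα̇} = ε^{β̇γ̇} ∂_{αβ̇} B⁺_{γ̇α̇} - ε^{βγ} ∂_{βα̇} B⁺_{γα}`. -/
def Bvec : YM2 →ₗ[ℂ] T2 where
  toFun Φ := divDot Φ.2.1 - divUnd Φ.2.2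
  map_add' Φ Ψ := by simp; module
  map_smul' c Φ := by simp; module

/-- The component of `e` along `v̂^L ∧ v̂^R`. -/
def e2LR : YM2 →ₗ[ℂ] Sec 2 2 where
  toFun Φ := ⟨ser 1
    0
    0
    (con2 lu lh Φ.2.1 - con2 mv mh Φ.2.2)
    (con2 mh lh Φ.1),
    ser_mem GrWt.one
      (zero_mem _)
      (zero_mem _)
      (sub_mem (con2_mem _ (by norm_num) (by norm_num)) (con2_mem _ (by norm_num) (by norm_num)))
      (con2_mem _ (by norm_num) (by norm_num))⟩
  map_add' Φ Ψ := Subtype.ext <| by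
    simp only [Submodule.coe_add, ← ser_add, Prod.fst_add, Prod.snd_add, map_add]
    congr 1 <;> module
  map_smul' c Φ := Subtype.ext <| by
    simp only [Submodule.coe_smul, ← ser_smul, Prod.smul_fst, Prod.smul_snd, map_smul,
      RingHom.id_apply]
    congr 1 <;> module

/-- The component of `e` along `v̂^F ∧ v̂^L`. -/
def e2FL : YM2 →ₗ[ℂ] Sec 3 1 where
  toFun Φ := ⟨ser 1
    0
    (-con2 lu lu Φ.2.1)
    (-((5 / 6 : ℂ) • con2 mh lu Φ.1) - (1 / 2 : ℂ) • con2 mh lu (Bvec Φ))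
    ((1 / 4 : ℂ) • con4 mh mh lu lh (dTraceDot (Φ.1 + Bvec Φ)) +
      (1 / 6 : ℂ) • con4 mh mh lu lh (dSymSym (Φ.1 + (2 : ℂ) • Bvec Φ))),
    ser_mem GrWt.one
      (zero_mem _)
      (neg_mem (con2_mem _ (by norm_num) (by norm_num)))
      (sub_mem (neg_mem (Submodule.smul_mem _ _ (con2_mem _ (by norm_num) (by norm_num))))
        (Submodule.smul_mem _ _ (con2_mem _ (by norm_num) (by norm_num))))
      (add_mem (Submodule.smul_mem _ _ (con4_mem _ (by norm_num) (by norm_num)))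
        (Submodule.smul_mem _ _ (con4_mem _ (by norm_num) (by norm_num))))⟩
  map_add' Φ Ψ := Subtype.ext <| by
    simp only [Submodule.coe_add, ← ser_add, Prod.fst_add, Prod.snd_add, map_add, map_smul]
    congr 1 <;> module
  map_smul' c Φ := Subtype.ext <| by
    simp only [Submodule.coe_smul, ← ser_smul, Prod.smul_fst, Prod.smul_snd, map_smul, map_add,
      RingHom.id_apply]
    congr 1 <;> module

/-- The component of `e` along `v̂^F ∧ v̂^R`. -/
def e2FR : YM2 →ₗ[ℂ] Sec 1 3 where
  toFun Φ := ⟨ser 1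
    0
    (con2 mv mv Φ.2.2)
    (-((5 / 6 : ℂ) • con2 mv lh Φ.1) + (1 / 2 : ℂ) • con2 mv lh (Bvec Φ))
    (-((1 / 4 : ℂ) • con4 mv mh lh lh (dTraceUnd (Φ.1 - Bvec Φ)) +
      (1 / 6 : ℂ) • con4 mv mh lh lh (dSymSym (Φ.1 - (2 : ℂ) • Bvec Φ)))),
    ser_mem GrWt.one
      (zero_mem _)
      (con2_mem _ (by norm_num) (by norm_num))
      (add_mem (neg_mem (Submodule.smul_mem _ _ (con2_mem _ (by norm_num) (by norm_num))))
        (Submodule.smul_mem _ _ (con2_mem _ (by norm_num) (by norm_num))))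
      (neg_mem (add_mem (Submodule.smul_mem _ _ (con4_mem _ (by norm_num) (by norm_num)))
        (Submodule.smul_mem _ _ (con4_mem _ (by norm_num) (by norm_num)))))⟩
  map_add' Φ Ψ := Subtype.ext <| by
    simp only [Submodule.coe_add, ← ser_add, Prod.fst_add, Prod.snd_add, map_add, map_sub,
      map_smul]
    congr 1 <;> module
  map_smul' c Φ := Subtype.ext <| by
    simp only [Submodule.coe_smul, ← ser_smul, Prod.smul_fst, Prod.smul_snd, map_smul, map_sub,
      RingHom.id_apply]
    congr 1 <;> module

/-- `e` in degree two. -/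
def e2 : YM2 →ₗ[ℂ] Form2 := e2LR.prod (e2FL.prod e2FR)

/-- `C⁺ = v̂^F ∧ v̂^L ∧ v̂^R (θ^i η_i)³ (2/3) c⁺`. -/
def e3 : YM3 →ₗ[ℂ] Form3 where
  toFun c := ⟨ser 1 0 0 0 ((2 / 3 : ℂ) • pull c), ser_mem GrWt.one (zero_mem _) (zero_mem _)
    (zero_mem _) (Submodule.smul_mem _ _ (by simpa using pull_mem c))⟩
  map_add' f g := Subtype.ext <| by
    simp only [Submodule.coe_add, ← ser_add, map_add, smul_add, add_zero]
  map_smul' c f := Subtype.ext <| by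
    simp only [Submodule.coe_smul, ← ser_smul, map_smul, smul_zero, RingHom.id_apply,
      smul_comm c]

/-! ### The `N = 3` supersymmetric extension

The `N = 3` multiplet contains, in addition to the gluons, the gluini `χ^i_α`, `χ_{iα̇}`
(R-symmetry triplets) and `χ_α̇`, `χ_α` (R-symmetry singlets) and the scalars `φ_k` and `φ^k`. -/

/-- `(χ^i_α, χ_{iα̇}, χ_α̇, χ_α, φ_k, φ^k)`. -/
abbrev Matter1 : Type :=
  (Fin 3 → T1) × (Fin 3 → T1) × T1 × T1 × (Fin 3 → SpaceFn) × (Fin 3 → SpaceFn)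

/-- The anti-fields `(χ⁺^i_α̇, χ⁺_{iα}, χ⁺_α, χ⁺_α̇, φ⁺_k, φ⁺^k)`. -/
abbrev Matter2 : Type :=
  (Fin 3 → T1) × (Fin 3 → T1) × T1 × T1 × (Fin 3 → SpaceFn) × (Fin 3 → SpaceFn)

/-- The linearised field equations: the Dirac equations
`χ⁺^i_α̇ = ε^{αβ} ∂_{αα̇} χ^i_β`, `χ⁺_{iα} = ε^{α̇β̇} ∂_{αα̇} χ_{iβ̇}`,
`χ⁺_α = ε^{α̇β̇} ∂_{αα̇} χ_β̇`, `χ⁺_α̇ = ε^{αβ} ∂_{αα̇} χ_β`, and the Laplace equations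
`φ⁺_k = □ φ_k`, `φ⁺^k = □ φ^k`. -/
def dMatter : Matter1 →ₗ[ℂ] Matter2 where
  toFun Φ := (fun i => diracUnd (Φ.1 i), fun i => diracDot (Φ.2.1 i), diracDot Φ.2.2.1,
    diracUnd Φ.2.2.2.1, fun k => box (Φ.2.2.2.2.1 k), fun k => box (Φ.2.2.2.2.2 k))
  map_add' Φ Ψ := by
    refine Prod.ext ?_ (Prod.ext ?_ (Prod.ext ?_ (Prod.ext ?_ (Prod.ext ?_ ?_)))) <;>
      (try funext i) <;> simp
  map_smul' c Φ := by
    refine Prod.ext ?_ (Prod.ext ?_ (Prod.ext ?_ (Prod.ext ?_ (Prod.ext ?_ ?_)))) <;>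
      (try funext i) <;> simp

/-- `½ ε^{ijk} η_i η_j`. -/
def eta2 (k : Fin 3) : Gr := eta (k + 1) * eta (k + 2)
/-- `½ ε_{ijk} θ^i θ^j`. -/
def theta2 (k : Fin 3) : Gr := theta (k + 1) * theta (k + 2)
/-- `η₁ η₂ η₃`. -/
def eta3 : Gr := eta 0 * eta 1 * eta 2
/-- `θ¹ θ² θ³`. -/
def theta3 : Gr := theta 0 * theta 1 * theta 2

theorem GrWt.cast {a b a' b' : ℕ} {w : Gr} (h : GrWt a b w) (ha : a = a') (hb : b = b') :
    GrWt a' b' w := ha ▸ hb ▸ h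

theorem GrWt.eta2 (k : Fin 3) : GrWt 2 0 (eta2 k) :=
  ((GrWt.eta (k + 1)).mul (GrWt.eta (k + 2))).cast rfl rfl

theorem GrWt.theta2 (k : Fin 3) : GrWt 0 2 (theta2 k) :=
  ((GrWt.theta (k + 1)).mul (GrWt.theta (k + 2))).cast rfl rfl

theorem GrWt.eta3 : GrWt 3 0 eta3 :=
  (((GrWt.eta 0).mul (GrWt.eta 1)).mul (GrWt.eta 2)).cast rfl rfl

theorem GrWt.theta3 : GrWt 0 3 theta3 :=
  (((GrWt.theta 0).mul (GrWt.theta 1)).mul (GrWt.theta 2)).cast rfl rfl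

/-- A superfunction `w f₀ + w θ^i η_i f₁ + w (θ^i η_i)² f₂` whose coefficients depend linearly on
a field, as an element of `Sec k l`. -/
def serLin {M : Type*} [AddCommGroup M] [Module ℂ M] {a b : ℕ} {k l : ℤ} {w : Gr}
    (hw : GrWt a b w) (f₀ f₁ f₂ : M →ₗ[ℂ] AmbFn)
    (h₀ : ∀ m, f₀ m ∈ Homog (k - a) (l - b)) (h₁ : ∀ m, f₁ m ∈ Homog (k - a - 1) (l - b - 1))
    (h₂ : ∀ m, f₂ m ∈ Homog (k - a - 2) (l - b - 2)) : M →ₗ[ℂ] Sec k l where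
  toFun m := ⟨ser w (f₀ m) (f₁ m) (f₂ m) 0, ser_mem hw (h₀ m) (h₁ m) (h₂ m) (zero_mem _)⟩
  map_add' f g := Subtype.ext <| by
    simp only [Submodule.coe_add, ← ser_add, map_add, add_zero]
  map_smul' c f := Subtype.ext <| by
    simp only [Submodule.coe_smul, ← ser_smul, map_smul, smul_zero, RingHom.id_apply]

/-- Restriction to the `i`-th member of an R-symmetry triplet. -/
abbrev pr {M : Type*} [AddCommGroup M] [Module ℂ M] (i : Fin 3) : (Fin 3 → M) →ₗ[ℂ] M :=
  LinearMap.proj i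

/-- The contribution of `χ^i_α`. -/
def ePsi (i : Fin 3) : T1 →ₗ[ℂ] Form1 :=
  (serLin (GrWt.eta i)
    (con1 mv)
    (-(con3 lh mv mh ∘ₗ gradUnd))
    ((1 / 2 : ℂ) • (con5 lh lh mv mh mh ∘ₗ grad2Und))
    (fun _ => con1_mem _ (by norm_num) (by norm_num))
    (fun _ => neg_mem (con3_mem _ (by norm_num) (by norm_num)))
    (fun _ => Submodule.smul_mem _ _ (con5_mem _ (by norm_num) (by norm_num)))).prod
  ((serLin (GrWt.eta i)
    0
    (-((2 : ℂ) • con1 mh))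
    ((2 : ℂ) • (con3 lh mh mh ∘ₗ gradUnd))
    (fun _ => zero_mem _)
    (fun _ => neg_mem (Submodule.smul_mem _ _ (con1_mem _ (by norm_num) (by norm_num))))
    (fun _ => Submodule.smul_mem _ _ (con3_mem _ (by norm_num) (by norm_num)))).prod
  0)

/-- The contribution of `χ_{iα̇}`. -/
def eChi (i : Fin 3) : T1 →ₗ[ℂ] Form1 :=
  (serLin (GrWt.theta i)
    (con1 lu)
    (con3 mh lu lh ∘ₗ gradDot)
    ((1 / 2 : ℂ) • (con5 mh mh lu lh lh ∘ₗ grad2Dot))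
    (fun _ => con1_mem _ (by norm_num) (by norm_num))
    (fun _ => con3_mem _ (by norm_num) (by norm_num))
    (fun _ => Submodule.smul_mem _ _ (con5_mem _ (by norm_num) (by norm_num)))).prod
  ((0 : T1 →ₗ[ℂ] Sec 2 0).prod
  (serLin (GrWt.theta i)
    0
    ((2 : ℂ) • con1 lh)
    ((2 : ℂ) • (con3 mh lh lh ∘ₗ gradDot))
    (fun _ => zero_mem _)
    (fun _ => Submodule.smul_mem _ _ (con1_mem _ (by norm_num) (by norm_num)))
    (fun _ => Submodule.smul_mem _ _ (con3_mem _ (by norm_num) (by norm_num)))))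

/-- The contribution of `χ_α̇`. -/
def eXi : T1 →ₗ[ℂ] Form1 :=
  (serLin GrWt.eta3
    ((1 / 2 : ℂ) • (con3 mv lh lh ∘ₗ gradDot)) 0 0
    (fun _ => Submodule.smul_mem _ _ (con3_mem _ (by norm_num) (by norm_num)))
    (fun _ => zero_mem _) (fun _ => zero_mem _)).prod
  ((serLin GrWt.eta3
    (con1 lh) 0 0
    (fun _ => con1_mem _ (by norm_num) (by norm_num))
    (fun _ => zero_mem _) (fun _ => zero_mem _)).prod
  0)

/-- The contribution of `χ_α`. -/
def eZeta : T1 →ₗ[ℂ] Form1 :=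
  (serLin GrWt.theta3
    ((1 / 2 : ℂ) • (con3 lu mh mh ∘ₗ gradUnd)) 0 0
    (fun _ => Submodule.smul_mem _ _ (con3_mem _ (by norm_num) (by norm_num)))
    (fun _ => zero_mem _) (fun _ => zero_mem _)).prod
  ((0 : T1 →ₗ[ℂ] Sec 2 0).prod
  (serLin GrWt.theta3
    (con1 mh) 0 0
    (fun _ => con1_mem _ (by norm_num) (by norm_num))
    (fun _ => zero_mem _) (fun _ => zero_mem _)))

/-- The contribution of `φ_k`. -/
def ePhiLow (k : Fin 3) : SpaceFn →ₗ[ℂ] Form1 :=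
  (serLin (GrWt.eta2 k)
    (con2 mv lh ∘ₗ grad)
    (-(con4 mh lh mv lh ∘ₗ grad2)) 0
    (fun _ => con2_mem _ (by norm_num) (by norm_num))
    (fun _ => neg_mem (con4_mem _ (by norm_num) (by norm_num)))
    (fun _ => zero_mem _)).prod
  ((serLin (GrWt.eta2 k)
    pull.toLinearMap
    (-((3 : ℂ) • (con2 mh lh ∘ₗ grad))) 0
    (fun f => by simpa using pull_mem f)
    (fun _ => neg_mem (Submodule.smul_mem _ _ (con2_mem _ (by norm_num) (by norm_num))))
    (fun _ => zero_mem _)).prod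
  0)

/-- The contribution of `φ^k`. -/
def ePhiUp (k : Fin 3) : SpaceFn →ₗ[ℂ] Form1 :=
  (serLin (GrWt.theta2 k)
    (con2 mh lu ∘ₗ grad)
    (con4 mh lh mh lu ∘ₗ grad2) 0
    (fun _ => con2_mem _ (by norm_num) (by norm_num))
    (fun _ => con4_mem _ (by norm_num) (by norm_num))
    (fun _ => zero_mem _)).prod
  ((0 : SpaceFn →ₗ[ℂ] Sec 2 0).prod
  (serLin (GrWt.theta2 k)
    pull.toLinearMap
    ((3 : ℂ) • (con2 mh lh ∘ₗ grad)) 0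
    (fun f => by simpa using pull_mem f)
    (fun _ => Submodule.smul_mem _ _ (con2_mem _ (by norm_num) (by norm_num)))
    (fun _ => zero_mem _)))

/-- The contribution of `χ⁺^i_α̇`. -/
def ePsiPlus (i : Fin 3) : T1 →ₗ[ℂ] Form2 :=
  (serLin (GrWt.eta i)
    0 0 (con1 lh)
    (fun _ => zero_mem _) (fun _ => zero_mem _)
    (fun _ => con1_mem _ (by norm_num) (by norm_num))).prod
  ((serLin (GrWt.eta i)
    0
    (-((3 / 2 : ℂ) • con1 lu))
    ((5 / 6 : ℂ) • (con3 mh lu lh ∘ₗ gradDot) - (5 / 4 : ℂ) • (con1 mh ∘ₗ diracDot))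
    (fun _ => zero_mem _)
    (fun _ => neg_mem (Submodule.smul_mem _ _ (con1_mem _ (by norm_num) (by norm_num))))
    (fun _ => sub_mem (Submodule.smul_mem _ _ (con3_mem _ (by norm_num) (by norm_num)))
      (Submodule.smul_mem _ _ (con1_mem _ (by norm_num) (by norm_num))))).prod
  (serLin (GrWt.eta i)
    0 0
    ((1 / 6 : ℂ) • (con3 mv lh lh ∘ₗ gradDot))
    (fun _ => zero_mem _) (fun _ => zero_mem _)
    (fun _ => Submodule.smul_mem _ _ (con3_mem _ (by norm_num) (by norm_num)))))

/-- The contribution of `χ⁺_{iα}`. -/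
def eChiPlus (i : Fin 3) : T1 →ₗ[ℂ] Form2 :=
  (serLin (GrWt.theta i)
    0 0 (-con1 mh)
    (fun _ => zero_mem _) (fun _ => zero_mem _)
    (fun _ => neg_mem (con1_mem _ (by norm_num) (by norm_num)))).prod
  ((serLin (GrWt.theta i)
    0 0
    ((1 / 6 : ℂ) • (con3 lu mh mh ∘ₗ gradUnd))
    (fun _ => zero_mem _) (fun _ => zero_mem _)
    (fun _ => Submodule.smul_mem _ _ (con3_mem _ (by norm_num) (by norm_num)))).prod
  (serLin (GrWt.theta i)
    0
    ((3 / 2 : ℂ) • con1 mv)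
    ((5 / 6 : ℂ) • (con3 lh mv mh ∘ₗ gradUnd) - (5 / 4 : ℂ) • (con1 lh ∘ₗ diracUnd))
    (fun _ => zero_mem _)
    (fun _ => Submodule.smul_mem _ _ (con1_mem _ (by norm_num) (by norm_num)))
    (fun _ => sub_mem (Submodule.smul_mem _ _ (con3_mem _ (by norm_num) (by norm_num)))
      (Submodule.smul_mem _ _ (con1_mem _ (by norm_num) (by norm_num))))))

/-- The contribution of `χ⁺_α`. -/
def eXiPlus : T1 →ₗ[ℂ] Form2 :=
  (0 : T1 →ₗ[ℂ] Sec 2 2).prod ((serLin GrWt.eta3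
    ((1 / 2 : ℂ) • con1 mv) 0 0
    (fun _ => Submodule.smul_mem _ _ (con1_mem _ (by norm_num) (by norm_num)))
    (fun _ => zero_mem _) (fun _ => zero_mem _)).prod 0)

/-- The contribution of `χ⁺_α̇`. -/
def eZetaPlus : T1 →ₗ[ℂ] Form2 :=
  (0 : T1 →ₗ[ℂ] Sec 2 2).prod ((0 : T1 →ₗ[ℂ] Sec 3 1).prod (serLin GrWt.theta3
    ((1 / 2 : ℂ) • con1 lu) 0 0
    (fun _ => Submodule.smul_mem _ _ (con1_mem _ (by norm_num) (by norm_num)))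
    (fun _ => zero_mem _) (fun _ => zero_mem _)))

/-- The contribution of `φ⁺_k`. -/
def ePhiLowPlus (k : Fin 3) : SpaceFn →ₗ[ℂ] Form2 :=
  (0 : SpaceFn →ₗ[ℂ] Sec 2 2).prod ((serLin (GrWt.eta2 k)
    0 (-((1 / 2 : ℂ) • pull.toLinearMap)) 0
    (fun _ => zero_mem _)
    (fun f => neg_mem (Submodule.smul_mem _ _ (by simpa using pull_mem f)))
    (fun _ => zero_mem _)).prod 0)

/-- The contribution of `φ⁺^k`. -/
def ePhiUpPlus (k : Fin 3) : SpaceFn →ₗ[ℂ] Form2 :=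
  (0 : SpaceFn →ₗ[ℂ] Sec 2 2).prod ((0 : SpaceFn →ₗ[ℂ] Sec 3 1).prod (serLin (GrWt.theta2 k)
    0 ((1 / 2 : ℂ) • pull.toLinearMap) 0
    (fun _ => zero_mem _)
    (fun f => Submodule.smul_mem _ _ (by simpa using pull_mem f))
    (fun _ => zero_mem _)))

/-- Sums of contributions of the six kinds of matter fields. -/
def sumMatter {N : Type*} [AddCommMonoid N] [Module ℂ N] (a b : Fin 3 → T1 →ₗ[ℂ] N)
    (c d : T1 →ₗ[ℂ] N) (p q : Fin 3 → SpaceFn →ₗ[ℂ] N) : Matter1 →ₗ[ℂ] N :=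
  (∑ i, a i ∘ₗ pr i).coprod ((∑ i, b i ∘ₗ pr i).coprod (c.coprod (d.coprod
    ((∑ k, p k ∘ₗ pr k).coprod (∑ k, q k ∘ₗ pr k)))))

/-- `e` on the matter fields. -/
def eMatter1 : Matter1 →ₗ[ℂ] Form1 := sumMatter ePsi eChi eXi eZeta ePhiLow ePhiUp

/-- `e` on the anti-fields of the matter fields. -/
def eMatter2 : Matter2 →ₗ[ℂ] Form2 :=
  sumMatter ePsiPlus eChiPlus eXiPlus eZetaPlus ePhiLowPlus ePhiUpPlus

/-- Gluons, gluini and scalars. -/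
abbrev SYM1 : Type := YM1 × Matter1
/-- Their anti-fields. -/
abbrev SYM2 : Type := YM2 × Matter2

/-- The linearised gauge transformations. -/
def dSYM0 : YM0 →ₗ[ℂ] SYM1 := dYM0.prod 0
/-- The linearised equations of motion. -/
def dSYM1 : SYM1 →ₗ[ℂ] SYM2 := dYM1.prodMap dMatter
/-- The linearised Noether identity. -/
def dSYM2 : SYM2 →ₗ[ℂ] YM3 := dYM2 ∘ₗ LinearMap.fst ℂ YM2 Matter2

/-- The supersymmetric extension of `e` in degree one. -/
def eSYM1 : SYM1 →ₗ[ℂ] Form1 := e1.coprod eMatter1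
/-- The supersymmetric extension of `e` in degree two. -/
def eSYM2 : SYM2 →ₗ[ℂ] Form2 := e2.coprod eMatter2

/-! ### Lie-algebra-valued fields and morphisms of cochain complexes -/

/-- The extension of a linear map to fields with values in the vector space `g` over the
field `𝕜` (for instance `𝕜 = ℝ` or `𝕜 = ℂ`). -/
def tens (𝕜 : Type*) [Field 𝕜] [Algebra 𝕜 ℂ] (g : Type*) [AddCommGroup g] [Module 𝕜 g]
    {M N : Type*} [AddCommMonoid M] [Module ℂ M] [Module 𝕜 M] [IsScalarTower 𝕜 ℂ M]
    [AddCommMonoid N] [Module ℂ N] [Module 𝕜 N] [IsScalarTower 𝕜 ℂ N] (f : M →ₗ[ℂ] N) :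
    M ⊗[𝕜] g →ₗ[𝕜] N ⊗[𝕜] g :=
  (f.restrictScalars 𝕜).rTensor g

/-- `(L₀ → L₁ → L₂ → L₃)` and `(L₀' → L₁' → L₂' → L₃')` are cochain complexes, and
`e = (e₀, e₁, e₂, e₃)` is an injective morphism of cochain complexes between them. -/
structure IsInjectiveCochainMap {𝕜 : Type*} [Field 𝕜] {L₀ L₁ L₂ L₃ L₀' L₁' L₂' L₃' : Type*}
    [AddCommMonoid L₀] [Module 𝕜 L₀] [AddCommMonoid L₁] [Module 𝕜 L₁]
    [AddCommMonoid L₂] [Module 𝕜 L₂] [AddCommMonoid L₃] [Module 𝕜 L₃]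
    [AddCommMonoid L₀'] [Module 𝕜 L₀'] [AddCommMonoid L₁'] [Module 𝕜 L₁']
    [AddCommMonoid L₂'] [Module 𝕜 L₂'] [AddCommMonoid L₃'] [Module 𝕜 L₃']
    (d₀ : L₀ →ₗ[𝕜] L₁) (d₁ : L₁ →ₗ[𝕜] L₂) (d₂ : L₂ →ₗ[𝕜] L₃)
    (d₀' : L₀' →ₗ[𝕜] L₁') (d₁' : L₁' →ₗ[𝕜] L₂') (d₂' : L₂' →ₗ[𝕜] L₃')
    (e₀ : L₀ →ₗ[𝕜] L₀') (e₁ : L₁ →ₗ[𝕜] L₁') (e₂ : L₂ →ₗ[𝕜] L₂') (e₃ : L₃ →ₗ[𝕜] L₃') : Prop where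
  d₁_d₀ : d₁ ∘ₗ d₀ = 0
  d₂_d₁ : d₂ ∘ₗ d₁ = 0
  d₁_d₀' : d₁' ∘ₗ d₀' = 0
  d₂_d₁' : d₂' ∘ₗ d₁' = 0
  comm₀ : d₀' ∘ₗ e₀ = e₁ ∘ₗ d₀
  comm₁ : d₁' ∘ₗ e₁ = e₂ ∘ₗ d₁
  comm₂ : d₂' ∘ₗ e₂ = e₃ ∘ₗ d₂
  injective₀ : Function.Injective e₀
  injective₁ : Function.Injective e₁
  injective₂ : Function.Injective e₂
  injective₃ : Function.Injective e₃

end CRAmbitwistor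

end

namespace CRAmbitwistor

/-! ### Directional derivatives -/

/-! All computations take place in a moving frame. At each point of `dom` the spinors `lu` = λ and
`lh` = λ' = λ̂/|λ|² form a basis of determinant one of the dotted spinors, and `mv` = μ, `mh` = μ'
one of the undotted spinors (`lu_lh`, `mv_mh`). In this frame the vertical fields are ladder
operators: `hatEL` is a derivation which sends λ' to λ and annihilates λ, μ, μ' and all functions
pulled back from ℝ⁴; `hatER` sends μ' to μ and annihilates the rest. The four derivatives `spinDir w
v` with w among μ, μ' and v among λ, λ' commute with one another, and their commutators with the
ladder operators come from the action on w and v (`hatEL_spinDir`, `hatER_spinDir`).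

The superfunctions that occur are polynomials `ser w f₀ f₁ f₂ f₃` in the central element u =
`thEta`, for which u⁴ = 0. The fields V̂_F, V̂_L, V̂_R act on the coefficients by simple recursions
(`hatVF_ser`, `hatVL_ser`, `hatVR_ser`). These give the commutators, and the commutators give the
vanishing of the square of the CR differential.

For compatibility with the differentials every tensor is contracted with the frame. Symmetrisation
of a tensor becomes the average over permutations of the spinors (`con4_sym4`), and a trace with ε
becomes an antisymmetrised pair of frame spinors (`con1_diracDot` and its relatives). Each power of
u then yields an identity between ℂ-linear combinations of the same words in `spinDir` and
contracted fields, and it suffices to compare scalars. A prefactor w such as η_i or η₁η₂η₃ shortens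
the polynomial, because w uᵏ vanishes early, so fewer coefficients have to agree.

Injectivity rests on a pairing of Grassmann monomials: multiplication by a complementary monomial
followed by `topCoeff` isolates one coefficient, all others being excluded by weight or by a
repeated generator (`coef_multiplet`, `coef_ser_eq`). Selected coefficients of the image are nonzero
multiples of pull-backs of single fields or of their contractions with frame spinors; ladder
operators turn λ', μ' into λ, μ, and a field whose contractions with all λ, μ vanish is zero. The
Lie algebra enters only through the functor `tens`, which preserves compositions, zero and, by
flatness over a field, injections. -/

theorem ext_mul (f g : AmbFn) : ext ((f : dom → ℂ) * (g : dom → ℂ)) = ext f * ext g := by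
  funext p
  by_cases hp : p ∈ dom
  · have := fun h => ext_apply h (⟨p, hp⟩ : dom)
    simp_all
  · simp [ext, hp]

theorem dir_apply (v : Amb) (f : AmbFn) (p : dom) :
    (AmbFn.dir v f).1 p = fderiv ℝ (ext f) p v := rfl

theorem dir_mul (v : Amb) (f g : AmbFn) :
    AmbFn.dir v (f * g) = AmbFn.dir v f * g + f * AmbFn.dir v g := by
  refine Subtype.ext (funext fun p => ?_)
  change fderiv ℝ (ext ((f : dom → ℂ) * (g : dom → ℂ))) p v =
    fderiv ℝ (ext f) p v * g.1 p + f.1 p * fderiv ℝ (ext g) p v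
  rw [ext_mul, fderiv_mul (differentiableAt_ext f p) (differentiableAt_ext g p)]
  simp [ext_apply]
  ring

theorem ext_of_eventuallyEq (F : Amb → ℂ) (hF : ContDiffOn ℝ ∞ F dom) (p : dom) :
    ext (AmbFn.of F hF : AmbFn) =ᶠ[nhds (p : Amb)] F :=
  (ext_eqOn F).eventuallyEq_of_mem (isOpen_dom.mem_nhds p.2)

theorem dir_of_apply {F : Amb → ℂ} (hF : ContDiffOn ℝ ∞ F dom) (v : Amb) (p : dom) :
    (AmbFn.dir v (AmbFn.of F hF)).1 p = fderiv ℝ F p v := by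
  rw [dir_apply, (ext_of_eventuallyEq F hF p).fderiv_eq]

/-- Only the restriction of `F` to the line through `p` matters, so the derivatives of the
coordinate functions become computations in one real variable. -/
theorem dir_of_apply_of_hasLineDerivAt {F : Amb → ℂ} (hF : ContDiffOn ℝ ∞ F dom) {v : Amb}
    {p : dom} {F' : ℂ} (h : HasLineDerivAt ℝ F F' p v) :
    (AmbFn.dir v (AmbFn.of F hF)).1 p = F' := by
  rw [dir_of_apply]
  have hd : DifferentiableAt ℝ F p :=
    (hF.contDiffAt (isOpen_dom.mem_nhds p.2)).differentiableAt (by simp)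
  rw [← hd.lineDeriv_eq_fderiv, h.lineDeriv]

theorem dir_comm (v w : Amb) (f : AmbFn) :
    AmbFn.dir v (AmbFn.dir w f) = AmbFn.dir w (AmbFn.dir v f) := by
  -- An iterated directional derivative is a value of the second Fréchet derivative, which is
  -- symmetric by smoothness.
  have key (a b : Amb) (f : AmbFn) (p : dom) :
      (AmbFn.dir a (AmbFn.dir b f)).1 p = fderiv ℝ (fderiv ℝ (ext f)) p a b := by
    refine (dir_of_apply (F := fun p => fderiv ℝ (ext f) p b)
      (((contDiffOn_ext f).fderiv_of_isOpen isOpen_dom (m := ∞) (by simp)).clm_apply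
        contDiffOn_const) a p).trans ?_
    have hd : DifferentiableAt ℝ (fderiv ℝ (ext f)) (p : Amb) :=
      (((contDiffOn_ext f).fderiv_of_isOpen isOpen_dom (m := ∞) (by simp)).contDiffAt
        (isOpen_dom.mem_nhds p.2)).differentiableAt (by simp)
    rw [fderiv_clm_apply hd (by fun_prop)]
    simp
  refine Subtype.ext (funext fun p => ?_)
  rw [key, key]
  exact ((contDiffOn_ext f).contDiffAt (isOpen_dom.mem_nhds p.2)).isSymmSndFDerivAt
    (by simp [minSmoothness_of_isRCLikeNormedField]; exact WithTop.coe_le_coe.2 le_top) v w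

/-- A function which does not change in the direction `v` has vanishing derivative in that
direction. -/
theorem dir_of_eq_zero {F : Amb → ℂ} (hF : ContDiffOn ℝ ∞ F dom) {v : Amb}
    (h : ∀ (p : Amb) (t : ℝ), F (p + t • v) = F p) : AmbFn.dir v (AmbFn.of F hF) = 0 := by
  refine Subtype.ext (funext fun p => dir_of_apply_of_hasLineDerivAt hF ?_)
  simp only [HasLineDerivAt, h]
  exact hasDerivAt_const _ _

/-- The derivative of a real-linear function. -/
theorem dir_of_linear {F : Amb → ℂ} (hF : ContDiffOn ℝ ∞ F dom) {v : Amb} {c : ℂ}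
    (h : ∀ (p : Amb) (t : ℝ), F (p + t • v) = F p + t * c) :
    AmbFn.dir v (AmbFn.of F hF) = algebraMap ℂ AmbFn c := by
  refine Subtype.ext (funext fun p => dir_of_apply_of_hasLineDerivAt hF ?_)
  simp only [HasLineDerivAt, h]
  have := ((Complex.ofRealCLM.hasDerivAt (x := 0)).mul_const c).const_add (F p)
  simpa using this

theorem dir_pull (v : E4) (f : SpaceFn) :
    AmbFn.dir (v, 0, 0) (pull f) = pull (SpaceFn.dir v f) := by
  refine Subtype.ext (funext fun p => (dir_of_apply _ _ p).trans ?_)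
  have hf : DifferentiableAt ℝ (f : E4 → ℂ) p.1.1 :=
    (show ContDiff ℝ ∞ (f : E4 → ℂ) from f.2).differentiable (by simp) _
  have := (hf.hasFDerivAt.comp (p : Amb)
    (hasFDerivAt_fst : HasFDerivAt (Prod.fst : Amb → E4) _ (p : Amb))).fderiv
  change fderiv ℝ ((f : E4 → ℂ) ∘ (Prod.fst : Amb → E4)) p (v, 0, 0) = fderiv ℝ (f : E4 → ℂ) p.1.1 v
  rw [this]
  simp

theorem dir_pull_fibre (v : (Fin 2 → ℂ) × (Fin 2 → ℂ)) (f : SpaceFn) :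
    AmbFn.dir (0, v) (pull f) = 0 :=
  dir_of_eq_zero _ fun p t => by simp

/-! ### Derivations -/

/-- Operators obeying the Leibniz rule. -/
def IsDeriv (D : AmbFn →ₗ[ℂ] AmbFn) : Prop := ∀ f g, D (f * g) = D f * g + f * D g

theorem IsDeriv.dir (v : Amb) : IsDeriv (AmbFn.dir v) := dir_mul v

theorem IsDeriv.add {D D' : AmbFn →ₗ[ℂ] AmbFn} (h : IsDeriv D) (h' : IsDeriv D') :
    IsDeriv (D + D') := fun f g => by
  simp only [LinearMap.add_apply, h f g, h' f g]; ring

theorem IsDeriv.neg {D : AmbFn →ₗ[ℂ] AmbFn} (h : IsDeriv D) : IsDeriv (-D) := fun f g => by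
  simp only [LinearMap.neg_apply, h f g]; ring

theorem IsDeriv.sub {D D' : AmbFn →ₗ[ℂ] AmbFn} (h : IsDeriv D) (h' : IsDeriv D') :
    IsDeriv (D - D') := fun f g => by
  simp only [LinearMap.sub_apply, h f g, h' f g]; ring

theorem IsDeriv.smul {D : AmbFn →ₗ[ℂ] AmbFn} (c : ℂ) (h : IsDeriv D) : IsDeriv (c • D) :=
  fun f g => by
    simp only [LinearMap.smul_apply, h f g, smul_add, smul_mul_assoc, mul_smul_comm]

theorem IsDeriv.fn_smul {D : AmbFn →ₗ[ℂ] AmbFn} (c : AmbFn) (h : IsDeriv D) : IsDeriv (c • D) :=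
  fun f g => by
    simp only [LinearMap.smul_apply, h f g, smul_eq_mul]; ring

theorem IsDeriv.sum {ι : Type*} [Fintype ι] {D : ι → AmbFn →ₗ[ℂ] AmbFn}
    (h : ∀ i, IsDeriv (D i)) : IsDeriv (∑ i, D i) := fun f g => by
  simp only [LinearMap.sum_apply, h _ f g, Finset.sum_add_distrib, Finset.sum_mul, Finset.mul_sum]

theorem isDeriv_pdx (α β : Fin 2) : IsDeriv (pdx α β) := by
  have h := fun i : Fin 4 => IsDeriv.dir (EuclideanSpace.single i 1, 0, 0)
  fin_cases α <;> fin_cases β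
  · exact ((h 0).sub ((h 1).smul _)).smul _
  · exact ((h 2).sub ((h 3).smul _)).smul _
  · exact (((h 2).add ((h 3).smul _)).smul _).neg
  · exact ((h 0).add ((h 1).smul _)).smul _

theorem isDeriv_dLamBar (k : Fin 2) : IsDeriv (dLamBar k) :=
  ((IsDeriv.dir _).add ((IsDeriv.dir _).smul _)).smul _

theorem isDeriv_dMuBar (k : Fin 2) : IsDeriv (dMuBar k) :=
  ((IsDeriv.dir _).add ((IsDeriv.dir _).smul _)).smul _

theorem isDeriv_dLamHat (k : Fin 2) : IsDeriv (dLamHat k) := by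
  fin_cases k
  · exact (isDeriv_dLamBar 1).neg
  · exact isDeriv_dLamBar 0

theorem isDeriv_dMuHat (k : Fin 2) : IsDeriv (dMuHat k) := by
  fin_cases k
  · exact (isDeriv_dMuBar 1).neg
  · exact isDeriv_dMuBar 0

theorem isDeriv_hatEL : IsDeriv hatEL := .sum fun _ => (isDeriv_dLamHat _).fn_smul _

theorem isDeriv_hatER : IsDeriv hatER := .sum fun _ => (isDeriv_dMuHat _).fn_smul _

/-! ### Commuting coordinate derivatives -/

/-- Commuting operators. -/
def OpComm (D D' : AmbFn →ₗ[ℂ] AmbFn) : Prop := ∀ f, D (D' f) = D' (D f)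

theorem OpComm.symm {D D' : AmbFn →ₗ[ℂ] AmbFn} (h : OpComm D D') : OpComm D' D :=
  fun f => (h f).symm

theorem OpComm.add_right {D D₁ D₂ : AmbFn →ₗ[ℂ] AmbFn} (h₁ : OpComm D D₁) (h₂ : OpComm D D₂) :
    OpComm D (D₁ + D₂) := fun f => by simp [h₁ f, h₂ f]

theorem OpComm.sub_right {D D₁ D₂ : AmbFn →ₗ[ℂ] AmbFn} (h₁ : OpComm D D₁) (h₂ : OpComm D D₂) :
    OpComm D (D₁ - D₂) := fun f => by simp [h₁ f, h₂ f]

theorem OpComm.neg_right {D D' : AmbFn →ₗ[ℂ] AmbFn} (h : OpComm D D') : OpComm D (-D') :=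
  fun f => by simp [h f]

theorem OpComm.smul_right {D D' : AmbFn →ₗ[ℂ] AmbFn} (h : OpComm D D') (c : ℂ) :
    OpComm D (c • D') := fun f => by simp [h f]

/-- Operators which commute with all directional derivatives. -/
def IsConstCoeff (D : AmbFn →ₗ[ℂ] AmbFn) : Prop := ∀ v, OpComm D (AmbFn.dir v)

theorem isConstCoeff_dir (v : Amb) : IsConstCoeff (AmbFn.dir v) := fun w => dir_comm v w

theorem IsConstCoeff.pdx {D : AmbFn →ₗ[ℂ] AmbFn} (h : IsConstCoeff D) (α β : Fin 2) :
    OpComm D (pdx α β) := by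
  have h' := fun i : Fin 4 => h (EuclideanSpace.single i 1, 0, 0)
  fin_cases α <;> fin_cases β
  · exact ((h' 0).sub_right ((h' 1).smul_right _)).smul_right _
  · exact ((h' 2).sub_right ((h' 3).smul_right _)).smul_right _
  · exact (((h' 2).add_right ((h' 3).smul_right _)).smul_right _).neg_right
  · exact ((h' 0).add_right ((h' 1).smul_right _)).smul_right _

theorem IsConstCoeff.dLamBar {D : AmbFn →ₗ[ℂ] AmbFn} (h : IsConstCoeff D) (k : Fin 2) :
    OpComm D (dLamBar k) := ((h _).add_right ((h _).smul_right _)).smul_right _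

theorem IsConstCoeff.dMuBar {D : AmbFn →ₗ[ℂ] AmbFn} (h : IsConstCoeff D) (k : Fin 2) :
    OpComm D (dMuBar k) := ((h _).add_right ((h _).smul_right _)).smul_right _

theorem isConstCoeff_pdx (α β : Fin 2) : IsConstCoeff (pdx α β) :=
  fun v => ((isConstCoeff_dir v).pdx α β).symm

theorem isConstCoeff_dLamBar (k : Fin 2) : IsConstCoeff (dLamBar k) :=
  fun v => ((isConstCoeff_dir v).dLamBar k).symm

/-! ### Derivatives of the coordinate functions -/

theorem pdx_pull (α β : Fin 2) (f : SpaceFn) : pdx α β (pull f) = pull (pd α β f) := by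
  fin_cases α <;> fin_cases β <;> simp [pdx, pd, spinD, dir_pull]

theorem dLamBar_pull (k : Fin 2) (f : SpaceFn) : dLamBar k (pull f) = 0 := by
  simp [dLamBar, dir_pull_fibre]

theorem dMuBar_pull (k : Fin 2) (f : SpaceFn) : dMuBar k (pull f) = 0 := by
  simp [dMuBar, dir_pull_fibre]

theorem hatEL_pull (f : SpaceFn) : hatEL (pull f) = 0 := by
  simp [hatEL, dLamHat, dLamBar_pull]

theorem hatER_pull (f : SpaceFn) : hatER (pull f) = 0 := by
  simp [hatER, dMuHat, dMuBar_pull]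

theorem pdx_of_eq_zero {F : Amb → ℂ} (hF : ContDiffOn ℝ ∞ F dom)
    (h : ∀ x y z, F (x, z) = F (y, z)) (α β : Fin 2) : pdx α β (AmbFn.of F hF) = 0 := by
  have h' (i : Fin 4) : AmbFn.dir (EuclideanSpace.single i 1, 0, 0) (AmbFn.of F hF) = 0 :=
    dir_of_eq_zero _ fun p t => by
      rw [show p + t • ((EuclideanSpace.single i 1, 0, 0) : Amb) =
        (p.1 + t • EuclideanSpace.single i 1, p.2) from Prod.ext (by simp) (by simp)]
      exact h _ _ _
  fin_cases α <;> fin_cases β <;> simp [pdx, spinD, h']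

theorem pdx_lam (α β k : Fin 2) : pdx α β (lam k) = 0 := pdx_of_eq_zero _ (fun _ _ _ => rfl) _ _
theorem pdx_mu (α β k : Fin 2) : pdx α β (mu k) = 0 := pdx_of_eq_zero _ (fun _ _ _ => rfl) _ _
theorem pdx_nLam (α β : Fin 2) : pdx α β nLam = 0 := pdx_of_eq_zero _ (fun _ _ _ => rfl) _ _
theorem pdx_nMu (α β : Fin 2) : pdx α β nMu = 0 := pdx_of_eq_zero _ (fun _ _ _ => rfl) _ _
theorem pdx_lamHatN (α β k : Fin 2) : pdx α β (lamHatN k) = 0 :=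
  pdx_of_eq_zero _ (fun _ _ _ => rfl) _ _
theorem pdx_muHatN (α β k : Fin 2) : pdx α β (muHatN k) = 0 :=
  pdx_of_eq_zero _ (fun _ _ _ => rfl) _ _

theorem dLamBar_of_eq_zero {F : Amb → ℂ} (hF : ContDiffOn ℝ ∞ F dom)
    (h : ∀ x y z m, F (x, y, m) = F (x, z, m)) (k : Fin 2) : dLamBar k (AmbFn.of F hF) = 0 := by
  have h' (w : Fin 2 → ℂ) : AmbFn.dir (0, w, 0) (AmbFn.of F hF) = 0 :=
    dir_of_eq_zero _ fun p t => by
      rw [show p + t • ((0, w, 0) : Amb) = (p.1, p.2.1 + t • w, p.2.2) from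
        Prod.ext (by simp) (Prod.ext (by simp) (by simp))]
      exact h _ _ _ _
  simp [dLamBar, h']

theorem dMuBar_of_eq_zero {F : Amb → ℂ} (hF : ContDiffOn ℝ ∞ F dom)
    (h : ∀ x l y z, F (x, l, y) = F (x, l, z)) (k : Fin 2) : dMuBar k (AmbFn.of F hF) = 0 := by
  have h' (w : Fin 2 → ℂ) : AmbFn.dir (0, 0, w) (AmbFn.of F hF) = 0 :=
    dir_of_eq_zero _ fun p t => by
      rw [show p + t • ((0, 0, w) : Amb) = (p.1, p.2.1, p.2.2 + t • w) from
        Prod.ext (by simp) (Prod.ext (by simp) (by simp))]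
      exact h _ _ _ _
  simp [dMuBar, h']

/-- Holomorphy: for `k = j` the directions 1 and i contribute 1 and i·i, which cancel. -/
theorem dLamBar_lam (j k : Fin 2) : dLamBar j (lam k) = 0 := by
  have h (z : ℂ) : AmbFn.dir (0, Pi.single j z, 0) (lam k) =
      algebraMap ℂ AmbFn ((Pi.single j z : Fin 2 → ℂ) k) :=
    dir_of_linear _ fun p t => by simp
  simp only [dLamBar, LinearMap.smul_apply, LinearMap.add_apply, h, Algebra.algebraMap_eq_smul_one,
    smul_smul, ← add_smul]
  by_cases hk : k = j
  · subst hk; simp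
  · simp [hk]

theorem dMuBar_mu (j k : Fin 2) : dMuBar j (mu k) = 0 := by
  have h (z : ℂ) : AmbFn.dir (0, 0, Pi.single j z) (mu k) =
      algebraMap ℂ AmbFn ((Pi.single j z : Fin 2 → ℂ) k) :=
    dir_of_linear _ fun p t => by simp
  simp only [dMuBar, LinearMap.smul_apply, LinearMap.add_apply, h, Algebra.algebraMap_eq_smul_one,
    smul_smul, ← add_smul]
  by_cases hk : k = j
  · subst hk; simp
  · simp [hk]

theorem dLamBar_mu (j k : Fin 2) : dLamBar j (mu k) = 0 :=
  dLamBar_of_eq_zero _ (fun _ _ _ _ => rfl) _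
theorem dLamBar_nMu (j : Fin 2) : dLamBar j nMu = 0 :=
  dLamBar_of_eq_zero _ (fun _ _ _ _ => rfl) _
theorem dLamBar_muHatN (j k : Fin 2) : dLamBar j (muHatN k) = 0 :=
  dLamBar_of_eq_zero _ (fun _ _ _ _ => rfl) _
theorem dMuBar_lam (j k : Fin 2) : dMuBar j (lam k) = 0 :=
  dMuBar_of_eq_zero _ (fun _ _ _ _ => rfl) _
theorem dMuBar_nLam (j : Fin 2) : dMuBar j nLam = 0 :=
  dMuBar_of_eq_zero _ (fun _ _ _ _ => rfl) _
theorem dMuBar_lamHatN (j k : Fin 2) : dMuBar j (lamHatN k) = 0 :=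
  dMuBar_of_eq_zero _ (fun _ _ _ _ => rfl) _

/-! ### Conjugate coordinates and the ladder action of `hatEL` and `hatER`. -/

/-- The function `conj λ_k`. -/
noncomputable def lamBar (k : Fin 2) : AmbFn :=
  AmbFn.of (fun p => Complex.conjCLE (p.2.1 k)) (by fun_prop)

/-- The function `conj μ_k`. -/
noncomputable def muBar (k : Fin 2) : AmbFn :=
  AmbFn.of (fun p => Complex.conjCLE (p.2.2 k)) (by fun_prop)

/-- In contrast to `dLamBar_lam`, the directions 1 and i now contribute 1 and i·(−i) = 1, and the
prefactor 1/2 normalises the sum. -/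
theorem dLamBar_lamBar (j k : Fin 2) : dLamBar j (lamBar k) = if k = j then 1 else 0 := by
  have h (z : ℂ) : AmbFn.dir (0, Pi.single j z, 0) (lamBar k) =
      algebraMap ℂ AmbFn (starRingEnd ℂ ((Pi.single j z : Fin 2 → ℂ) k)) :=
    dir_of_linear _ fun p t => by simp
  simp only [dLamBar, LinearMap.smul_apply, LinearMap.add_apply, h, Algebra.algebraMap_eq_smul_one,
    smul_smul, ← add_smul]
  by_cases hk : k = j
  · subst hk; simp [← two_mul]
  · simp [hk]

theorem dMuBar_muBar (j k : Fin 2) : dMuBar j (muBar k) = if k = j then 1 else 0 := by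
  have h (z : ℂ) : AmbFn.dir (0, 0, Pi.single j z) (muBar k) =
      algebraMap ℂ AmbFn (starRingEnd ℂ ((Pi.single j z : Fin 2 → ℂ) k)) :=
    dir_of_linear _ fun p t => by simp
  simp only [dMuBar, LinearMap.smul_apply, LinearMap.add_apply, h, Algebra.algebraMap_eq_smul_one,
    smul_smul, ← add_smul]
  by_cases hk : k = j
  · subst hk; simp [← two_mul]
  · simp [hk]

/-- The sign is forced by the conventions in `epsUp` and `hat`: |λ|² is negative on nonzero spinors.
Only its having no zeros on `dom` is needed for cancellation. -/
theorem nLam_eq : nLam = -(lam 0 * lamBar 0 + lam 1 * lamBar 1) := by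
  ext p
  change spinNorm p.1.2.1 =
    -(p.1.2.1 0 * starRingEnd ℂ (p.1.2.1 0) + p.1.2.1 1 * starRingEnd ℂ (p.1.2.1 1))
  simp only [spinNorm, raise, hat, epsUp, Fin.sum_univ_two]
  simp
  ring

theorem nMu_eq : nMu = -(mu 0 * muBar 0 + mu 1 * muBar 1) := by
  ext p
  change spinNorm p.1.2.2 =
    -(p.1.2.2 0 * starRingEnd ℂ (p.1.2.2 0) + p.1.2.2 1 * starRingEnd ℂ (p.1.2.2 1))
  simp only [spinNorm, raise, hat, epsUp, Fin.sum_univ_two]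
  simp
  ring

/-- This allows identities for `lamHatN` to be checked after multiplication by |λ|², so that no
quotient has to be differentiated. -/
theorem nLam_mul_cancel {f g : AmbFn} (h : nLam * f = nLam * g) : f = g := by
  ext p
  have := congrArg (fun F : AmbFn => F.1 p) h
  exact mul_left_cancel₀ (spinNorm_ne_zero p.2.1) this

theorem nMu_mul_cancel {f g : AmbFn} (h : nMu * f = nMu * g) : f = g := by
  ext p
  have := congrArg (fun F : AmbFn => F.1 p) h
  exact mul_left_cancel₀ (spinNorm_ne_zero p.2.2) this

theorem nLam_mul_lamHatN (k : Fin 2) : nLam * lamHatN k = ![-lamBar 1, lamBar 0] k := by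
  ext p
  have h := spinNorm_ne_zero p.2.1
  have : (nLam * lamHatN k : AmbFn).1 p = hat p.1.2.1 k := by
    change spinNorm p.1.2.1 * (hat p.1.2.1 k * (spinNorm p.1.2.1)⁻¹) = _
    field_simp
  refine this.trans ?_
  fin_cases k <;> rfl

theorem nMu_mul_muHatN (k : Fin 2) : nMu * muHatN k = ![-muBar 1, muBar 0] k := by
  ext p
  have h := spinNorm_ne_zero p.2.2
  have : (nMu * muHatN k : AmbFn).1 p = hat p.1.2.2 k := by
    change spinNorm p.1.2.2 * (hat p.1.2.2 k * (spinNorm p.1.2.2)⁻¹) = _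
    field_simp
  refine this.trans ?_
  fin_cases k <;> rfl

theorem hatEL_apply (f : AmbFn) :
    hatEL f = nLam * (lam 1 * dLamBar 0 f - lam 0 * dLamBar 1 f) := by
  simp [hatEL, dLamHat, Fin.sum_univ_two]
  ring

theorem hatER_apply (f : AmbFn) :
    hatER f = nMu * (mu 1 * dMuBar 0 f - mu 0 * dMuBar 1 f) := by
  simp [hatER, dMuHat, Fin.sum_univ_two]
  ring

theorem hatEL_lam (k : Fin 2) : hatEL (lam k) = 0 := by simp [hatEL_apply, dLamBar_lam]
theorem hatEL_mu (k : Fin 2) : hatEL (mu k) = 0 := by simp [hatEL_apply, dLamBar_mu]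
theorem hatEL_nMu : hatEL nMu = 0 := by simp [hatEL_apply, dLamBar_nMu]
theorem hatEL_muHatN (k : Fin 2) : hatEL (muHatN k) = 0 := by simp [hatEL_apply, dLamBar_muHatN]
theorem hatER_mu (k : Fin 2) : hatER (mu k) = 0 := by simp [hatER_apply, dMuBar_mu]
theorem hatER_lam (k : Fin 2) : hatER (lam k) = 0 := by simp [hatER_apply, dMuBar_lam]
theorem hatER_lamHatN (k : Fin 2) : hatER (lamHatN k) = 0 := by simp [hatER_apply, dMuBar_lamHatN]

theorem hatEL_lamBar (k : Fin 2) : hatEL (lamBar k) = nLam * ![lam 1, -lam 0] k := by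
  fin_cases k <;> simp [hatEL_apply, dLamBar_lamBar]

theorem hatER_muBar (k : Fin 2) : hatER (muBar k) = nMu * ![mu 1, -mu 0] k := by
  fin_cases k <;> simp [hatER_apply, dMuBar_muBar]

/-- Up to the factor |λ|², the derivation replaces λ̂ by λ in |λ|² = λ_α̇ λ̂^α̇, and the
ε-contraction of λ with itself is zero. -/
theorem hatEL_nLam : hatEL nLam = 0 := by
  rw [nLam_eq, map_neg, map_add, isDeriv_hatEL, isDeriv_hatEL, hatEL_lam, hatEL_lam,
    hatEL_lamBar, hatEL_lamBar]
  simp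
  ring

theorem hatER_nMu : hatER nMu = 0 := by
  rw [nMu_eq, map_neg, map_add, isDeriv_hatER, isDeriv_hatER, hatER_mu, hatER_mu,
    hatER_muBar, hatER_muBar]
  simp
  ring

/-- The basic ladder relation λ' ↦ λ. Since |λ|² is annihilated, applying the derivation to |λ|² λ'
= λ̂ gives |λ|² times the image of λ' on the left and |λ|² λ on the right. -/
theorem hatEL_lamHatN (k : Fin 2) : hatEL (lamHatN k) = lam k := by
  apply nLam_mul_cancel
  have h := congrArg hatEL (nLam_mul_lamHatN k)
  rw [isDeriv_hatEL, hatEL_nLam, zero_mul, zero_add] at h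
  rw [h]
  fin_cases k <;> simp [hatEL_lamBar]
  ring

theorem hatER_muHatN (k : Fin 2) : hatER (muHatN k) = mu k := by
  apply nMu_mul_cancel
  have h := congrArg hatER (nMu_mul_muHatN k)
  rw [isDeriv_hatER, hatER_nMu, zero_mul, zero_add] at h
  rw [h]
  fin_cases k <;> simp [hatER_muBar]
  ring

/-! ### Spinor frames -/

/-- Spinors which do not depend on the point of `ℝ⁴`. -/
class XConst (v : Fin 2 → AmbFn) : Prop where
  pdx_eq : ∀ α β i, pdx α β (v i) = 0

theorem map_raise (D : AmbFn →ₗ[ℂ] AmbFn) (v : Fin 2 → AmbFn) (i : Fin 2) :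
    D (raise v i) = raise (fun j => D (v j)) i := by
  simp [raise]

theorem raise_zero (i : Fin 2) : raise (fun _ => (0 : AmbFn)) i = 0 := by
  simp [raise]

instance : XConst lu := ⟨fun α β i => by simp [lu, map_raise, pdx_lam, raise_zero]⟩
instance : XConst mv := ⟨fun α β i => by simp [mv, map_raise, pdx_mu, raise_zero]⟩
instance : XConst lh := ⟨fun α β i => by simp [lh, map_raise, pdx_lamHatN, raise_zero]⟩
instance : XConst mh := ⟨fun α β i => by simp [mh, map_raise, pdx_muHatN, raise_zero]⟩

/-- The operator `D` maps the components of the spinor `v` to those of `v'`. -/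
class Acts (D : AmbFn →ₗ[ℂ] AmbFn) (v : Fin 2 → AmbFn) (v' : outParam (Fin 2 → AmbFn)) : Prop where
  eq : ∀ i, D (v i) = v' i

/-- The complete action of the ladder operators on the frame. Since the image spinor is an
`outParam`, instance search computes it, and rules such as `hatEL_spinDir` or `hatEL_con2` can be
used by `simp` for any contraction with frame spinors. -/
instance : Acts hatEL lu 0 := ⟨fun i => by simp [lu, map_raise, hatEL_lam, raise_zero]⟩
instance : Acts hatEL lh lu := ⟨fun i => by simp only [lu, lh, map_raise, hatEL_lamHatN]⟩
instance : Acts hatEL mv 0 := ⟨fun i => by simp [mv, map_raise, hatEL_mu, raise_zero]⟩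
instance : Acts hatEL mh 0 := ⟨fun i => by simp [mh, map_raise, hatEL_muHatN, raise_zero]⟩
instance : Acts hatER mv 0 := ⟨fun i => by simp [mv, map_raise, hatER_mu, raise_zero]⟩
instance : Acts hatER mh mv := ⟨fun i => by simp only [mv, mh, map_raise, hatER_muHatN]⟩
instance : Acts hatER lu 0 := ⟨fun i => by simp [lu, map_raise, hatER_lam, raise_zero]⟩
instance : Acts hatER lh 0 := ⟨fun i => by simp [lh, map_raise, hatER_lamHatN, raise_zero]⟩

/-- The frame has determinant one. Equivalently ε^{α̇β̇} = λ^α̇ λ'^β̇ − λ'^α̇ λ^β̇, and this is how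
traces are expressed in the frame: a factor 1 is inserted and rewritten by this identity. -/
theorem lu_lh : lu 1 * lh 0 - lu 0 * lh 1 = 1 := by
  apply nLam_mul_cancel
  have h0 := nLam_mul_lamHatN 0
  have h1 := nLam_mul_lamHatN 1
  simp only [Matrix.cons_val_zero, Matrix.cons_val_one] at h0 h1
  simp only [lu, lh, raise, epsUp, Fin.sum_univ_two, Matrix.of_apply, Matrix.cons_val_zero,
    Matrix.cons_val_one, zero_smul, one_smul, neg_smul, zero_add, add_zero]
  have := nLam_eq
  linear_combination (-lam 0) * h1 + lam 1 * h0 - this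

theorem mv_mh : mv 1 * mh 0 - mv 0 * mh 1 = 1 := by
  apply nMu_mul_cancel
  have h0 := nMu_mul_muHatN 0
  have h1 := nMu_mul_muHatN 1
  simp only [Matrix.cons_val_zero, Matrix.cons_val_one] at h0 h1
  simp only [mv, mh, raise, epsUp, Fin.sum_univ_two, Matrix.of_apply, Matrix.cons_val_zero,
    Matrix.cons_val_one, zero_smul, one_smul, neg_smul, zero_add, add_zero]
  have := nMu_eq
  linear_combination (-mu 0) * h1 + mu 1 * h0 - this

/-- The operator `w^α v^α̇ ∂_{αα̇}`. -/
noncomputable def spinDir (w v : Fin 2 → AmbFn) : AmbFn →ₗ[ℂ] AmbFn :=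
  ∑ α, ∑ β, (w α * v β) • pdx α β

theorem hatEF_eq : hatEF = spinDir mv lu := rfl
theorem EW_eq : EW = spinDir mv lh := rfl
theorem EWhat_eq : EWhat = -spinDir mh lu := rfl

theorem spinDir_apply (w v : Fin 2 → AmbFn) (f : AmbFn) :
    spinDir w v f = ∑ α, ∑ β, w α * v β * pdx α β f := by
  simp [spinDir]

theorem isDeriv_spinDir (w v : Fin 2 → AmbFn) : IsDeriv (spinDir w v) :=
  .sum fun _ => .sum fun _ => (isDeriv_pdx _ _).fn_smul _

@[simp] theorem spinDir_zero_left (v : Fin 2 → AmbFn) : spinDir 0 v = 0 := by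
  ext f : 1; simp [spinDir_apply]

@[simp] theorem spinDir_zero_right (w : Fin 2 → AmbFn) : spinDir w 0 = 0 := by
  ext f : 1; simp [spinDir_apply]

/-- The coefficients do not depend on x, hence only the commutativity of the coordinate derivatives
is involved. -/
theorem spinDir_comm (w v w' v' : Fin 2 → AmbFn) [hw : XConst w] [hv : XConst v] [hw' : XConst w']
    [hv' : XConst v'] (f : AmbFn) :
    spinDir w v (spinDir w' v' f) = spinDir w' v' (spinDir w v f) := by
  have h (a b c d : Fin 2) : pdx a b (pdx c d f) = pdx c d (pdx a b f) :=
    (isConstCoeff_pdx a b).pdx c d f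
  simp only [spinDir_apply, map_sum, isDeriv_pdx _ _ _ _, hw.pdx_eq, hv.pdx_eq, hw'.pdx_eq,
    hv'.pdx_eq, mul_zero, zero_mul, add_zero, zero_add]
  simp only [Fin.sum_univ_two]
  -- Each mixed second derivative gets one fixed order, after which `ring` can treat it as an atom.
  rw [h 1 1 0 0, h 1 1 0 1, h 1 1 1 0, h 1 0 0 0, h 1 0 0 1, h 0 1 0 0]
  ring

theorem hatEL_pdx_comm (α β : Fin 2) (f : AmbFn) : hatEL (pdx α β f) = pdx α β (hatEL f) := by
  have h (a : Fin 2) : dLamBar a (pdx α β f) = pdx α β (dLamBar a f) :=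
    (isConstCoeff_dLamBar a).pdx α β f
  simp only [hatEL_apply, isDeriv_pdx _ _ _ _, pdx_nLam, map_sub, pdx_lam, h]
  ring

theorem hatER_pdx_comm (α β : Fin 2) (f : AmbFn) : hatER (pdx α β f) = pdx α β (hatER f) := by
  have h (a : Fin 2) : dMuBar a (pdx α β f) = pdx α β (dMuBar a f) :=
    ((isConstCoeff_pdx α β).dMuBar a f).symm
  simp only [hatER_apply, isDeriv_pdx _ _ _ _, pdx_nMu, map_sub, pdx_mu, h]
  ring

theorem hatEL_hatER_comm (f : AmbFn) : hatEL (hatER f) = hatER (hatEL f) := by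
  have h (a b : Fin 2) : dLamBar a (dMuBar b f) = dMuBar b (dLamBar a f) :=
    (isConstCoeff_dLamBar a).dMuBar b f
  rw [hatER_apply, isDeriv_hatEL, hatEL_nMu, map_sub, isDeriv_hatEL, isDeriv_hatEL, hatEL_mu,
    hatEL_mu, hatEL_apply (f := dMuBar 0 f), hatEL_apply (f := dMuBar 1 f), hatEL_apply (f := f),
    hatER_apply]
  simp only [isDeriv_dMuBar _ _ _, map_sub, dMuBar_nLam, dMuBar_lam, h]
  ring

/-- The vertical field commutes with ∂_{αα̇}, so by the Leibniz rule the commutator acts only on the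
two spinor coefficients. This rule and its counterpart for `hatER` move the ladder operators past
derivatives in all later computations. -/
theorem hatEL_spinDir (w v : Fin 2 → AmbFn) {w' v' : Fin 2 → AmbFn} [hw : Acts hatEL w w']
    [hv : Acts hatEL v v'] (f : AmbFn) :
    hatEL (spinDir w v f) = spinDir w v (hatEL f) + spinDir w' v f + spinDir w v' f := by
  simp only [spinDir_apply, map_sum, isDeriv_hatEL _ _, hw.eq, hv.eq, hatEL_pdx_comm,
    ← Finset.sum_add_distrib]
  exact Finset.sum_congr rfl fun _ _ => Finset.sum_congr rfl fun _ _ => by ring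

theorem hatER_spinDir (w v : Fin 2 → AmbFn) {w' v' : Fin 2 → AmbFn} [hw : Acts hatER w w']
    [hv : Acts hatER v v'] (f : AmbFn) :
    hatER (spinDir w v f) = spinDir w v (hatER f) + spinDir w' v f + spinDir w v' f := by
  simp only [spinDir_apply, map_sum, isDeriv_hatER _ _, hw.eq, hv.eq, hatER_pdx_comm,
    ← Finset.sum_add_distrib]
  exact Finset.sum_congr rfl fun _ _ => Finset.sum_congr rfl fun _ _ => by ring

/-! ### Contractions in a frame -/

theorem con1_apply (v : Fin 2 → AmbFn) (T : T1) : con1 v T = ∑ a, pull (T a) * v a := rfl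
theorem con2_apply (v₁ v₂ : Fin 2 → AmbFn) (T : T2) :
    con2 v₁ v₂ T = ∑ a, con1 v₂ (T a) * v₁ a := rfl
theorem con3_apply (v₁ v₂ v₃ : Fin 2 → AmbFn) (T : T3) :
    con3 v₁ v₂ v₃ T = ∑ a, con2 v₂ v₃ (T a) * v₁ a := rfl
theorem con4_apply (v₁ v₂ v₃ v₄ : Fin 2 → AmbFn) (T : T4) :
    con4 v₁ v₂ v₃ v₄ T = ∑ a, con3 v₂ v₃ v₄ (T a) * v₁ a := rfl
theorem con5_apply (v₁ v₂ v₃ v₄ v₅ : Fin 2 → AmbFn) (T : T5) :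
    con5 v₁ v₂ v₃ v₄ v₅ T = ∑ a, con4 v₂ v₃ v₄ v₅ (T a) * v₁ a := rfl
theorem con6_apply (v₁ v₂ v₃ v₄ v₅ v₆ : Fin 2 → AmbFn) (T : T6) :
    con6 v₁ v₂ v₃ v₄ v₅ v₆ T = ∑ a, con5 v₂ v₃ v₄ v₅ v₆ (T a) * v₁ a := rfl

@[simp] theorem con1_zero_left : con1 0 = 0 := by
  exact LinearMap.ext fun T => by simp [con1_apply]
@[simp] theorem con2_zero_left (v : Fin 2 → AmbFn) : con2 0 v = 0 := by
  exact LinearMap.ext fun T => by simp [con2_apply]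
@[simp] theorem con2_zero_right (v : Fin 2 → AmbFn) : con2 v 0 = 0 := by
  exact LinearMap.ext fun T => by simp [con2_apply]

/-- Components of fields on ℝ⁴ are constants for a vertical derivation, so the Leibniz rule only
touches the spinors. -/
theorem IsDeriv.con1 {D : AmbFn →ₗ[ℂ] AmbFn} (hD : IsDeriv D) (h : ∀ f, D (pull f) = 0)
    (v : Fin 2 → AmbFn) {v' : Fin 2 → AmbFn} [hv : Acts D v v'] (T : T1) :
    D (con1 v T) = CRAmbitwistor.con1 v' T := by
  simp only [con1_apply, map_sum, hD _ _, h, hv.eq, zero_mul, zero_add]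

theorem IsDeriv.con2 {D : AmbFn →ₗ[ℂ] AmbFn} (hD : IsDeriv D) (h : ∀ f, D (pull f) = 0)
    (v w : Fin 2 → AmbFn) {v' w' : Fin 2 → AmbFn} [hv : Acts D v v'] [hw : Acts D w w'] (T : T2) :
    D (con2 v w T) = CRAmbitwistor.con2 v' w T + CRAmbitwistor.con2 v w' T := by
  simp only [con2_apply, map_sum, hD _ _, hD.con1 h, hv.eq, ← Finset.sum_add_distrib]
  exact Finset.sum_congr rfl fun _ _ => by ring

theorem hatEL_con1 (v : Fin 2 → AmbFn) {v' : Fin 2 → AmbFn} [Acts hatEL v v'] (T : T1) :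
    hatEL (con1 v T) = con1 v' T := isDeriv_hatEL.con1 hatEL_pull v T

theorem hatER_con1 (v : Fin 2 → AmbFn) {v' : Fin 2 → AmbFn} [Acts hatER v v'] (T : T1) :
    hatER (con1 v T) = con1 v' T := isDeriv_hatER.con1 hatER_pull v T

theorem hatEL_con2 (v w : Fin 2 → AmbFn) {v' w' : Fin 2 → AmbFn} [Acts hatEL v v']
    [Acts hatEL w w'] (T : T2) : hatEL (con2 v w T) = con2 v' w T + con2 v w' T :=
  isDeriv_hatEL.con2 hatEL_pull v w T

theorem hatER_con2 (v w : Fin 2 → AmbFn) {v' w' : Fin 2 → AmbFn} [Acts hatER v v']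
    [Acts hatER w w'] (T : T2) : hatER (con2 v w T) = con2 v' w T + con2 v w' T :=
  isDeriv_hatER.con2 hatER_pull v w T

theorem con2_symm {B : T2} (hB : B ∈ Sym) (v w : Fin 2 → AmbFn) : con2 v w B = con2 w v B := by
  simp only [con2_apply, con1_apply, Fin.sum_univ_two, hB 1 0]
  ring

/-- Contraction of the index of a derivative. -/
theorem spinDir_pull (w v : Fin 2 → AmbFn) (f : SpaceFn) :
    spinDir w v (pull f) = ∑ α, ∑ β, pull (pd α β f) * (w α * v β) := by
  simp only [spinDir_apply, pdx_pull]
  exact Finset.sum_congr rfl fun _ _ => Finset.sum_congr rfl fun _ _ => by ring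

theorem spinDir_xconst (w v s : Fin 2 → AmbFn) [hs : XConst s] (i : Fin 2) :
    spinDir w v (s i) = 0 := by
  simp [spinDir_apply, hs.pdx_eq]

theorem spinDir_con1 (w v s : Fin 2 → AmbFn) [XConst s] (T : T1) :
    spinDir w v (con1 s T) = ∑ i, spinDir w v (pull (T i)) * s i := by
  simp only [con1_apply, map_sum, isDeriv_spinDir _ _ _ _, spinDir_xconst, mul_zero, add_zero]

theorem spinDir_con2 (w v s t : Fin 2 → AmbFn) [XConst s] [XConst t] (T : T2) :
    spinDir w v (con2 s t T) = ∑ i, spinDir w v (con1 t (T i)) * s i := by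
  simp only [con2_apply, map_sum, isDeriv_spinDir _ _ _ _, spinDir_xconst, mul_zero, add_zero]

/-- `∂_{αα̇} T_β`, contracted. -/
theorem con3_pd (w v s : Fin 2 → AmbFn) [XConst s] (T : T1) :
    con3 w v s (fun a x i => pd a x (T i)) = spinDir w v (con1 s T) := by
  rw [spinDir_con1]
  simp only [spinDir_pull, con3_apply, con2_apply, con1_apply, Fin.sum_univ_two]
  ring

theorem con4_pd (w v s t : Fin 2 → AmbFn) [XConst s] [XConst t] (T : T2) :
    con4 w v s t (fun a x i j => pd a x (T i j)) = spinDir w v (con2 s t T) := by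
  rw [spinDir_con2]
  simp only [spinDir_con1]
  simp only [spinDir_pull, con4_apply, con3_apply, con2_apply, con1_apply, Fin.sum_univ_two]
  ring

theorem con2_grad (w v : Fin 2 → AmbFn) (f : SpaceFn) :
    con2 w v (grad f) = spinDir w v (pull f) := by
  simp only [spinDir_pull, con2_apply, con1_apply, Fin.sum_univ_two, grad, LinearMap.coe_mk,
    AddHom.coe_mk]
  ring

theorem con4_grad2 (w v w' v' : Fin 2 → AmbFn) [XConst w'] [XConst v'] (f : SpaceFn) :
    con4 w v w' v' (grad2 f) = spinDir w v (spinDir w' v' (pull f)) := by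
  rw [← con2_grad, ← con4_pd]; rfl

/-! ### Contractions of symmetrised tensors. -/

theorem con2_sym2 (v w : Fin 2 → AmbFn) (T : T2) :
    con2 v w (sym2 T) = (1 / 2 : ℂ) • (con2 v w T + con2 w v T) := by
  simp only [con2_apply, con1_apply, Fin.sum_univ_two, sym2, LinearMap.coe_mk, AddHom.coe_mk,
    map_smul, map_add, smul_mul_assoc, add_mul, ← smul_add]
  congr 1
  ring

theorem con3_sym3 (x y z : Fin 2 → AmbFn) (T : T3) :
    con3 x y z (sym3 T) = (1 / 6 : ℂ) • (con3 x y z T + con3 x z y T + con3 y x z T +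
      con3 y z x T + con3 z x y T + con3 z y x T) := by
  simp only [con3_apply, con2_apply, con1_apply, Fin.sum_univ_two, sym3, sym2, LinearMap.coe_mk,
    AddHom.coe_mk, map_smul, map_add, smul_mul_assoc, add_mul, ← smul_add, smul_smul]
  norm_num1
  congr 1
  ring

/-- Permuting tensor indices is the same as permuting the spinors put into them. The nested
definition of `sym4` runs over the cosets of the smaller symmetric groups, so that all 24
permutations occur once with equal weight. -/
theorem con4_sym4 (x y z w : Fin 2 → AmbFn) (T : T4) :
    con4 x y z w (sym4 T) = (1 / 24 : ℂ) • (
      con4 x y z w T + con4 x y w z T + con4 x z y w T + con4 x z w y T + con4 x w y z T +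
      con4 x w z y T + con4 y x z w T + con4 y x w z T + con4 y z x w T + con4 y z w x T +
      con4 y w x z T + con4 y w z x T + con4 z x y w T + con4 z x w y T + con4 z y x w T +
      con4 z y w x T + con4 z w x y T + con4 z w y x T + con4 w x y z T + con4 w x z y T +
      con4 w y x z T + con4 w y z x T + con4 w z x y T + con4 w z y x T) := by
  simp only [con4_apply, con3_apply, con2_apply, con1_apply, Fin.sum_univ_two, sym4, sym3, sym2,
    LinearMap.coe_mk, AddHom.coe_mk, map_smul, map_add, smul_mul_assoc, add_mul, ← smul_add,
    smul_smul]
  norm_num1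
  congr 1
  ring

/-! ### Tensor operations in a frame -/

/-- The primed variants serve tensors in which dotted indices precede undotted ones, as in
`gradUnd`, `dUnd` and `ddUnd`. -/
theorem con3_pd' (v w s : Fin 2 → AmbFn) [XConst s] (T : T1) :
    con3 v w s (fun x a i => pd a x (T i)) = spinDir w v (con1 s T) := by
  rw [← con3_pd]
  simp only [con3_apply, con2_apply, con1_apply, Fin.sum_univ_two]
  ring

theorem con4_pd' (v w s t : Fin 2 → AmbFn) [XConst s] [XConst t] (T : T2) :
    con4 v w s t (fun x a i j => pd a x (T i j)) = spinDir w v (con2 s t T) := by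
  rw [← con4_pd]
  simp only [con4_apply, con3_apply, con2_apply, con1_apply, Fin.sum_univ_two]
  ring

/-- The outer derivative passes through every spinor inside it because these are independent of x;
hence no condition is imposed on the outermost pair `w`, `v`. -/
theorem con5_pd_pd (w w' v v' s : Fin 2 → AmbFn) [XConst w'] [XConst v'] [XConst s] (T : T1) :
    con5 w w' v v' s (fun a b x y i => pd a x (pd b y (T i))) =
      spinDir w v (spinDir w' v' (con1 s T)) := by
  rw [← con3_pd, con3_apply, map_sum]
  simp only [isDeriv_spinDir _ _ _ _, spinDir_xconst, mul_zero, add_zero, ← con4_pd]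
  simp only [con5_apply, con4_apply, con3_apply, con2_apply, con1_apply, Fin.sum_univ_two]
  ring

theorem con6_pd_pd (w w' v v' s t : Fin 2 → AmbFn) [XConst w'] [XConst v'] [XConst s] [XConst t]
    (T : T2) :
    con6 w w' v v' s t (fun a b x y i j => pd a x (pd b y (T i j))) =
      spinDir w v (spinDir w' v' (con2 s t T)) := by
  rw [con2_apply, map_sum, map_sum]
  simp only [isDeriv_spinDir _ _ _ _, spinDir_xconst, mul_zero, add_zero, ← con5_pd_pd]
  simp only [con6_apply, con5_apply, con4_apply, con3_apply, con2_apply, con1_apply,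
    Fin.sum_univ_two]
  ring

theorem con5_pd_pd' (v v' w w' s : Fin 2 → AmbFn) [XConst w'] [XConst v'] [XConst s] (T : T1) :
    con5 v v' w w' s (fun x y a b i => pd a x (pd b y (T i))) =
      spinDir w v (spinDir w' v' (con1 s T)) := by
  rw [← con5_pd_pd]
  simp only [con5_apply, con4_apply, con3_apply, con2_apply, con1_apply, Fin.sum_univ_two]
  ring

theorem con6_pd_pd' (v v' w w' s t : Fin 2 → AmbFn) [XConst w'] [XConst v'] [XConst s] [XConst t]
    (T : T2) :
    con6 v v' w w' s t (fun x y a b i j => pd a x (pd b y (T i j))) =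
      spinDir w v (spinDir w' v' (con2 s t T)) := by
  rw [← con6_pd_pd]
  simp only [con6_apply, con5_apply, con4_apply, con3_apply, con2_apply, con1_apply,
    Fin.sum_univ_two]
  ring

theorem con3_gradDot (w x y : Fin 2 → AmbFn) [XConst x] [XConst y] (f : T1) :
    con3 w x y (gradDot f) =
      (1 / 2 : ℂ) • (spinDir w x (con1 y f) + spinDir w y (con1 x f)) := by
  rw [← con3_pd, ← con3_pd]
  simp only [gradDot, LinearMap.coe_mk, AddHom.coe_mk, con3_apply, con2_sym2, smul_mul_assoc,
    add_mul, ← Finset.smul_sum, Finset.sum_add_distrib]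

theorem con3_gradUnd (v a b : Fin 2 → AmbFn) [XConst a] [XConst b] (f : T1) :
    con3 v a b (gradUnd f) =
      (1 / 2 : ℂ) • (spinDir a v (con1 b f) + spinDir b v (con1 a f)) := by
  rw [← con3_pd', ← con3_pd']
  simp only [gradUnd, LinearMap.coe_mk, AddHom.coe_mk, con3_apply, con2_sym2, smul_mul_assoc,
    add_mul, ← Finset.smul_sum, Finset.sum_add_distrib]

theorem con4_dDot (w x y z : Fin 2 → AmbFn) [XConst x] [XConst y] [XConst z] (B : T2) :
    con4 w x y z (dDot B) = (1 / 6 : ℂ) • (spinDir w x (con2 y z B) + spinDir w x (con2 z y B) +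
      spinDir w y (con2 x z B) + spinDir w y (con2 z x B) + spinDir w z (con2 x y B) +
      spinDir w z (con2 y x B)) := by
  simp only [← con4_pd]
  simp only [dDot, LinearMap.coe_mk, AddHom.coe_mk, con4_apply, con3_sym3, smul_mul_assoc,
    add_mul, ← Finset.smul_sum, Finset.sum_add_distrib]

theorem con4_dUnd (v a b c : Fin 2 → AmbFn) [XConst a] [XConst b] [XConst c] (B : T2) :
    con4 v a b c (dUnd B) = (1 / 6 : ℂ) • (spinDir a v (con2 b c B) + spinDir a v (con2 c b B) +
      spinDir b v (con2 a c B) + spinDir b v (con2 c a B) + spinDir c v (con2 a b B) +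
      spinDir c v (con2 b a B)) := by
  simp only [← con4_pd']
  simp only [dUnd, LinearMap.coe_mk, AddHom.coe_mk, con4_apply, con3_sym3, smul_mul_assoc,
    add_mul, ← Finset.smul_sum, Finset.sum_add_distrib]

theorem con5_grad2Dot (a b x y z : Fin 2 → AmbFn) [XConst b] [XConst x] [XConst y] [XConst z]
    (f : T1) :
    con5 a b x y z (grad2Dot f) = (1 / 6 : ℂ) • (
      spinDir a x (spinDir b y (con1 z f)) + spinDir a x (spinDir b z (con1 y f)) +
      spinDir a y (spinDir b x (con1 z f)) + spinDir a y (spinDir b z (con1 x f)) +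
      spinDir a z (spinDir b x (con1 y f)) + spinDir a z (spinDir b y (con1 x f))) := by
  simp only [← con5_pd_pd]
  simp only [grad2Dot, LinearMap.coe_mk, AddHom.coe_mk, con5_apply, con4_apply, con3_sym3,
    smul_mul_assoc, add_mul, ← Finset.smul_sum, Finset.sum_add_distrib]

theorem con5_grad2Und (x y a b c : Fin 2 → AmbFn) [XConst y] [XConst a] [XConst b] [XConst c]
    (f : T1) :
    con5 x y a b c (grad2Und f) = (1 / 6 : ℂ) • (
      spinDir a x (spinDir b y (con1 c f)) + spinDir a x (spinDir c y (con1 b f)) +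
      spinDir b x (spinDir a y (con1 c f)) + spinDir b x (spinDir c y (con1 a f)) +
      spinDir c x (spinDir a y (con1 b f)) + spinDir c x (spinDir b y (con1 a f))) := by
  simp only [← con5_pd_pd']
  simp only [grad2Und, LinearMap.coe_mk, AddHom.coe_mk, con5_apply, con4_apply, con3_sym3,
    smul_mul_assoc, add_mul, ← Finset.smul_sum, Finset.sum_add_distrib]

theorem con6_ddDot (a b x y z w : Fin 2 → AmbFn) [XConst b] [XConst x] [XConst y] [XConst z]
    [XConst w] (B : T2) :
    con6 a b x y z w (ddDot B) = (1 / 24 : ℂ) • (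
      spinDir a x (spinDir b y (con2 z w B)) + spinDir a x (spinDir b y (con2 w z B)) +
      spinDir a x (spinDir b z (con2 y w B)) + spinDir a x (spinDir b z (con2 w y B)) +
      spinDir a x (spinDir b w (con2 y z B)) + spinDir a x (spinDir b w (con2 z y B)) +
      spinDir a y (spinDir b x (con2 z w B)) + spinDir a y (spinDir b x (con2 w z B)) +
      spinDir a y (spinDir b z (con2 x w B)) + spinDir a y (spinDir b z (con2 w x B)) +
      spinDir a y (spinDir b w (con2 x z B)) + spinDir a y (spinDir b w (con2 z x B)) +
      spinDir a z (spinDir b x (con2 y w B)) + spinDir a z (spinDir b x (con2 w y B)) +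
      spinDir a z (spinDir b y (con2 x w B)) + spinDir a z (spinDir b y (con2 w x B)) +
      spinDir a z (spinDir b w (con2 x y B)) + spinDir a z (spinDir b w (con2 y x B)) +
      spinDir a w (spinDir b x (con2 y z B)) + spinDir a w (spinDir b x (con2 z y B)) +
      spinDir a w (spinDir b y (con2 x z B)) + spinDir a w (spinDir b y (con2 z x B)) +
      spinDir a w (spinDir b z (con2 x y B)) + spinDir a w (spinDir b z (con2 y x B))) := by
  simp only [← con6_pd_pd]
  simp only [ddDot, LinearMap.coe_mk, AddHom.coe_mk, con6_apply, con5_apply, con4_sym4,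
    smul_mul_assoc, add_mul, ← Finset.smul_sum, Finset.sum_add_distrib]

theorem con6_ddUnd (x y a b c d : Fin 2 → AmbFn) [XConst y] [XConst a] [XConst b] [XConst c]
    [XConst d] (B : T2) :
    con6 x y a b c d (ddUnd B) = (1 / 24 : ℂ) • (
      spinDir a x (spinDir b y (con2 c d B)) + spinDir a x (spinDir b y (con2 d c B)) +
      spinDir a x (spinDir c y (con2 b d B)) + spinDir a x (spinDir c y (con2 d b B)) +
      spinDir a x (spinDir d y (con2 b c B)) + spinDir a x (spinDir d y (con2 c b B)) +
      spinDir b x (spinDir a y (con2 c d B)) + spinDir b x (spinDir a y (con2 d c B)) +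
      spinDir b x (spinDir c y (con2 a d B)) + spinDir b x (spinDir c y (con2 d a B)) +
      spinDir b x (spinDir d y (con2 a c B)) + spinDir b x (spinDir d y (con2 c a B)) +
      spinDir c x (spinDir a y (con2 b d B)) + spinDir c x (spinDir a y (con2 d b B)) +
      spinDir c x (spinDir b y (con2 a d B)) + spinDir c x (spinDir b y (con2 d a B)) +
      spinDir c x (spinDir d y (con2 a b B)) + spinDir c x (spinDir d y (con2 b a B)) +
      spinDir d x (spinDir a y (con2 b c B)) + spinDir d x (spinDir a y (con2 c b B)) +
      spinDir d x (spinDir b y (con2 a c B)) + spinDir d x (spinDir b y (con2 c a B)) +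
      spinDir d x (spinDir c y (con2 a b B)) + spinDir d x (spinDir c y (con2 b a B))) := by
  simp only [← con6_pd_pd']
  simp only [ddUnd, LinearMap.coe_mk, AddHom.coe_mk, con6_apply, con5_apply, con4_sym4,
    smul_mul_assoc, add_mul, ← Finset.smul_sum, Finset.sum_add_distrib]

theorem con4_dSymSym (a b x y : Fin 2 → AmbFn) [XConst a] [XConst b] [XConst x] [XConst y]
    (M : T2) :
    con4 a b x y (dSymSym M) = (1 / 4 : ℂ) • (spinDir a x (con2 b y M) + spinDir a y (con2 b x M) +
      spinDir b x (con2 a y M) + spinDir b y (con2 a x M)) := by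
  simp only [← con4_pd]
  simp only [dSymSym, gradDot, sym2, con4_apply, con3_apply, con2_apply, con1_apply,
    Fin.sum_univ_two, LinearMap.coe_mk, AddHom.coe_mk, map_smul, map_add, smul_mul_assoc,
    add_mul, ← smul_add, smul_smul]
  norm_num1
  congr 1
  ring

/-! ### Traces in a frame -/

theorem sum_epsUp_smul {M : Type*} [AddCommGroup M] [Module ℂ M] (P : Fin 2 → Fin 2 → M) :
    ∑ x, ∑ y, epsUp x y • P x y = P 1 0 - P 0 1 := by
  simp [epsUp, Fin.sum_univ_two]
  abel

theorem diracDot_apply (f : T1) (a : Fin 2) : diracDot f a = pd a 1 (f 0) - pd a 0 (f 1) :=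
  sum_epsUp_smul fun x y => pd a x (f y)

theorem diracUnd_apply (f : T1) (x : Fin 2) : diracUnd f x = pd 1 x (f 0) - pd 0 x (f 1) :=
  sum_epsUp_smul fun a b => pd a x (f b)

theorem divDot_apply (B : T2) (a x : Fin 2) :
    divDot B a x = pd a 1 (B 0 x) - pd a 0 (B 1 x) :=
  sum_epsUp_smul fun y z => pd a y (B z x)

theorem divUnd_apply (B : T2) (a x : Fin 2) :
    divUnd B a x = pd 1 x (B 0 a) - pd 0 x (B 1 a) :=
  sum_epsUp_smul fun b c => pd b x (B c a)

theorem curvDot_apply (A : T2) (x y : Fin 2) :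
    curvDot A x y = (1 / 2 : ℂ) • (pd 1 x (A 0 y) - pd 0 x (A 1 y) + pd 1 y (A 0 x) -
      pd 0 y (A 1 x)) := by
  have h := congrFun (congrFun (sum_epsUp_smul fun a b => sym2 fun x y => pd a x (A b y)) x) y
  refine h.trans ?_
  simp only [sym2, LinearMap.coe_mk, AddHom.coe_mk, Pi.sub_apply]
  module

theorem curvUnd_apply (A : T2) (a b : Fin 2) :
    curvUnd A a b = (1 / 2 : ℂ) • (pd a 1 (A b 0) - pd a 0 (A b 1) + pd b 1 (A a 0) -
      pd b 0 (A a 1)) := by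
  have h := congrFun (congrFun (sum_epsUp_smul fun x y => sym2 fun a b => pd a x (A b y)) a) b
  refine h.trans ?_
  simp only [sym2, LinearMap.coe_mk, AddHom.coe_mk, Pi.sub_apply]
  module

/-- Insertion of ε^{α̇β̇} = λ^α̇ λ'^β̇ − λ'^α̇ λ^β̇ into the contracted dotted indices. The
remaining trace formulas are obtained in the same way from `lu_lh` or `mv_mh`. -/
theorem con1_diracDot (w : Fin 2 → AmbFn) (f : T1) :
    con1 w (diracDot f) = spinDir w lu (con1 lh f) - spinDir w lh (con1 lu f) := by
  rw [← mul_one (con1 w _), ← lu_lh, ← con3_pd, ← con3_pd]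
  simp only [diracDot_apply, con1_apply, con2_apply, con3_apply,
    Fin.sum_univ_two, map_sub]
  ring

theorem con1_diracUnd (v : Fin 2 → AmbFn) (f : T1) :
    con1 v (diracUnd f) = spinDir mv v (con1 mh f) - spinDir mh v (con1 mv f) := by
  rw [← mul_one (con1 v _), ← mv_mh, ← con3_pd, ← con3_pd]
  simp only [diracUnd_apply, con1_apply, con2_apply, con3_apply,
    Fin.sum_univ_two, map_sub]
  ring

theorem con2_divDot (w v : Fin 2 → AmbFn) [XConst v] (B : T2) :
    con2 w v (divDot B) = spinDir w lu (con2 lh v B) - spinDir w lh (con2 lu v B) := by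
  rw [← mul_one (con2 w v _), ← lu_lh, ← con4_pd, ← con4_pd]
  simp only [divDot_apply, con1_apply, con2_apply, con3_apply,
    con4_apply, Fin.sum_univ_two, map_sub]
  ring

theorem con2_divUnd (w v : Fin 2 → AmbFn) [XConst w] (B : T2) :
    con2 w v (divUnd B) = spinDir mv v (con2 mh w B) - spinDir mh v (con2 mv w B) := by
  rw [← mul_one (con2 w v _), ← mv_mh, ← con4_pd, ← con4_pd]
  simp only [divUnd_apply, con1_apply, con2_apply, con3_apply,
    con4_apply, Fin.sum_univ_two, map_sub]
  ring

theorem con2_curvDot (x y : Fin 2 → AmbFn) [XConst x] [XConst y] (A : T2) :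
    con2 x y (curvDot A) = (1 / 2 : ℂ) • (spinDir mv x (con2 mh y A) - spinDir mh x (con2 mv y A) +
      spinDir mv y (con2 mh x A) - spinDir mh y (con2 mv x A)) := by
  rw [← mul_one (con2 x y _), ← mv_mh]
  simp only [← con4_pd]
  simp only [curvDot_apply, con1_apply, con2_apply, con3_apply, con4_apply, Fin.sum_univ_two,
    map_sub, map_add, map_smul, ← smul_add, smul_mul_assoc]
  congr 1
  ring

theorem con2_curvUnd (a b : Fin 2 → AmbFn) [XConst a] [XConst b] (A : T2) :
    con2 a b (curvUnd A) = (1 / 2 : ℂ) • (spinDir a lu (con2 b lh A) - spinDir a lh (con2 b lu A) +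
      spinDir b lu (con2 a lh A) - spinDir b lh (con2 a lu A)) := by
  rw [← mul_one (con2 a b _), ← lu_lh]
  simp only [← con4_pd]
  simp only [curvUnd_apply, con1_apply, con2_apply, con3_apply, con4_apply, Fin.sum_univ_two,
    map_sub, map_add, map_smul, ← smul_add, smul_mul_assoc]
  congr 1
  ring

/-- The sign comes from the lower epsilon: ε_{α̇β̇} λ^α̇ λ'^β̇ is minus the determinant in `lu_lh`.
-/
theorem con4_dTraceDot (a b : Fin 2 → AmbFn) (M : T2) :
    con4 a b lu lh (dTraceDot M) = -con2 a b (curvUnd M) := by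
  rw [← mul_one (con2 a b _), ← lu_lh]
  simp only [dTraceDot, LinearMap.coe_mk, AddHom.coe_mk, con1_apply, con2_apply, con3_apply,
    con4_apply, Fin.sum_univ_two, epsLow, Matrix.of_apply, Matrix.cons_val_zero,
    Matrix.cons_val_one, zero_smul, one_smul, neg_smul, map_neg, map_zero]
  ring

theorem con4_dTraceUnd (x y : Fin 2 → AmbFn) (M : T2) :
    con4 mv mh x y (dTraceUnd M) = -con2 x y (curvDot M) := by
  rw [← mul_one (con2 x y _), ← mv_mh]
  simp only [dTraceUnd, LinearMap.coe_mk, AddHom.coe_mk, con1_apply, con2_apply, con3_apply,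
    con4_apply, Fin.sum_univ_two, epsLow, Matrix.of_apply, Matrix.cons_val_zero,
    Matrix.cons_val_one, zero_smul, one_smul, neg_smul, map_neg, map_zero]
  ring

theorem divA_apply (A : T2) :
    divA A = pd 1 1 (A 0 0) - pd 1 0 (A 0 1) - pd 0 1 (A 1 0) + pd 0 0 (A 1 1) := by
  simp [divA, epsUp, Fin.sum_univ_two]
  abel

theorem pull_divA (A : T2) :
    pull (divA A) = spinDir mv lu (con2 mh lh A) - spinDir mv lh (con2 mh lu A) -
      spinDir mh lu (con2 mv lh A) + spinDir mh lh (con2 mv lu A) := by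
  -- Two separate factors 1 are inserted: one is expanded in the dotted frame, the other in the
  -- undotted frame.
  rw [← mul_one (pull _), ← mul_one (pull _ * 1)]
  nth_rw 1 [← lu_lh]
  rw [← mv_mh]
  simp only [← con4_pd]
  simp only [divA_apply, con1_apply, con2_apply, con3_apply,
    con4_apply, Fin.sum_univ_two, map_sub, map_add]
  ring

theorem box_eq (f : SpaceFn) : box f = (2 : ℂ) • divA (grad f) := by
  simp [box, divA, grad]

/-- The four terms of the divergence of a gradient agree in pairs once the derivatives are commuted;
this doubles the factor 2 in the definition of the Laplacian. -/
theorem pull_box (f : SpaceFn) :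
    pull (box f) = (4 : ℂ) • (spinDir mv lu (spinDir mh lh (pull f)) -
      spinDir mv lh (spinDir mh lu (pull f))) := by
  rw [box_eq, map_smul, pull_divA]
  simp only [con2_grad]
  rw [spinDir_comm mh lu mv lh, spinDir_comm mh lh mv lu]
  module

/-! ### The Grassmann algebra -/

theorem eta_anticomm_ι (i : Fin 3) (v : (Fin 3 → ℂ) × (Fin 3 → ℂ)) :
    eta i * ExteriorAlgebra.ι ℂ v = -(ExteriorAlgebra.ι ℂ v * eta i) :=
  eq_neg_of_add_eq_zero_left (ExteriorAlgebra.ι_add_mul_swap _ _)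

theorem theta_anticomm_ι (i : Fin 3) (v : (Fin 3 → ℂ) × (Fin 3 → ℂ)) :
    theta i * ExteriorAlgebra.ι ℂ v = -(ExteriorAlgebra.ι ℂ v * theta i) :=
  eq_neg_of_add_eq_zero_left (ExteriorAlgebra.ι_add_mul_swap _ _)

theorem eta_mul_self (i : Fin 3) : eta i * eta i = 0 := ExteriorAlgebra.ι_sq_zero _
theorem theta_mul_self (i : Fin 3) : theta i * theta i = 0 := ExteriorAlgebra.ι_sq_zero _

theorem eta_mul_eta (i j : Fin 3) : eta i * eta j = -(eta j * eta i) := eta_anticomm_ι i _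
theorem eta_mul_theta (i j : Fin 3) : eta i * theta j = -(theta j * eta i) := eta_anticomm_ι i _
theorem theta_mul_theta (i j : Fin 3) : theta i * theta j = -(theta j * theta i) :=
  theta_anticomm_ι i _

/-- `θ^i η_i` without summation. -/
noncomputable def thEtaTerm (i : Fin 3) : Gr := theta i * eta i

theorem thEta_eq : thEta = thEtaTerm 0 + thEtaTerm 1 + thEtaTerm 2 := Fin.sum_univ_three _

/-- A product of two generators is central: moving a generator past it produces two signs. -/
theorem thEtaTerm_comm (i : Fin 3) (x : Gr) : thEtaTerm i * x = x * thEtaTerm i := by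
  induction x using ExteriorAlgebra.induction with
  | algebraMap r => exact (Algebra.commutes r _).symm
  | ι v =>
    rw [thEtaTerm, mul_assoc, eta_anticomm_ι, mul_neg, ← mul_assoc, theta_anticomm_ι, neg_mul,
      neg_neg, mul_assoc]
  | mul a b ha hb => rw [← mul_assoc, ha, mul_assoc, hb, mul_assoc]
  | add a b ha hb => rw [mul_add, add_mul, ha, hb]

theorem thEta_comm (x : Gr) : thEta * x = x * thEta := by
  simp only [thEta_eq, add_mul, mul_add, thEtaTerm_comm]

theorem eta_mul_thEtaTerm (i : Fin 3) : eta i * thEtaTerm i = 0 := by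
  rw [← thEtaTerm_comm, thEtaTerm, mul_assoc, eta_mul_self, mul_zero]

theorem theta_mul_thEtaTerm (i : Fin 3) : theta i * thEtaTerm i = 0 := by
  rw [thEtaTerm, ← mul_assoc, theta_mul_self, zero_mul]

theorem thEtaTerm_mul_self (i : Fin 3) : thEtaTerm i * thEtaTerm i = 0 := by
  nth_rw 1 [thEtaTerm]
  rw [mul_assoc, eta_mul_thEtaTerm, mul_zero]

/-- The three summands of u commute and square to zero, so uⁿ is n! times their n-th elementary
symmetric polynomial. -/
theorem thEta_sq : thEta ^ 2 = (2 : ℂ) • (thEtaTerm 0 * thEtaTerm 1 + thEtaTerm 0 * thEtaTerm 2 +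
    thEtaTerm 1 * thEtaTerm 2) := by
  rw [sq, thEta_eq]
  simp only [mul_add, add_mul, thEtaTerm_mul_self]
  rw [thEtaTerm_comm 1 (thEtaTerm 0), thEtaTerm_comm 2 (thEtaTerm 0),
    thEtaTerm_comm 2 (thEtaTerm 1)]
  module

theorem thEta_cube : thEta ^ 3 = (6 : ℂ) • (thEtaTerm 0 * (thEtaTerm 1 * thEtaTerm 2)) := by
  have h (i j : Fin 3) : thEtaTerm i * thEtaTerm j * thEtaTerm i = 0 := by
    rw [mul_assoc, thEtaTerm_comm j, ← mul_assoc, thEtaTerm_mul_self, zero_mul]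
  have h' (i j : Fin 3) : thEtaTerm i * thEtaTerm j * thEtaTerm j = 0 := by
    rw [mul_assoc, thEtaTerm_mul_self, mul_zero]
  rw [pow_succ, thEta_sq, thEta_eq, smul_mul_assoc]
  simp only [mul_add, add_mul, h, h']
  rw [thEtaTerm_comm 1 (thEtaTerm 2), ← mul_assoc, mul_assoc (thEtaTerm 0) (thEtaTerm 2),
    thEtaTerm_comm 2 (thEtaTerm 1), ← thEtaTerm_comm 0 (thEtaTerm 1 * thEtaTerm 2), ← mul_assoc]
  module

/-- u³ is a multiple of each single summand of u, so one annihilated summand suffices. -/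
theorem mul_thEta_cube {w : Gr} {i : Fin 3} (h : w * thEtaTerm i = 0) : w * thEta ^ 3 = 0 := by
  obtain ⟨x, hx⟩ : ∃ x, thEta ^ 3 = thEtaTerm i * x := by
    rw [thEta_cube]
    fin_cases i
    · exact ⟨(6 : ℂ) • (thEtaTerm 1 * thEtaTerm 2), (mul_smul_comm _ _ _).symm⟩
    · refine ⟨(6 : ℂ) • (thEtaTerm 0 * thEtaTerm 2), ?_⟩
      rw [mul_smul_comm, ← mul_assoc, thEtaTerm_comm 0, mul_assoc]; rfl
    · refine ⟨(6 : ℂ) • (thEtaTerm 0 * thEtaTerm 1), ?_⟩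
      rw [mul_smul_comm, thEtaTerm_comm _ (thEtaTerm 0 * thEtaTerm 1), mul_assoc]; rfl
  rw [hx, ← mul_assoc, h, zero_mul]

theorem mul_thEta_sq {w : Gr} (h₀ : w * (thEtaTerm 0 * thEtaTerm 1) = 0)
    (h₁ : w * (thEtaTerm 0 * thEtaTerm 2) = 0) (h₂ : w * (thEtaTerm 1 * thEtaTerm 2) = 0) :
    w * thEta ^ 2 = 0 := by
  rw [thEta_sq, mul_smul_comm, mul_add, mul_add, h₀, h₁, h₂, add_zero, add_zero, smul_zero]

theorem thEta_pow_four : thEta ^ 4 = 0 := by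
  have h (i : Fin 3) : thEtaTerm i * thEta ^ 3 = 0 := mul_thEta_cube (thEtaTerm_mul_self i)
  rw [pow_succ', thEta_eq, add_mul, add_mul, ← thEta_eq, h, h, h, add_zero, add_zero]

theorem eta_mul_thEta_cube (i : Fin 3) : eta i * thEta ^ 3 = 0 :=
  mul_thEta_cube (eta_mul_thEtaTerm i)

theorem theta_mul_thEta_cube (i : Fin 3) : theta i * thEta ^ 3 = 0 :=
  mul_thEta_cube (theta_mul_thEtaTerm i)

theorem eta2_mul_thEtaTerm (k : Fin 3) :
    eta2 k * thEtaTerm (k + 1) = 0 ∧ eta2 k * thEtaTerm (k + 2) = 0 := by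
  constructor
  · rw [eta2, eta_mul_eta, neg_mul, mul_assoc, eta_mul_thEtaTerm, mul_zero, neg_zero]
  · rw [eta2, mul_assoc, eta_mul_thEtaTerm, mul_zero]

theorem theta2_mul_thEtaTerm (k : Fin 3) :
    theta2 k * thEtaTerm (k + 1) = 0 ∧ theta2 k * thEtaTerm (k + 2) = 0 := by
  constructor
  · rw [theta2, theta_mul_theta, neg_mul, mul_assoc, theta_mul_thEtaTerm, mul_zero, neg_zero]
  · rw [theta2, mul_assoc, theta_mul_thEtaTerm, mul_zero]

/-- Each of the three products in u² involves two distinct indices, at least one of which is `k + 1`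
or `k + 2`. -/
theorem mul_thEta_sq_of {w : Gr} (k : Fin 3) (h₁ : w * thEtaTerm (k + 1) = 0)
    (h₂ : w * thEtaTerm (k + 2) = 0) : w * thEta ^ 2 = 0 := by
  have h (i j : Fin 3) (hi : w * thEtaTerm i = 0 ∨ w * thEtaTerm j = 0) :
      w * (thEtaTerm i * thEtaTerm j) = 0 := by
    rcases hi with hi | hj
    · rw [← mul_assoc, hi, zero_mul]
    · rw [thEtaTerm_comm, ← mul_assoc, hj, zero_mul]
  fin_cases k
  · exact mul_thEta_sq (h _ _ (.inr h₁)) (h _ _ (.inr h₂)) (h _ _ (.inl h₁))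
  · exact mul_thEta_sq (h _ _ (.inl h₂)) (h _ _ (.inl h₂)) (h _ _ (.inr h₁))
  · exact mul_thEta_sq (h _ _ (.inl h₁)) (h _ _ (.inl h₁)) (h _ _ (.inl h₂))

theorem eta2_mul_thEta_sq (k : Fin 3) : eta2 k * thEta ^ 2 = 0 :=
  mul_thEta_sq_of k (eta2_mul_thEtaTerm k).1 (eta2_mul_thEtaTerm k).2

theorem theta2_mul_thEta_sq (k : Fin 3) : theta2 k * thEta ^ 2 = 0 :=
  mul_thEta_sq_of k (theta2_mul_thEtaTerm k).1 (theta2_mul_thEtaTerm k).2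

theorem eta3_mul_thEta : eta3 * thEta = 0 := by
  have h2 : eta3 * thEtaTerm 2 = 0 := by rw [eta3, mul_assoc, eta_mul_thEtaTerm, mul_zero]
  have h1 : eta3 * thEtaTerm 1 = 0 := by
    rw [eta3, mul_assoc, mul_assoc, ← thEtaTerm_comm, ← mul_assoc (eta 1), eta_mul_thEtaTerm,
      zero_mul, mul_zero]
  have h0 : eta3 * thEtaTerm 0 = 0 := by
    rw [eta3, mul_assoc, mul_assoc, ← mul_assoc (eta 1), ← thEtaTerm_comm, ← mul_assoc,
      eta_mul_thEtaTerm, zero_mul]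
  rw [thEta_eq, mul_add, mul_add, h0, h1, h2, add_zero, add_zero]

theorem theta3_mul_thEta : theta3 * thEta = 0 := by
  have h2 : theta3 * thEtaTerm 2 = 0 := by rw [theta3, mul_assoc, theta_mul_thEtaTerm, mul_zero]
  have h1 : theta3 * thEtaTerm 1 = 0 := by
    rw [theta3, mul_assoc, mul_assoc, ← thEtaTerm_comm, ← mul_assoc (theta 1),
      theta_mul_thEtaTerm, zero_mul, mul_zero]
  have h0 : theta3 * thEtaTerm 0 = 0 := by
    rw [theta3, mul_assoc, mul_assoc, ← mul_assoc (theta 1), ← thEtaTerm_comm, ← mul_assoc,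
      theta_mul_thEtaTerm, zero_mul]
  rw [thEta_eq, mul_add, mul_add, h0, h1, h2, add_zero, add_zero]

/-- The top monomial does not vanish. -/
theorem thEta_cube_ne_zero : thEta ^ 3 ≠ 0 := by
  rw [thEta_cube]
  refine smul_ne_zero (by norm_num) fun h => ?_
  -- Contracting with the dual covectors in the order in which the generators stand in the word
  -- removes them one at a time from the left, and only a nonzero scalar remains.
  let dη (i : Fin 3) : Module.Dual ℂ ((Fin 3 → ℂ) × (Fin 3 → ℂ)) :=
    LinearMap.proj i ∘ₗ LinearMap.fst ℂ _ _
  let dθ (i : Fin 3) : Module.Dual ℂ ((Fin 3 → ℂ) × (Fin 3 → ℂ)) :=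
    LinearMap.proj i ∘ₗ LinearMap.snd ℂ _ _
  have h' := congrArg (fun x => CliffordAlgebra.contractLeft (dη 2) (CliffordAlgebra.contractLeft
    (dθ 2) (CliffordAlgebra.contractLeft (dη 1) (CliffordAlgebra.contractLeft (dθ 1)
    (CliffordAlgebra.contractLeft (dη 0) (CliffordAlgebra.contractLeft (dθ 0) x)))))) h
  simp [thEtaTerm, theta, eta, mul_assoc, ExteriorAlgebra.ι, CliffordAlgebra.contractLeft_ι_mul,
    dη, dθ] at h'

/-! ### Operators on superfunctions -/

theorem hatVF_ser (w : Gr) (f₀ f₁ f₂ f₃ : AmbFn) :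
    hatVF (ser w f₀ f₁ f₂ f₃) = ser w (hatEF f₀) (hatEF f₁) (hatEF f₂) (hatEF f₃) := by
  simp [hatVF, ser]

theorem thEta_mul_mul_pow (w : Gr) (n : ℕ) : thEta * (w * thEta ^ n) = w * thEta ^ (n + 1) := by
  rw [thEta_comm, mul_assoc, ← pow_succ]

/-- Since u is central, multiplication by it shifts the coefficients by one place; the last one is
lost because u⁴ = 0. -/
theorem mulLeft_thEta_ser (D : AmbFn →ₗ[ℂ] AmbFn) (w : Gr) (f₀ f₁ f₂ f₃ : AmbFn) :
    TensorProduct.map (LinearMap.mulLeft ℂ thEta) D (ser w f₀ f₁ f₂ f₃) =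
      ser w 0 (D f₀) (D f₁) (D f₂) := by
  have h1 := thEta_mul_mul_pow w 1
  rw [pow_one] at h1
  simp [ser, thEta_mul_mul_pow, thEta_pow_four, h1, thEta_comm w]

theorem mulThEta_ser (w : Gr) (f₀ f₁ f₂ f₃ : AmbFn) :
    mulThEta (ser w f₀ f₁ f₂ f₃) = ser w 0 f₀ f₁ f₂ := mulLeft_thEta_ser _ _ _ _ _ _

theorem hatVL_ser (w : Gr) (f₀ f₁ f₂ f₃ : AmbFn) :
    hatVL (ser w f₀ f₁ f₂ f₃) = ser w (hatEL f₀) (hatEL f₁ - spinDir mh lu f₀)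
      (hatEL f₂ - spinDir mh lu f₁) (hatEL f₃ - spinDir mh lu f₂) := by
  have h : hatVL (ser w f₀ f₁ f₂ f₃) = ser w (hatEL f₀) (hatEL f₁) (hatEL f₂) (hatEL f₃) +
      ser w 0 (EWhat f₀) (EWhat f₁) (EWhat f₂) := by
    rw [← mulLeft_thEta_ser _ _ _ _ _ f₃]
    simp [hatVL, ser]
  rw [h, ← ser_add, add_zero]
  simp only [EWhat_eq, LinearMap.neg_apply, sub_eq_add_neg]

theorem hatVR_ser (w : Gr) (f₀ f₁ f₂ f₃ : AmbFn) :
    hatVR (ser w f₀ f₁ f₂ f₃) = ser w (hatER f₀) (hatER f₁ + spinDir mv lh f₀)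
      (hatER f₂ + spinDir mv lh f₁) (hatER f₃ + spinDir mv lh f₂) := by
  have h : hatVR (ser w f₀ f₁ f₂ f₃) = ser w (hatER f₀) (hatER f₁) (hatER f₂) (hatER f₃) +
      ser w 0 (EW f₀) (EW f₁) (EW f₂) := by
    rw [← mulLeft_thEta_ser _ _ _ _ _ f₃]
    simp [hatVR, ser]
  rw [h, ← ser_add, add_zero]
  simp only [EW_eq]

theorem ser_sub (w : Gr) (f₀ f₁ f₂ f₃ g₀ g₁ g₂ g₃ : AmbFn) :
    ser w (f₀ - g₀) (f₁ - g₁) (f₂ - g₂) (f₃ - g₃) = ser w f₀ f₁ f₂ f₃ - ser w g₀ g₁ g₂ g₃ := by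
  simp only [ser, TensorProduct.tmul_sub]
  module

theorem ser_zero (w : Gr) : ser w 0 0 0 0 = 0 := by
  simp [ser]

/-- For prefactors η_i and θ^i the coefficients of u³ on the two sides need not agree, so they must
be discarded before comparison. The next two lemmas play this role for η^(k), θ_(k) and for the
cubic monomials. -/
theorem ser_congr_of_mul_thEta_cube {w : Gr} (hw : w * thEta ^ 3 = 0) {f₀ f₁ f₂ f₃ g₀ g₁ g₂ g₃ : AmbFn}
    (h₀ : f₀ = g₀) (h₁ : f₁ = g₁) (h₂ : f₂ = g₂) : ser w f₀ f₁ f₂ f₃ = ser w g₀ g₁ g₂ g₃ := by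
  simp [ser, hw, h₀, h₁, h₂]

theorem ser_congr_of_mul_thEta_sq {w : Gr} (hw : w * thEta ^ 2 = 0) {f₀ f₁ f₂ f₃ g₀ g₁ g₂ g₃ : AmbFn}
    (h₀ : f₀ = g₀) (h₁ : f₁ = g₁) : ser w f₀ f₁ f₂ f₃ = ser w g₀ g₁ g₂ g₃ := by
  have h : w * thEta ^ 3 = 0 := by rw [pow_succ, ← mul_assoc, hw, zero_mul]
  simp [ser, hw, h, h₀, h₁]

theorem ser_congr_of_mul_thEta {w : Gr} (hw : w * thEta = 0) {f₀ f₁ f₂ f₃ g₀ g₁ g₂ g₃ : AmbFn}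
    (h₀ : f₀ = g₀) : ser w f₀ f₁ f₂ f₃ = ser w g₀ g₁ g₂ g₃ := by
  have h : w * thEta ^ 2 = 0 := by rw [sq, ← mul_assoc, hw, zero_mul]
  have h' : w * thEta ^ 3 = 0 := by rw [pow_succ, ← mul_assoc, h, zero_mul]
  simp [ser, hw, h, h', h₀]

/-- Pure tensors are the series with zeroth coefficient only, so operator identities can be checked
there with the recursions on coefficients. -/
theorem superFn_induction {p : SuperFn → Prop} (tmul : ∀ w f, p (ser w f 0 0 0))
    (add : ∀ x y, p x → p y → p (x + y)) (x : SuperFn) : p x := by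
  induction x using TensorProduct.induction_on with
  | zero => simpa [ser] using tmul 0 0
  | tmul w f => simpa [ser] using tmul w f
  | add x y hx hy => exact add x y hx hy

theorem linearMap_ext_ser {D D' : SuperFn →ₗ[ℂ] SuperFn}
    (h : ∀ w f, D (ser w f 0 0 0) = D' (ser w f 0 0 0)) : D = D' := by
  refine LinearMap.ext fun x => ?_
  induction x using superFn_induction with
  | tmul w f => exact h w f
  | add x y hx hy => rw [map_add, map_add, hx, hy]

/-- `[V̂_F, V̂_L] = 0`. -/
theorem hatVF_hatVL (f : SuperFn) : hatVF (hatVL f) = hatVL (hatVF f) := by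
  refine LinearMap.congr_fun (linearMap_ext_ser (D := hatVF ∘ₗ hatVL) (D' := hatVL ∘ₗ hatVF)
    fun w f => ?_) f
  simp only [LinearMap.comp_apply, hatVF_ser, hatVL_ser, hatEF_eq, hatEL_spinDir, map_sub,
    map_zero, spinDir_comm mv lu mh lu, spinDir_zero_left, spinDir_zero_right,
    LinearMap.zero_apply, add_zero]

/-- `[V̂_F, V̂_R] = 0`. -/
theorem hatVF_hatVR (f : SuperFn) : hatVF (hatVR f) = hatVR (hatVF f) := by
  refine LinearMap.congr_fun (linearMap_ext_ser (D := hatVF ∘ₗ hatVR) (D' := hatVR ∘ₗ hatVF)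
    fun w f => ?_) f
  simp only [LinearMap.comp_apply, hatVF_ser, hatVR_ser, hatEF_eq, hatER_spinDir, map_add,
    map_zero, spinDir_comm mv lu mv lh, spinDir_zero_left, spinDir_zero_right,
    LinearMap.zero_apply, add_zero]

/-- `[V̂_L, V̂_R] = 2 θ^i η_i V̂_F`. -/
theorem hatVL_hatVR (f : SuperFn) :
    hatVL (hatVR f) = hatVR (hatVL f) + (2 : ℂ) • mulThEta (hatVF f) := by
  refine LinearMap.congr_fun (linearMap_ext_ser (D := hatVL ∘ₗ hatVR)
    (D' := hatVR ∘ₗ hatVL + (2 : ℂ) • (mulThEta ∘ₗ hatVF)) fun w f => ?_) f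
  simp only [LinearMap.comp_apply, LinearMap.add_apply, LinearMap.smul_apply, hatVF_ser,
    hatVL_ser, hatVR_ser, mulThEta_ser, ← ser_smul, ← ser_add, hatEF_eq, hatEL_spinDir,
    hatER_spinDir, map_add, map_sub, map_zero, spinDir_comm mv lh mh lu, spinDir_zero_left,
    spinDir_zero_right, LinearMap.zero_apply, hatEL_hatER_comm]
  congr 1 <;> module

/-! ### The complexes -/

/-- The components are the three commutators. The one of V̂_L and V̂_R is compensated by the term
that comes from the differential of v̂^F. -/
theorem dbar1_dbar0 : dbar1 ∘ₗ dbar0 = 0 := by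
  refine LinearMap.ext fun f => Prod.ext (Subtype.ext ?_) (Prod.ext (Subtype.ext ?_)
    (Subtype.ext ?_))
  · change hatVL (hatVR f) - hatVR (hatVL f) - (2 : ℂ) • mulThEta (hatVF f) = 0
    rw [hatVL_hatVR]
    module
  · change hatVF (hatVL f) - hatVL (hatVF f) = 0
    rw [hatVF_hatVL, sub_self]
  · change hatVF (hatVR f) - hatVR (hatVF f) = 0
    rw [hatVF_hatVR, sub_self]

theorem hatVF_mulThEta (f : SuperFn) : hatVF (mulThEta f) = mulThEta (hatVF f) := by
  refine LinearMap.congr_fun (linearMap_ext_ser (D := hatVF ∘ₗ mulThEta)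
    (D' := mulThEta ∘ₗ hatVF) fun w f => ?_) f
  simp only [LinearMap.comp_apply, hatVF_ser, mulThEta_ser, map_zero]

/-- Apart from the commutators, one uses that u commutes with V̂_F; the term 2u V̂_F applied to the
v̂^F-component then cancels against the commutator of V̂_L and V̂_R. -/
theorem dbar2_dbar1 : dbar2 ∘ₗ dbar1 = 0 := by
  refine LinearMap.ext fun A => Subtype.ext ?_
  change hatVF (hatVL A.2.2 - hatVR A.2.1 - (2 : ℂ) • mulThEta A.1) -
    hatVL (hatVF A.2.2 - hatVR A.1) + hatVR (hatVF A.2.1 - hatVL A.1) = 0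
  simp only [map_sub, map_smul, hatVF_hatVL, hatVF_hatVR, hatVL_hatVR, hatVF_mulThEta]
  module

theorem pull_injective : Function.Injective pull := fun f g h => by
  refine Subtype.ext (funext fun x => ?_)
  exact congrArg (fun F : AmbFn => F.1 ⟨(x, 1, 1), ⟨one_ne_zero, one_ne_zero⟩⟩) h

/-- Inherited from the total space: `pull` is injective and intertwines `pd` with `pdx`. -/
theorem pd_comm (a b c d : Fin 2) (f : SpaceFn) : pd a b (pd c d f) = pd c d (pd a b f) :=
  pull_injective <| by
    simp only [← pdx_pull]
    exact (isConstCoeff_pdx a b).pdx c d (pull f)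

/-- Symmetrising the dotted indices makes the second derivatives symmetric in the undotted ones as
well, because derivatives commute; the trace with ε therefore vanishes. -/
theorem curvDot_grad (f : SpaceFn) : curvDot (grad f) = 0 := by
  funext x y
  simp only [curvDot_apply, grad, LinearMap.coe_mk, AddHom.coe_mk, Pi.zero_apply, pd_comm 1 _ 0]
  module

theorem curvUnd_grad (f : SpaceFn) : curvUnd (grad f) = 0 := by
  funext x y
  simp only [curvUnd_apply, grad, LinearMap.coe_mk, AddHom.coe_mk, Pi.zero_apply, pd_comm _ 1 _ 0]
  module

theorem dYM1_dYM0 : dYM1 ∘ₗ dYM0 = 0 := by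
  refine LinearMap.ext fun f => Prod.ext ?_ (Prod.ext (Subtype.ext ?_) (Subtype.ext ?_))
  · change divDot (0 : T2) + divUnd (0 : T2) = 0
    simp
  · change curvDot (grad f) - 0 = 0
    rw [curvDot_grad, sub_zero]
  · change curvUnd (grad f) - 0 = 0
    rw [curvUnd_grad, sub_zero]

/-- Contracting the undotted indices of two commuting derivatives with ε leaves an expression
antisymmetric in the dotted indices, and this meets the symmetric `B`. -/
theorem divA_divDot {B : T2} (hB : B ∈ Sym) : divA (divDot B) = 0 := by
  simp only [divA_apply, divDot_apply, map_sub, hB 1 0, pd_comm 1 1 0 0, pd_comm 1 1 0 1,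
    pd_comm 1 0 0 1, pd_comm 1 0 0 0]
  module

theorem divA_divUnd {B : T2} (hB : B ∈ Sym) : divA (divUnd B) = 0 := by
  simp only [divA_apply, divUnd_apply, map_sub, hB 1 0, pd_comm 1 1 0 0, pd_comm 1 1 1 0,
    pd_comm 0 1 1 0, pd_comm 0 1 0 0]
  module

theorem dYM2_dYM1 : dYM2 ∘ₗ dYM1 = 0 := LinearMap.ext fun Φ => by
  change divA (divDot Φ.2.1 + divUnd Φ.2.2) = 0
  rw [map_add, divA_divDot Φ.2.1.2, divA_divUnd Φ.2.2.2, add_zero]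

theorem dSYM1_dSYM0 : dSYM1 ∘ₗ dSYM0 = 0 := LinearMap.ext fun f =>
  Prod.ext (LinearMap.congr_fun dYM1_dYM0 f) (map_zero dMatter)

theorem dSYM2_dSYM1 : dSYM2 ∘ₗ dSYM1 = 0 := LinearMap.ext fun Φ =>
  LinearMap.congr_fun dYM2_dYM1 Φ.1

/-! ### Compatibility with the differentials: Yang--Mills theory -/

/-- A function of x is annihilated by the ladder operators. What remains of the three vector fields
are the derivatives along μλ, −uμ'λ and uμλ', which are exactly the places where the gauge potential
enters `e1`. -/
theorem dbar0_e0 : dbar0 ∘ₗ e0 = e1 ∘ₗ dYM0 := by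
  refine LinearMap.ext fun f => Prod.ext (Subtype.ext ?_) (Prod.ext (Subtype.ext ?_)
    (Subtype.ext ?_))
  · change hatVF (ser 1 (pull f) 0 0 0) = ser 1 _ _ _ _
    rw [hatVF_ser]
    congr 1 <;> simp [dYM0, con2_grad, hatEF_eq]
  · change hatVL (ser 1 (pull f) 0 0 0) = ser 1 _ _ _ _
    rw [hatVL_ser]
    congr 1 <;> simp [dYM0, con2_grad, hatEL_pull]
  · change hatVR (ser 1 (pull f) 0 0 0) = ser 1 _ _ _ _
    rw [hatVR_ser]
    congr 1 <;> simp [dYM0, con2_grad, hatER_pull]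

/-- Reordering of the four derivatives along the frame. -/
theorem spinDir_order : ∀ f,
    spinDir mv lh (spinDir mv lu f) = spinDir mv lu (spinDir mv lh f) ∧
    spinDir mh lu (spinDir mv lu f) = spinDir mv lu (spinDir mh lu f) ∧
    spinDir mh lh (spinDir mv lu f) = spinDir mv lu (spinDir mh lh f) ∧
    spinDir mh lu (spinDir mv lh f) = spinDir mv lh (spinDir mh lu f) ∧
    spinDir mh lh (spinDir mv lh f) = spinDir mv lh (spinDir mh lh f) ∧
    spinDir mh lh (spinDir mh lu f) = spinDir mh lu (spinDir mh lh f) := fun f =>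
  ⟨spinDir_comm _ _ _ _ f, spinDir_comm _ _ _ _ f, spinDir_comm _ _ _ _ f,
    spinDir_comm _ _ _ _ f, spinDir_comm _ _ _ _ f, spinDir_comm _ _ _ _ f⟩

/-- At first order in u the three occurrences of A cancel as 1 + 1 − 2. At second order the
coefficient 3/2 of B(λ',λ') becomes −3 B(λ,λ') under the ladder operator, and the term −2u of the
differential adds 2 B(λ,λ'), which leaves the −B of the field equation; the undotted B behaves
likewise with opposite sign. -/
theorem dbar1_e1_LR (Φ : YM1) : hatVL (e1R Φ : SuperFn) - hatVR (e1L Φ : SuperFn) -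
    (2 : ℂ) • mulThEta (e1F Φ : SuperFn) = (e2LR (dYM1 Φ) : SuperFn) := by
  obtain ⟨A, ⟨B, hB⟩, ⟨C, hC⟩⟩ := Φ
  simp only [e1F, e1L, e1R, e2LR, dYM1, LinearMap.coe_mk, AddHom.coe_mk, hatVL_ser, hatVR_ser,
    mulThEta_ser, ← ser_smul, ← ser_sub]
  -- Symmetry fixes the order of the two spinors in contractions with `B` and `C`, so that equal
  -- words become syntactically equal before `module` compares scalars.
  have h₁ := con2_symm hB lh lu
  have h₂ := con2_symm hC mh mv
  congr 1 <;>
  simp only [AddSubgroupClass.coe_sub, con4_dDot, con4_dUnd, con2_curvDot, con2_curvUnd,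
    con2_divDot, con2_divUnd, map_add, map_sub, map_neg, map_smul, map_zero, hatEL_spinDir,
    hatER_spinDir, hatEL_con2, hatER_con2, con2_zero_left, con2_zero_right, spinDir_zero_left,
    spinDir_zero_right, LinearMap.zero_apply, h₁, h₂] <;>
  module

/-- At first order in u the derivatives of A antisymmetrise in μ, μ' to the curvature along λλ, and
the ladder operator turns B(λ,λ') into B(λ,λ). At higher orders the derivatives need a fixed order,
which `spinDir_order` provides. -/
theorem dbar1_e1_FL (Φ : YM1) : hatVF (e1L Φ : SuperFn) - hatVL (e1F Φ : SuperFn) =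
    (e2FL (dYM1 Φ) : SuperFn) := by
  obtain ⟨A, ⟨B, hB⟩, ⟨C, hC⟩⟩ := Φ
  simp only [e1F, e1L, e2FL, dYM1, LinearMap.coe_mk, AddHom.coe_mk, hatVF_ser, hatVL_ser, ← ser_sub]
  have h₁ := con2_symm hB lh lu
  have h₂ := con2_symm hC mh mv
  congr 1 <;>
  simp only [AddSubgroupClass.coe_sub, con6_ddDot, con6_ddUnd, con4_dDot, con4_dUnd, con2_curvDot,
    con2_curvUnd, con2_divDot, con2_divUnd, con4_dSymSym, con4_dTraceDot, Bvec, LinearMap.coe_mk,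
    AddHom.coe_mk, hatEF_eq, map_add, map_sub, map_neg, map_smul, map_zero, hatEL_spinDir,
    hatEL_con2, con2_zero_left, con2_zero_right, spinDir_zero_left, spinDir_zero_right,
    LinearMap.zero_apply, h₁, h₂, spinDir_order] <;>
  module

theorem dbar1_e1_FR (Φ : YM1) : hatVF (e1R Φ : SuperFn) - hatVR (e1F Φ : SuperFn) =
    (e2FR (dYM1 Φ) : SuperFn) := by
  obtain ⟨A, ⟨B, hB⟩, ⟨C, hC⟩⟩ := Φ
  simp only [e1F, e1R, e2FR, dYM1, LinearMap.coe_mk, AddHom.coe_mk, hatVF_ser, hatVR_ser, ← ser_sub]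
  have h₁ := con2_symm hB lh lu
  have h₂ := con2_symm hC mh mv
  congr 1 <;>
  simp only [AddSubgroupClass.coe_sub, con6_ddDot, con6_ddUnd, con4_dDot, con4_dUnd, con2_curvDot,
    con2_curvUnd, con2_divDot, con2_divUnd, con4_dSymSym, con4_dTraceUnd, Bvec, LinearMap.coe_mk,
    AddHom.coe_mk, hatEF_eq, map_add, map_sub, map_neg, map_smul, map_zero, hatER_spinDir,
    hatER_con2, con2_zero_left, con2_zero_right, spinDir_zero_left, spinDir_zero_right,
    LinearMap.zero_apply, h₁, h₂, spinDir_order] <;>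
  module

theorem dbar1_e1 : dbar1 ∘ₗ e1 = e2 ∘ₗ dYM1 :=
  LinearMap.ext fun Φ => Prod.ext (Subtype.ext (dbar1_e1_LR Φ))
    (Prod.ext (Subtype.ext (dbar1_e1_FL Φ)) (Subtype.ext (dbar1_e1_FR Φ)))

/-- All contributions of the anti-fields `B` and `C` cancel. The terms in A⁺ survive only at order
u³, where the coefficients 1, 5/6, 1/4 and 1/6 combine to 2/3 of each of the four terms in
`pull_divA`. -/
theorem dbar2_e2 : dbar2 ∘ₗ e2 = e3 ∘ₗ dYM2 := by
  refine LinearMap.ext fun Φ => Subtype.ext ?_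
  change hatVF (e2LR Φ : SuperFn) - hatVL (e2FR Φ : SuperFn) + hatVR (e2FL Φ : SuperFn) =
    (e3 (divA Φ.1) : SuperFn)
  obtain ⟨A, ⟨B, hB⟩, ⟨C, hC⟩⟩ := Φ
  simp only [e2LR, e2FL, e2FR, e3, LinearMap.coe_mk, AddHom.coe_mk, hatVF_ser, hatVL_ser, hatVR_ser,
    ← ser_sub, ← ser_add]
  have h₁ := con2_symm hB lh lu
  have h₂ := con2_symm hC mh mv
  congr 1 <;>
  simp only [con2_curvDot, con2_curvUnd, con2_divDot, con2_divUnd, con4_dSymSym, con4_dTraceDot,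
    con4_dTraceUnd, Bvec, LinearMap.coe_mk, AddHom.coe_mk, hatEF_eq, pull_divA, map_add, map_sub,
    map_neg, map_smul, map_zero, hatEL_spinDir, hatER_spinDir, hatEL_con2, hatER_con2,
    con2_zero_left, con2_zero_right, spinDir_zero_left, spinDir_zero_right, LinearMap.zero_apply,
    h₁, h₂, spinDir_order] <;>
  module

/-! ### Compatibility with the differentials: matter fields -/

theorem sumMatter_apply {N : Type*} [AddCommMonoid N] [Module ℂ N] (a b : Fin 3 → T1 →ₗ[ℂ] N)
    (c d : T1 →ₗ[ℂ] N) (p q : Fin 3 → SpaceFn →ₗ[ℂ] N) (Φ : Matter1) :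
    sumMatter a b c d p q Φ = ∑ i, a i (Φ.1 i) + (∑ i, b i (Φ.2.1 i) + (c Φ.2.2.1 +
      (d Φ.2.2.2.1 + (∑ k, p k (Φ.2.2.2.2.1 k) + ∑ k, q k (Φ.2.2.2.2.2 k))))) := by
  simp [sumMatter]

theorem form2_ext {A B : Form2} (h : (A.1 : SuperFn) = B.1) (h' : (A.2.1 : SuperFn) = B.2.1)
    (h'' : (A.2.2 : SuperFn) = B.2.2) : A = B :=
  Prod.ext (Subtype.ext h) (Prod.ext (Subtype.ext h') (Subtype.ext h''))

theorem serLin_apply {M : Type*} [AddCommGroup M] [Module ℂ M] {a b : ℕ} {k l : ℤ} {w : Gr}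
    (hw : GrWt a b w) (f₀ f₁ f₂ : M →ₗ[ℂ] AmbFn) (h₀ : ∀ m, f₀ m ∈ Homog (k - a) (l - b))
    (h₁ : ∀ m, f₁ m ∈ Homog (k - a - 1) (l - b - 1))
    (h₂ : ∀ m, f₂ m ∈ Homog (k - a - 2) (l - b - 2)) (m : M) :
    (serLin hw f₀ f₁ f₂ h₀ h₁ h₂ m : SuperFn) = ser w (f₀ m) (f₁ m) (f₂ m) 0 := rfl

theorem dbar1_coe (A : Form1) :
    ((dbar1 A).1 : SuperFn) = hatVL A.2.2 - hatVR A.2.1 - (2 : ℂ) • mulThEta A.1 ∧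
    ((dbar1 A).2.1 : SuperFn) = hatVF A.2.1 - hatVL A.1 ∧
    ((dbar1 A).2.2 : SuperFn) = hatVF A.2.2 - hatVR A.1 := ⟨rfl, rfl, rfl⟩

theorem dbar2_coe (W : Form2) :
    (dbar2 W : SuperFn) = hatVF W.1 - hatVL W.2.2 + hatVR W.2.1 := rfl

theorem dbar1_ePsi (i : Fin 3) (f : T1) : dbar1 (ePsi i f) = ePsiPlus i (diracUnd f) := by
  apply form2_ext <;>
  simp only [dbar1_coe, ePsi, ePsiPlus, LinearMap.prod_apply, Function.prod, serLin_apply,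
    LinearMap.zero_apply, Submodule.coe_zero, ← ser_zero (eta i), hatVF_ser, hatVL_ser, hatVR_ser,
    mulThEta_ser, ← ser_smul, ← ser_sub] <;>
  apply ser_congr_of_mul_thEta_cube (eta_mul_thEta_cube i) <;>
  simp only [LinearMap.comp_apply, LinearMap.sub_apply, LinearMap.neg_apply, LinearMap.smul_apply,
    LinearMap.zero_apply, con3_gradDot, con3_gradUnd, con5_grad2Und, con1_diracDot, con1_diracUnd,
    hatEF_eq, map_add, map_sub, map_neg, map_smul, map_zero, hatEL_spinDir, hatER_spinDir,
    hatEL_con1, hatER_con1, con1_zero_left, spinDir_zero_left, spinDir_zero_right,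
    spinDir_order] <;>
  module

/-- Only A⁺ enters the Noether identity, so each matter anti-field has to be mapped to a closed
form. -/
theorem dbar2_ePsiPlus (i : Fin 3) (f : T1) : dbar2 (ePsiPlus i f) = 0 := by
  apply Subtype.ext
  simp only [dbar2_coe, ePsiPlus, LinearMap.prod_apply, Function.prod, serLin_apply,
    LinearMap.zero_apply, Submodule.coe_zero, ← ser_zero (eta i), hatVF_ser, hatVL_ser, hatVR_ser,
    ← ser_sub, ← ser_add]
  apply ser_congr_of_mul_thEta_cube (eta_mul_thEta_cube i) <;>
  simp only [LinearMap.comp_apply, LinearMap.sub_apply, LinearMap.neg_apply, LinearMap.smul_apply,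
    LinearMap.zero_apply, con3_gradDot, con1_diracDot, hatEF_eq, map_add, map_sub, map_neg,
    map_smul, map_zero, hatEL_spinDir, hatER_spinDir, hatEL_con1, hatER_con1, con1_zero_left,
    spinDir_zero_left, spinDir_zero_right] <;>
  module

theorem dbar1_eChi (i : Fin 3) (f : T1) : dbar1 (eChi i f) = eChiPlus i (diracDot f) := by
  apply form2_ext <;>
  simp only [dbar1_coe, eChi, eChiPlus, LinearMap.prod_apply, Function.prod, serLin_apply,
    LinearMap.zero_apply, Submodule.coe_zero, ← ser_zero (theta i), hatVF_ser, hatVL_ser, hatVR_ser,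
    mulThEta_ser, ← ser_smul, ← ser_sub] <;>
  apply ser_congr_of_mul_thEta_cube (theta_mul_thEta_cube i) <;>
  simp only [LinearMap.comp_apply, LinearMap.sub_apply, LinearMap.neg_apply, LinearMap.smul_apply,
    LinearMap.zero_apply, con3_gradDot, con3_gradUnd, con5_grad2Dot, con1_diracDot, con1_diracUnd,
    hatEF_eq, map_add, map_sub, map_smul, map_zero, hatEL_spinDir, hatER_spinDir, hatEL_con1,
    hatER_con1, con1_zero_left, spinDir_zero_left, spinDir_zero_right, spinDir_order] <;>
  module

theorem dbar2_eChiPlus (i : Fin 3) (f : T1) : dbar2 (eChiPlus i f) = 0 := by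
  apply Subtype.ext
  simp only [dbar2_coe, eChiPlus, LinearMap.prod_apply, Function.prod, serLin_apply,
    LinearMap.zero_apply, Submodule.coe_zero, ← ser_zero (theta i), hatVF_ser, hatVL_ser, hatVR_ser,
    ← ser_sub, ← ser_add]
  apply ser_congr_of_mul_thEta_cube (theta_mul_thEta_cube i) <;>
  simp only [LinearMap.comp_apply, LinearMap.sub_apply, LinearMap.neg_apply, LinearMap.smul_apply,
    LinearMap.zero_apply, con3_gradUnd, con1_diracUnd, hatEF_eq, map_add, map_sub, map_neg,
    map_smul, map_zero, hatEL_spinDir, hatER_spinDir, hatEL_con1, hatER_con1, con1_zero_left,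
    spinDir_zero_left, spinDir_zero_right] <;>
  module

/-- The component along v̂^F ∧ v̂^L subtracts from the derivative of χ(λ') along μλ its
symmetrisation in λ, λ'. The remainder is half the antisymmetric part, that is, half the Dirac
operator contracted with μ. -/
theorem dbar1_eXi (f : T1) : dbar1 (eXi f) = eXiPlus (diracDot f) := by
  apply form2_ext <;>
  simp only [dbar1_coe, eXi, eXiPlus, LinearMap.prod_apply, Function.prod, serLin_apply,
    LinearMap.zero_apply, Submodule.coe_zero, ← ser_zero eta3, hatVF_ser, hatVL_ser, hatVR_ser,
    mulThEta_ser, ← ser_smul, ← ser_sub] <;>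
  apply ser_congr_of_mul_thEta eta3_mul_thEta <;>
  simp only [LinearMap.comp_apply, LinearMap.smul_apply, LinearMap.zero_apply, con3_gradDot,
    con1_diracDot, hatEF_eq, map_add, map_smul, map_zero, hatEL_spinDir, hatER_spinDir, hatEL_con1,
    hatER_con1, con1_zero_left, spinDir_zero_left, spinDir_zero_right] <;>
  module

theorem dbar2_eXiPlus (f : T1) : dbar2 (eXiPlus f) = 0 := by
  apply Subtype.ext
  simp only [dbar2_coe, eXiPlus, LinearMap.prod_apply, Function.prod, serLin_apply,
    LinearMap.zero_apply, Submodule.coe_zero, ← ser_zero eta3, hatVF_ser, hatVL_ser, hatVR_ser,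
    ← ser_sub, ← ser_add]
  apply ser_congr_of_mul_thEta eta3_mul_thEta
  simp only [LinearMap.smul_apply, LinearMap.zero_apply, hatEF_eq, map_smul, map_zero, hatER_con1,
    con1_zero_left]
  module

theorem dbar1_eZeta (f : T1) : dbar1 (eZeta f) = eZetaPlus (diracUnd f) := by
  apply form2_ext <;>
  simp only [dbar1_coe, eZeta, eZetaPlus, LinearMap.prod_apply, Function.prod, serLin_apply,
    LinearMap.zero_apply, Submodule.coe_zero, ← ser_zero theta3, hatVF_ser, hatVL_ser, hatVR_ser,
    mulThEta_ser, ← ser_smul, ← ser_sub] <;>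
  apply ser_congr_of_mul_thEta theta3_mul_thEta <;>
  simp only [LinearMap.comp_apply, LinearMap.smul_apply, LinearMap.zero_apply, con3_gradUnd,
    con1_diracUnd, hatEF_eq, map_add, map_smul, map_zero, hatEL_spinDir, hatER_spinDir, hatEL_con1,
    hatER_con1, con1_zero_left, spinDir_zero_left, spinDir_zero_right] <;>
  module

theorem dbar2_eZetaPlus (f : T1) : dbar2 (eZetaPlus f) = 0 := by
  apply Subtype.ext
  simp only [dbar2_coe, eZetaPlus, LinearMap.prod_apply, Function.prod, serLin_apply,
    LinearMap.zero_apply, Submodule.coe_zero, ← ser_zero theta3, hatVF_ser, hatVL_ser, hatVR_ser,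
    ← ser_sub, ← ser_add]
  apply ser_congr_of_mul_thEta theta3_mul_thEta
  simp only [LinearMap.smul_apply, LinearMap.zero_apply, hatEF_eq, map_smul, map_zero, hatEL_con1,
    con1_zero_left]
  module

/-- Along v̂^L ∧ v̂^R the first-order terms cancel as 3 − 1 − 2, which explains the coefficient 3 in
`ePhiLow`. Along v̂^F ∧ v̂^L they give −2 times the frame expression whose fourfold is the Laplacian
(`pull_box`), hence the factor −1/2. -/
theorem dbar1_ePhiLow (i : Fin 3) (f : SpaceFn) : dbar1 (ePhiLow i f) = ePhiLowPlus i (box f) := by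
  apply form2_ext <;>
  simp only [dbar1_coe, ePhiLow, ePhiLowPlus, LinearMap.prod_apply, Function.prod, serLin_apply,
    LinearMap.zero_apply, Submodule.coe_zero, ← ser_zero (eta2 i), hatVF_ser, hatVL_ser, hatVR_ser,
    mulThEta_ser, ← ser_smul, ← ser_sub] <;>
  apply ser_congr_of_mul_thEta_sq (eta2_mul_thEta_sq i) <;>
  simp only [LinearMap.comp_apply, LinearMap.neg_apply, LinearMap.smul_apply, LinearMap.zero_apply,
    AlgHom.toLinearMap_apply, con2_grad, con4_grad2, pull_box, hatEF_eq, map_add, map_neg, map_smul,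
    map_zero, hatEL_spinDir, hatER_spinDir, hatEL_pull, hatER_pull, spinDir_zero_left,
    spinDir_zero_right, spinDir_order] <;>
  module

theorem dbar2_ePhiLowPlus (i : Fin 3) (f : SpaceFn) : dbar2 (ePhiLowPlus i f) = 0 := by
  apply Subtype.ext
  simp only [dbar2_coe, ePhiLowPlus, LinearMap.prod_apply, Function.prod, serLin_apply,
    LinearMap.zero_apply, Submodule.coe_zero, ← ser_zero (eta2 i), hatVF_ser, hatVL_ser, hatVR_ser,
    ← ser_sub, ← ser_add]
  apply ser_congr_of_mul_thEta_sq (eta2_mul_thEta_sq i) <;>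
  simp only [LinearMap.neg_apply, LinearMap.smul_apply, AlgHom.toLinearMap_apply, hatEF_eq, map_neg,
    map_smul, map_zero, hatER_pull] <;>
  module

theorem dbar1_ePhiUp (i : Fin 3) (f : SpaceFn) : dbar1 (ePhiUp i f) = ePhiUpPlus i (box f) := by
  apply form2_ext <;>
  simp only [dbar1_coe, ePhiUp, ePhiUpPlus, LinearMap.prod_apply, Function.prod, serLin_apply,
    LinearMap.zero_apply, Submodule.coe_zero, ← ser_zero (theta2 i), hatVF_ser, hatVL_ser, hatVR_ser,
    mulThEta_ser, ← ser_smul, ← ser_sub] <;>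
  apply ser_congr_of_mul_thEta_sq (theta2_mul_thEta_sq i) <;>
  simp only [LinearMap.comp_apply, LinearMap.smul_apply, LinearMap.zero_apply,
    AlgHom.toLinearMap_apply, con2_grad, con4_grad2, pull_box, hatEF_eq, map_add, map_smul,
    map_zero, hatEL_spinDir, hatER_spinDir, hatEL_pull, hatER_pull, spinDir_zero_left,
    spinDir_zero_right, spinDir_order] <;>
  module

theorem dbar2_ePhiUpPlus (i : Fin 3) (f : SpaceFn) : dbar2 (ePhiUpPlus i f) = 0 := by
  apply Subtype.ext
  simp only [dbar2_coe, ePhiUpPlus, LinearMap.prod_apply, Function.prod, serLin_apply,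
    LinearMap.zero_apply, Submodule.coe_zero, ← ser_zero (theta2 i), hatVF_ser, hatVL_ser, hatVR_ser,
    ← ser_sub, ← ser_add]
  apply ser_congr_of_mul_thEta_sq (theta2_mul_thEta_sq i) <;>
  simp only [LinearMap.smul_apply, AlgHom.toLinearMap_apply, hatEF_eq, map_smul, map_zero,
    hatEL_pull] <;>
  module

theorem dbar1_eMatter1 (Φ : Matter1) : dbar1 (eMatter1 Φ) = eMatter2 (dMatter Φ) := by
  simp only [eMatter1, eMatter2, sumMatter_apply, map_add, map_sum, dbar1_ePsi, dbar1_eChi,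
    dbar1_eXi, dbar1_eZeta, dbar1_ePhiLow, dbar1_ePhiUp, dMatter, LinearMap.coe_mk, AddHom.coe_mk]

theorem dbar2_eMatter2 (Φ : Matter2) : dbar2 (eMatter2 Φ) = 0 := by
  simp only [eMatter2, sumMatter_apply, map_add, map_sum, dbar2_ePsiPlus, dbar2_eChiPlus,
    dbar2_eXiPlus, dbar2_eZetaPlus, dbar2_ePhiLowPlus, dbar2_ePhiUpPlus, Finset.sum_const_zero,
    add_zero]

theorem dbar0_e0_susy : dbar0 ∘ₗ e0 = eSYM1 ∘ₗ dSYM0 := LinearMap.ext fun f => by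
  have h := LinearMap.congr_fun dbar0_e0 f
  simpa [eSYM1, dSYM0] using h

theorem dbar1_eSYM1 : dbar1 ∘ₗ eSYM1 = eSYM2 ∘ₗ dSYM1 := LinearMap.ext fun Φ => by
  have h := LinearMap.congr_fun dbar1_e1 Φ.1
  simp only [LinearMap.comp_apply] at h
  simp only [LinearMap.comp_apply, eSYM1, eSYM2, dSYM1, LinearMap.coprod_apply, map_add, h,
    dbar1_eMatter1, LinearMap.prodMap_apply]

theorem dbar2_eSYM2 : dbar2 ∘ₗ eSYM2 = e3 ∘ₗ dSYM2 := LinearMap.ext fun Φ => by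
  have h := LinearMap.congr_fun dbar2_e2 Φ.1
  simp only [LinearMap.comp_apply] at h
  simp only [LinearMap.comp_apply, eSYM2, dSYM2, LinearMap.coprod_apply, map_add, h, dbar2_eMatter2,
    LinearMap.fst_apply, add_zero]

/-! ### Coefficients of Grassmann monomials -/

/-- Since 13 ≡ −3 modulo 16, this is the character sum that projects onto weight 3: for `n < 16` the
exponent `13 + n` is divisible by 16 only if `n = 3`. -/
theorem geom_sum_rootOfUnity {z : ℂ} (hz : IsPrimitiveRoot z 16) {n : ℕ} (hn : n < 16)
    (hn' : n ≠ 3) : ∑ j ∈ Finset.range 16, (z ^ (13 + n)) ^ j = 0 := by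
  have h1 : z ^ (13 + n) ≠ 1 := fun h => by
    have := (hz.pow_eq_one_iff_dvd _).1 h
    omega
  have h2 := geom_sum_mul (z ^ (13 + n)) 16
  rw [← pow_mul, mul_comm (13 + n), pow_mul, hz.pow_eq_one, one_pow, sub_self] at h2
  exact (mul_eq_zero.1 h2).resolve_right (sub_ne_zero.2 h1)

/-- A functional of weight `(3, 3)` which does not vanish on the top monomial. -/
theorem exists_topCoeff : ∃ φ : Gr →ₗ[ℂ] ℂ, φ (thEta ^ 3) ≠ 0 ∧
    ∀ a b w, GrWt a b w → a < 16 → b < 16 → ¬ (a = 3 ∧ b = 3) → φ w = 0 := by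
  -- Linear functionals on a vector space separate points, so some functional detects the top
  -- monomial.
  obtain ⟨φ, hφ⟩ : ∃ φ : Gr →ₗ[ℂ] ℂ, φ (thEta ^ 3) ≠ 0 := by
    by_contra! h
    exact thEta_cube_ne_zero ((Module.forall_dual_apply_eq_zero_iff ℂ _).1 h)
  obtain ⟨z, hz⟩ : ∃ z : ℂ, IsPrimitiveRoot z 16 :=
    ⟨_, Complex.isPrimitiveRoot_exp 16 (by norm_num)⟩
  let u : ℂˣ := Units.mk0 z (hz.ne_zero (by norm_num))
  -- Averaging over 16th roots of unity in both scalings keeps only weight (3, 3) among the weights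
  -- below 16. This range leaves room for products whose formal weight exceeds 3. The average is not
  -- normalised.
  let ψ : Gr →ₗ[ℂ] ℂ := ∑ j ∈ Finset.range 16, ∑ k ∈ Finset.range 16,
    ((z ^ 13) ^ j * (z ^ 13) ^ k) • (φ ∘ₗ (scaleGr (u ^ j) (u ^ k)).toLinearMap)
  have key (a b : ℕ) (w : Gr) (hw : GrWt a b w) :
      ψ w = (∑ j ∈ Finset.range 16, (z ^ (13 + a)) ^ j) *
        (∑ k ∈ Finset.range 16, (z ^ (13 + b)) ^ k) * φ w := by
    simp only [ψ, LinearMap.sum_apply, LinearMap.smul_apply, LinearMap.comp_apply,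
      AlgHom.toLinearMap_apply, hw _ _, map_smul, smul_eq_mul,
      Units.val_pow_eq_pow_val, u, Units.val_mk0]
    rw [Finset.sum_mul_sum, Finset.sum_mul]
    refine Finset.sum_congr rfl fun j _ => ?_
    rw [Finset.sum_mul]
    refine Finset.sum_congr rfl fun k _ => ?_
    ring
  refine ⟨ψ, ?_, fun a b w hw ha hb hab => ?_⟩
  · have h16 : z ^ (13 + 3) = 1 := hz.pow_eq_one
    rw [key 3 3 _ (GrWt.pow 3), h16]
    simpa using hφ
  · rw [key a b w hw]
    by_cases h : a = 3
    · rw [geom_sum_rootOfUnity hz hb fun h' => hab ⟨h, h'⟩, mul_zero, zero_mul]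
    · rw [geom_sum_rootOfUnity hz ha h, zero_mul, zero_mul]

/-- The coefficient of the top monomial, up to normalisation. -/
noncomputable def topCoeff : Gr →ₗ[ℂ] ℂ := exists_topCoeff.choose

theorem topCoeff_thEta_cube : topCoeff (thEta ^ 3) ≠ 0 := exists_topCoeff.choose_spec.1

theorem GrWt.topCoeff_eq_zero {a b : ℕ} {w : Gr} (h : GrWt a b w) (ha : a < 16) (hb : b < 16)
    (hab : ¬ (a = 3 ∧ b = 3)) : topCoeff w = 0 := exists_topCoeff.choose_spec.2 a b w h ha hb hab

/-- The functional `f ↦ (c f)_top` on superfunctions. -/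
noncomputable def coef (c : Gr) : SuperFn →ₗ[ℂ] AmbFn :=
  (TensorProduct.lid ℂ AmbFn).toLinearMap ∘ₗ
    TensorProduct.map (topCoeff ∘ₗ LinearMap.mulLeft ℂ c) LinearMap.id

theorem coef_ser (c w : Gr) (m : ℕ) (f₀ f₁ f₂ f₃ : AmbFn) :
    coef (c * thEta ^ m) (ser w f₀ f₁ f₂ f₃) = topCoeff (c * w * thEta ^ m) • f₀ +
      topCoeff (c * w * thEta ^ (m + 1)) • f₁ + topCoeff (c * w * thEta ^ (m + 2)) • f₂ +
      topCoeff (c * w * thEta ^ (m + 3)) • f₃ := by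
  have hc (m : ℕ) (x : Gr) : thEta ^ m * x = x * thEta ^ m :=
    ((show Commute thEta x from thEta_comm x).pow_left m).eq
  have h (k : ℕ) : c * thEta ^ m * (w * thEta ^ k) = c * w * thEta ^ (m + k) := by
    rw [mul_assoc, ← mul_assoc (thEta ^ m), hc, mul_assoc w, ← pow_add, mul_assoc]
  have h0 := h 0
  have h1 := h 1
  rw [pow_zero, mul_one, add_zero] at h0
  rw [pow_one] at h1
  have hs (x : Gr) : coef x (ser w f₀ f₁ f₂ f₃) = topCoeff (x * w) • f₀ +
      topCoeff (x * (w * thEta)) • f₁ + topCoeff (x * (w * thEta ^ 2)) • f₂ +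
      topCoeff (x * (w * thEta ^ 3)) • f₃ := by
    simp [coef, ser]
  rw [hs, h0, h1, h, h]

/-- Powers of u raise both weights equally, so a product whose two weights differ never reaches (3,
3). The bounds 13 keep the weights below 16 even after three further factors of u. -/
theorem coef_ser_of_wt {a b a' b' m : ℕ} {c w : Gr} (hc : GrWt a b c) (hw : GrWt a' b' w)
    (h : a + a' ≠ b + b') (hm : a + a' + m < 13) (hm' : b + b' + m < 13) (f₀ f₁ f₂ f₃ : AmbFn) :
    coef (c * thEta ^ m) (ser w f₀ f₁ f₂ f₃) = 0 := by
  have h' (k : ℕ) (hk : k ≤ m + 3) : topCoeff (c * w * thEta ^ k) = 0 :=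
    ((hc.mul hw).mul (GrWt.pow k)).topCoeff_eq_zero (by omega) (by omega) (by omega)
  rw [coef_ser, h' _ (by omega), h' _ (by omega), h' _ (by omega), h' _ (by omega)]
  simp only [zero_smul, add_zero]

/-! ### Pairings of complementary Grassmann monomials. -/

theorem thEta_cube_eq_three (i : Fin 3) : thEta ^ 3 = (3 : ℂ) • (thEtaTerm i * thEta ^ 2) := by
  have h (i j : Fin 3) : thEtaTerm i * (thEtaTerm i * thEtaTerm j) = 0 := by
    rw [← mul_assoc, thEtaTerm_mul_self, zero_mul]
  have h' (i j : Fin 3) : thEtaTerm i * (thEtaTerm j * thEtaTerm i) = 0 := by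
    rw [thEtaTerm_comm j, ← mul_assoc, thEtaTerm_mul_self, zero_mul]
  rw [thEta_cube, thEta_sq]
  fin_cases i <;> simp only [Fin.zero_eta, Fin.mk_one, Fin.reduceFinMk, mul_smul_comm, mul_add, h,
    h', add_zero, zero_add, smul_smul]
  · norm_num
  · rw [← mul_assoc (thEtaTerm 1) (thEtaTerm 0), thEtaTerm_comm 1 (thEtaTerm 0), mul_assoc]
    norm_num
  · rw [thEtaTerm_comm 2, mul_assoc]
    norm_num

/-- Only the summand of u with the missing index `k` survives multiplication; this gives the nonzero
pairing of η^(k) with θ_(k). -/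
theorem thEtaTerm_mul_mul_thEta (k : Fin 3) : thEta ^ 3 =
    (6 : ℂ) • (thEtaTerm (k + 1) * thEtaTerm (k + 2) * thEta) := by
  have h (i j : Fin 3) : thEtaTerm i * thEtaTerm j * thEtaTerm i = 0 := by
    rw [mul_assoc, thEtaTerm_comm j, ← mul_assoc, thEtaTerm_mul_self, zero_mul]
  have h' (i j : Fin 3) : thEtaTerm i * thEtaTerm j * thEtaTerm j = 0 := by
    rw [mul_assoc, thEtaTerm_mul_self, mul_zero]
  have h01 : ∀ k : Fin 3, thEta = thEtaTerm (k + 1) + thEtaTerm (k + 2) + thEtaTerm k := by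
    intro k
    rw [thEta_eq]
    fin_cases k <;> simp only [Fin.zero_eta, Fin.mk_one, Fin.reduceFinMk, Fin.isValue,
      zero_add, Fin.reduceAdd] <;> abel
  nth_rw 2 [h01 k]
  rw [mul_add, mul_add, h, h', zero_add, zero_add, thEta_cube]
  congr 1
  fin_cases k <;> simp only [Fin.zero_eta, Fin.mk_one, Fin.reduceFinMk, Fin.isValue,
      zero_add, Fin.reduceAdd]
  · rw [thEtaTerm_comm 0]
  · rw [thEtaTerm_comm 2 (thEtaTerm 0), mul_assoc, thEtaTerm_comm 2]
  · rw [mul_assoc]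

/-- The pairing of the triplets is diagonal: every term of u² contains the summand of index `i` or
`j`, hence a repeated generator. -/
theorem theta_mul_eta_mul_thEta_sq {i j : Fin 3} (h : i ≠ j) :
    theta j * eta i * thEta ^ 2 = 0 := by
  have hi : theta j * eta i * thEtaTerm i = 0 := by rw [mul_assoc, eta_mul_thEtaTerm, mul_zero]
  have hj : theta j * eta i * thEtaTerm j = 0 := by
    rw [mul_assoc, ← thEtaTerm_comm, ← mul_assoc, theta_mul_thEtaTerm, zero_mul]
  -- Two distinct indices are, in some order, the successors `k + 1`, `k + 2` of the third one,
  -- which is the form required by `mul_thEta_sq_of`.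
  have : ∀ i j : Fin 3, i ≠ j → ∃ k : Fin 3, (i = k + 1 ∧ j = k + 2) ∨ (j = k + 1 ∧ i = k + 2) := by
    decide
  obtain ⟨k, ⟨rfl, rfl⟩ | ⟨rfl, rfl⟩⟩ := this i j h
  · exact mul_thEta_sq_of k hi hj
  · exact mul_thEta_sq_of k hj hi

theorem topCoeff_theta_eta (i : Fin 3) : topCoeff (theta i * eta i * thEta ^ 2) ≠ 0 := fun h => by
  apply topCoeff_thEta_cube
  rw [thEta_cube_eq_three i, map_smul, thEtaTerm, h, smul_zero]

theorem theta2_mul_eta2_self (k : Fin 3) :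
    theta2 k * eta2 k = -(thEtaTerm (k + 1) * thEtaTerm (k + 2)) := by
  rw [theta2, eta2, mul_assoc, ← mul_assoc (theta (k + 2)), ← neg_neg (theta (k + 2) * eta (k + 1)),
    ← eta_mul_theta]
  simp only [thEtaTerm, mul_neg, neg_mul, mul_assoc]

theorem topCoeff_theta2_eta2 (k : Fin 3) : topCoeff (theta2 k * eta2 k * thEta ^ 1) ≠ 0 :=
  fun h => by
    apply topCoeff_thEta_cube
    rw [theta2_mul_eta2_self, pow_one, neg_mul, map_neg, neg_eq_zero] at h
    rw [thEtaTerm_mul_mul_thEta k, map_smul, h, smul_zero]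

/-- For distinct `j`, `k` the generators in the two quadratic monomials together involve all three
indices, so every summand of u is annihilated. -/
theorem theta2_mul_eta2_mul_thEta {j k : Fin 3} (h : k ≠ j) : theta2 j * eta2 k * thEta = 0 := by
  have hk := eta2_mul_thEtaTerm k
  have hj := theta2_mul_thEtaTerm j
  have h1 (i : Fin 3) (hi : eta2 k * thEtaTerm i = 0) : theta2 j * eta2 k * thEtaTerm i = 0 := by
    rw [mul_assoc, hi, mul_zero]
  have h2 (i : Fin 3) (hi : theta2 j * thEtaTerm i = 0) : theta2 j * eta2 k * thEtaTerm i = 0 := by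
    rw [mul_assoc, ← thEtaTerm_comm, ← mul_assoc, hi, zero_mul]
  have h3 (i : Fin 3) : theta2 j * eta2 k * thEtaTerm i = 0 := by
    have : ∀ i j k : Fin 3, k ≠ j → (i = k + 1 ∨ i = k + 2) ∨ (i = j + 1 ∨ i = j + 2) := by decide
    rcases this i j k h with (rfl | rfl) | (rfl | rfl)
    exacts [h1 _ hk.1, h1 _ hk.2, h2 _ hj.1, h2 _ hj.2]
  rw [thEta_eq, mul_add, mul_add, h3, h3, h3, add_zero, add_zero]

theorem topCoeff_theta3_eta3 : topCoeff (theta3 * eta3 * thEta ^ 0) ≠ 0 := fun h => by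
  -- Moving η₁ to the left past θ³ and θ² produces two signs and reduces the claim to the pairing of
  -- quadratic monomials.
  have h' : theta3 * eta3 = thEtaTerm 0 * (theta2 0 * eta2 0) := by
    simp only [theta3, eta3, theta2, eta2, thEtaTerm, mul_assoc, zero_add, Fin.isValue]
    congr 1
    rw [← mul_assoc (theta 2), ← neg_neg (theta 2 * eta 0), ← eta_mul_theta, neg_mul, mul_neg,
      ← mul_assoc (theta 1), ← mul_assoc (theta 1), ← neg_neg (theta 1 * eta 0), ← eta_mul_theta]
    simp only [neg_mul, neg_neg, mul_assoc]
  apply topCoeff_thEta_cube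
  rw [pow_zero, mul_one, h', theta2_mul_eta2_self, mul_neg, map_neg, neg_eq_zero] at h
  rw [thEta_cube, map_smul]
  exact (congrArg ((6 : ℂ) • ·) h).trans (smul_zero _)

/-- `w f₀ + w θ^i η_i f₁ + w (θ^i η_i)² f₂ + w (θ^i η_i)³ f₃`. -/
noncomputable abbrev ser' (w : Gr) (f : Fin 4 → AmbFn) : SuperFn := ser w (f 0) (f 1) (f 2) (f 3)

/-- The component expansion of a superfunction which is invariant or a triplet under the
R-symmetry. -/
noncomputable def multiplet (a : Fin 4 → AmbFn) (b c : Fin 3 → Fin 4 → AmbFn) (d e : Fin 4 → AmbFn)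
    (p q : Fin 3 → Fin 4 → AmbFn) : SuperFn :=
  ser' 1 a + (∑ i, ser' (eta i) (b i) + (∑ i, ser' (theta i) (c i) + (ser' eta3 d +
    (ser' theta3 e + (∑ k, ser' (eta2 k) (p k) + ∑ k, ser' (theta2 k) (q k))))))

theorem smul_eq_zero_of_ne {z : ℂ} (hz : z ≠ 0) {f : AmbFn} (h : z • f = 0) : f = 0 := by
  have := congrArg (fun x => z⁻¹ • x) h
  simpa [smul_smul, inv_mul_cancel₀ hz] using this

/-- `N` is the power of u that completes `c * w` to weight (3, 3). Testing with `c * thEta ^ (N -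
n)` therefore selects the single coefficient `f n`. -/
theorem coef_ser_eq {r s N : ℕ} {c w : Gr} (hw : GrWt r s (c * w)) (hr : r + N = 3)
    (hs : s + N = 3) (n : Fin 4) (hn : (n : ℕ) ≤ N) (f : Fin 4 → AmbFn) :
    coef (c * thEta ^ (N - (n : ℕ))) (ser' w f) = topCoeff (c * w * thEta ^ N) • f n := by
  have ht (m : ℕ) (hm : m < 12) (hmn : m ≠ N) : topCoeff (c * w * thEta ^ m) = 0 :=
    (hw.mul (GrWt.pow m)).topCoeff_eq_zero (by omega) (by omega) (by omega)
  obtain ⟨k, hk⟩ : ∃ k, N = n + k := ⟨N - n, by omega⟩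
  rw [coef_ser]
  have h (j : Fin 4) : topCoeff (c * w * thEta ^ (N - (n : ℕ) + j)) • f j =
      if j = n then topCoeff (c * w * thEta ^ N) • f n else 0 := by
    split_ifs with hj
    · rw [hj, Nat.sub_add_cancel hn]
    · rw [ht _ (by omega) fun h' => hj (Fin.ext (by omega)), zero_smul]
  have h0 := h 0
  have h1 := h 1
  have h2 := h 2
  have h3 := h 3
  simp only [Fin.val_zero, add_zero, Fin.val_one, Fin.val_two, Fin.isValue] at h0 h1 h2
  rw [show ((3 : Fin 4) : ℕ) = 3 from rfl] at h3
  rw [h0, h1, h2, h3]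
  fin_cases n <;> simp

section multiplet

variable {a : Fin 4 → AmbFn} {b c : Fin 3 → Fin 4 → AmbFn} {d e : Fin 4 → AmbFn}
  {p q : Fin 3 → Fin 4 → AmbFn}

/-- A coefficient functional only sees the monomials of complementary weight. -/
theorem coef_multiplet {r s m : ℕ} {x : Gr} (hx : GrWt r s x) (hr : r + m < 10) (hs : s + m < 10) :
    coef (x * thEta ^ m) (multiplet a b c d e p q) =
      (if r = s then coef (x * thEta ^ m) (ser' 1 a) else 0) +
      ((if r + 1 = s then ∑ i, coef (x * thEta ^ m) (ser' (eta i) (b i)) else 0) +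
      ((if r = s + 1 then ∑ i, coef (x * thEta ^ m) (ser' (theta i) (c i)) else 0) +
      ((if r + 3 = s then coef (x * thEta ^ m) (ser' eta3 d) else 0) +
      ((if r = s + 3 then coef (x * thEta ^ m) (ser' theta3 e) else 0) +
      ((if r + 2 = s then ∑ i, coef (x * thEta ^ m) (ser' (eta2 i) (p i)) else 0) +
      (if r = s + 2 then ∑ i, coef (x * thEta ^ m) (ser' (theta2 i) (q i)) else 0)))))) := by
  have key {r' s' : ℕ} {w : Gr} (hw : GrWt r' s' w) (hr' : r' ≤ 3) (hs' : s' ≤ 3)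
      (f : Fin 4 → AmbFn) : coef (x * thEta ^ m) (ser' w f) =
      if r + r' = s + s' then coef (x * thEta ^ m) (ser' w f) else 0 := by
    split_ifs with h
    · rfl
    · exact coef_ser_of_wt hx hw h (by omega) (by omega) _ _ _ _
  have hsum (P : Prop) [Decidable P] (f : Fin 3 → AmbFn) :
      (∑ i, if P then f i else 0) = if P then ∑ i, f i else 0 := by
    split_ifs <;> simp
  -- The conditions are moved inside the sums, so that each summand can be treated by `key`
  -- separately.
  simp only [multiplet, map_add, map_sum, ← hsum]
  congr 1
  · exact key GrWt.one (by omega) (by omega) a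
  congr 1
  · exact Finset.sum_congr rfl fun i _ => key (GrWt.eta i) (by omega) (by omega) _
  congr 1
  · exact Finset.sum_congr rfl fun i _ => key (GrWt.theta i) (by omega) (by omega) _
  congr 1
  · exact key GrWt.eta3 (by omega) (by omega) d
  congr 1
  · exact key GrWt.theta3 (by omega) (by omega) e
  congr 1
  · exact Finset.sum_congr rfl fun i _ => key (GrWt.eta2 i) (by omega) (by omega) _
  · exact Finset.sum_congr rfl fun i _ => key (GrWt.theta2 i) (by omega) (by omega) _

theorem multiplet_one (h : multiplet a b c d e p q = 0) (n : Fin 4) : a n = 0 := by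
  have h' := coef_multiplet (a := a) (b := b) (c := c) (d := d) (e := e) (p := p) (q := q)
    (m := 3 - n) GrWt.one (by omega) (by omega)
  simp only [h, map_zero, reduceIte, add_zero, OfNat.ofNat_ne_zero, zero_add, OfNat.zero_ne_ofNat,
    one_ne_zero, zero_ne_one] at h'
  rw [coef_ser_eq (GrWt.one.mul GrWt.one) rfl rfl n (by omega)] at h'
  exact smul_eq_zero_of_ne (by simpa using topCoeff_thEta_cube) h'.symm

theorem eta_mul_theta2 (i k : Fin 3) : eta i * theta2 k = theta2 k * eta i := by
  rw [theta2, ← mul_assoc, eta_mul_theta, neg_mul, mul_assoc, eta_mul_theta, mul_neg, neg_neg,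
    mul_assoc]

theorem eta_mul_theta3 (i : Fin 3) : eta i * theta3 = -(theta3 * eta i) := by
  have h : theta3 = theta 0 * theta2 0 := by
    simp only [theta3, theta2, mul_assoc, zero_add]
  rw [h, ← mul_assoc, eta_mul_theta, neg_mul, mul_assoc, eta_mul_theta2, mul_assoc]

theorem eta2_mul_theta2 (j k : Fin 3) : eta2 j * theta2 k = theta2 k * eta2 j := by
  rw [eta2, mul_assoc, eta_mul_theta2, ← mul_assoc, eta_mul_theta2, mul_assoc]

theorem eta3_mul_theta3 : eta3 * theta3 = -(theta3 * eta3) := by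
  rw [eta3, mul_assoc, eta_mul_theta3, mul_neg, ← mul_assoc, mul_assoc (eta 0), eta_mul_theta3,
    mul_neg, ← mul_assoc, eta_mul_theta3]
  simp only [neg_mul, neg_neg, mul_assoc]

theorem sum_smul_eq {t : Fin 3 → Fin 3 → ℂ} (ht : ∀ i j, i ≠ j → t j i = 0) (f : Fin 3 → AmbFn)
    (j : Fin 3) : ∑ i, t j i • f i = t j j • f j :=
  Finset.sum_eq_single j (fun i _ hi => by rw [ht i j hi, zero_smul]) (by simp)

/-- The test monomial is θ^j times a power of u; weight leaves only the η-triplet, and the diagonal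
pairing picks `i = j`. The bound on `n` is needed because η_j u³ = 0. The remaining sectors are
treated with their own complementary monomials. -/
theorem multiplet_eta (h : multiplet a b c d e p q = 0) (j : Fin 3) (n : Fin 4) (hn : (n : ℕ) ≤ 2) :
    b j n = 0 := by
  have h' := coef_multiplet (a := a) (b := b) (c := c) (d := d) (e := e) (p := p) (q := q)
    (m := 2 - n) (GrWt.theta j) (by omega) (by omega)
  simp only [h, map_zero, reduceIte, add_zero, Nat.reduceAdd, zero_add, OfNat.zero_ne_ofNat,
    zero_ne_one, Nat.reduceEqDiff] at h'
  simp only [fun i => coef_ser_eq ((GrWt.theta j).mul (GrWt.eta i)) (N := 2) rfl rfl n hn] at h'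
  rw [sum_smul_eq (t := fun j i => topCoeff (theta j * eta i * thEta ^ 2)) fun i j hij => by
    rw [theta_mul_eta_mul_thEta_sq hij, map_zero]] at h'
  exact smul_eq_zero_of_ne (topCoeff_theta_eta j) h'.symm

theorem multiplet_theta (h : multiplet a b c d e p q = 0) (j : Fin 3) (n : Fin 4)
    (hn : (n : ℕ) ≤ 2) : c j n = 0 := by
  have h' := coef_multiplet (a := a) (b := b) (c := c) (d := d) (e := e) (p := p) (q := q)
    (m := 2 - n) (GrWt.eta j) (by omega) (by omega)
  simp only [h, map_zero, reduceIte, add_zero, Nat.reduceAdd, OfNat.ofNat_ne_zero, zero_add,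
    one_ne_zero, Nat.reduceEqDiff] at h'
  simp only [fun i => coef_ser_eq ((GrWt.eta j).mul (GrWt.theta i)) (N := 2) rfl rfl n hn] at h'
  rw [sum_smul_eq (t := fun j i => topCoeff (eta j * theta i * thEta ^ 2)) fun i j hij => by
    rw [eta_mul_theta, neg_mul, theta_mul_eta_mul_thEta_sq hij.symm, neg_zero, map_zero]] at h'
  refine smul_eq_zero_of_ne ?_ h'.symm
  rw [eta_mul_theta, neg_mul, map_neg]
  exact neg_ne_zero.2 (topCoeff_theta_eta j)

theorem multiplet_eta2 (h : multiplet a b c d e p q = 0) (j : Fin 3) (n : Fin 4)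
    (hn : (n : ℕ) ≤ 1) : p j n = 0 := by
  have h' := coef_multiplet (a := a) (b := b) (c := c) (d := d) (e := e) (p := p) (q := q)
    (m := 1 - n) (GrWt.theta2 j) (by omega) (by omega)
  simp only [h, map_zero, reduceIte, add_zero, Nat.reduceAdd, zero_add, OfNat.zero_ne_ofNat,
    Nat.reduceEqDiff] at h'
  simp only [fun i => coef_ser_eq ((GrWt.theta2 j).mul (GrWt.eta2 i)) (N := 1) rfl rfl n hn] at h'
  rw [sum_smul_eq (t := fun j i => topCoeff (theta2 j * eta2 i * thEta ^ 1)) fun i j hij => by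
    rw [pow_one, theta2_mul_eta2_mul_thEta hij, map_zero]] at h'
  exact smul_eq_zero_of_ne (topCoeff_theta2_eta2 j) h'.symm

theorem multiplet_theta2 (h : multiplet a b c d e p q = 0) (j : Fin 3) (n : Fin 4)
    (hn : (n : ℕ) ≤ 1) : q j n = 0 := by
  have h' := coef_multiplet (a := a) (b := b) (c := c) (d := d) (e := e) (p := p) (q := q)
    (m := 1 - n) (GrWt.eta2 j) (by omega) (by omega)
  simp only [h, map_zero, reduceIte, Nat.reduceAdd, OfNat.ofNat_ne_zero, zero_add,
    Nat.reduceEqDiff] at h'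
  simp only [fun i => coef_ser_eq ((GrWt.eta2 j).mul (GrWt.theta2 i)) (N := 1) rfl rfl n hn] at h'
  rw [sum_smul_eq (t := fun j i => topCoeff (eta2 j * theta2 i * thEta ^ 1)) fun i j hij => by
    rw [eta2_mul_theta2, pow_one, theta2_mul_eta2_mul_thEta hij.symm, map_zero]] at h'
  refine smul_eq_zero_of_ne ?_ h'.symm
  rw [eta2_mul_theta2]
  exact topCoeff_theta2_eta2 j

theorem multiplet_eta3 (h : multiplet a b c d e p q = 0) : d 0 = 0 := by
  have h' := coef_multiplet (a := a) (b := b) (c := c) (d := d) (e := e) (p := p) (q := q)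
    (m := 0 - ((0 : Fin 4) : ℕ)) GrWt.theta3 (by simp) (by simp)
  rw [h, map_zero, coef_ser_eq (GrWt.theta3.mul GrWt.eta3) (N := 0) rfl rfl 0 le_rfl] at h'
  exact smul_eq_zero_of_ne topCoeff_theta3_eta3 (by simpa using h'.symm)

theorem multiplet_theta3 (h : multiplet a b c d e p q = 0) : e 0 = 0 := by
  have h' := coef_multiplet (a := a) (b := b) (c := c) (d := d) (e := e) (p := p) (q := q)
    (m := 0 - ((0 : Fin 4) : ℕ)) GrWt.eta3 (by simp) (by simp)
  rw [h, map_zero, coef_ser_eq (GrWt.eta3.mul GrWt.theta3) (N := 0) rfl rfl 0 le_rfl] at h'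
  refine smul_eq_zero_of_ne (z := topCoeff (eta3 * theta3 * thEta ^ 0)) ?_ (by simpa using h'.symm)
  rw [eta3_mul_theta3, neg_mul, map_neg]
  exact neg_ne_zero.2 topCoeff_theta3_eta3

end multiplet

/-! ### Fields are determined by their contractions -/

theorem lu_apply (p : dom) : (lu 0).1 p = -p.1.2.1 1 ∧ (lu 1).1 p = p.1.2.1 0 := by
  simp [lu, raise, epsUp, lam, AmbFn.of, Fin.sum_univ_two]

theorem mv_apply (p : dom) : (mv 0).1 p = -p.1.2.2 1 ∧ (mv 1).1 p = p.1.2.2 0 := by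
  simp [mv, raise, epsUp, mu, AmbFn.of, Fin.sum_univ_two]

theorem con1_value (v : Fin 2 → AmbFn) (T : T1) (p : dom) :
    (con1 v T).1 p = (T 0).1 p.1.1 * (v 0).1 p + (T 1).1 p.1.1 * (v 1).1 p := by
  simp [con1_apply, pull, AmbFn.of, Fin.sum_univ_two]

theorem con2_value (v w : Fin 2 → AmbFn) (T : T2) (p : dom) :
    (con2 v w T).1 p = (con1 w (T 0)).1 p * (v 0).1 p + (con1 w (T 1)).1 p * (v 1).1 p := by
  simp [con2_apply, Fin.sum_univ_two]

theorem e0_ne : (![1, 0] : Fin 2 → ℂ) ≠ 0 := fun h => by simpa using congrFun h 0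
theorem e1_ne : (![0, 1] : Fin 2 → ℂ) ≠ 0 := fun h => by simpa using congrFun h 1
theorem e01_ne : (![1, 1] : Fin 2 → ℂ) ≠ 0 := fun h => by simpa using congrFun h 1

/-- The contraction is linear in λ, so the values at the two unit spinors give the components. -/
theorem eq_zero_of_con1_lu {T : T1} (h : con1 lu T = 0) : T = 0 := by
  have key (x : E4) (l m : Fin 2 → ℂ) (hl : l ≠ 0) (hm : m ≠ 0) :
      -((T 0).1 x * l 1) + (T 1).1 x * l 0 = 0 := by
    have := congrArg (fun F : AmbFn => F.1 ⟨(x, l, m), hl, hm⟩) h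
    simpa [con1_value, lu_apply] using this
  funext i
  refine Subtype.ext (funext fun x => ?_)
  have k0 := key x _ _ e0_ne e0_ne
  have k1 := key x _ _ e1_ne e0_ne
  fin_cases i
  · simpa using k1
  · simpa using k0

theorem eq_zero_of_con1_mv {T : T1} (h : con1 mv T = 0) : T = 0 := by
  have key (x : E4) (l m : Fin 2 → ℂ) (hl : l ≠ 0) (hm : m ≠ 0) :
      -((T 0).1 x * m 1) + (T 1).1 x * m 0 = 0 := by
    have := congrArg (fun F : AmbFn => F.1 ⟨(x, l, m), hl, hm⟩) h
    simpa [con1_value, mv_apply] using this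
  funext i
  refine Subtype.ext (funext fun x => ?_)
  have k0 := key x _ _ e0_ne e0_ne
  have k1 := key x _ _ e0_ne e1_ne
  fin_cases i
  · simpa using k1
  · simpa using k0

/-- The ladder operator replaces λ' by λ, which reduces the claim to a polynomial dependence on λ.
-/
theorem eq_zero_of_con1_lh {T : T1} (h : con1 lh T = 0) : T = 0 :=
  eq_zero_of_con1_lu (by rw [← hatEL_con1 lh, h, map_zero])

theorem eq_zero_of_con1_mh {T : T1} (h : con1 mh T = 0) : T = 0 :=
  eq_zero_of_con1_mv (by rw [← hatER_con1 mh, h, map_zero])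

theorem eq_zero_of_con2_mv_lu {T : T2} (h : con2 mv lu T = 0) : T = 0 := by
  have key (x : E4) (l m : Fin 2 → ℂ) (hl : l ≠ 0) (hm : m ≠ 0) :
      -((-((T 0 0).1 x * l 1) + (T 0 1).1 x * l 0) * m 1) +
        (-((T 1 0).1 x * l 1) + (T 1 1).1 x * l 0) * m 0 = 0 := by
    have := congrArg (fun F : AmbFn => F.1 ⟨(x, l, m), hl, hm⟩) h
    simpa [con2_value, con1_value, mv_apply, lu_apply] using this
  funext i j
  refine Subtype.ext (funext fun x => ?_)
  have k00 := key x _ _ e0_ne e0_ne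
  have k01 := key x _ _ e0_ne e1_ne
  have k10 := key x _ _ e1_ne e0_ne
  have k11 := key x _ _ e1_ne e1_ne
  fin_cases i <;> fin_cases j
  · simpa using k11
  · simpa using k01
  · simpa using k10
  · simpa using k00

theorem eq_zero_of_con2_mh_lh {T : T2} (h : con2 mh lh T = 0) : T = 0 := by
  have h' : con2 mh lu T = 0 := by simpa [hatEL_con2] using congrArg hatEL h
  exact eq_zero_of_con2_mv_lu (by simpa [hatER_con2] using congrArg hatER h')

/-- Polarisation: a symmetric form is determined by its values at (1,0), (0,1) and (1,1). -/
theorem eq_zero_of_quadratic {T : T2} (hT : T ∈ Sym)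
    (h : ∀ x (m : Fin 2 → ℂ), m ≠ 0 → -((-((T 0 0).1 x * m 1) + (T 0 1).1 x * m 0) * m 1) +
        (-((T 1 0).1 x * m 1) + (T 1 1).1 x * m 0) * m 0 = 0) : T = 0 := by
  have h0 (x : E4) : (T 0 0).1 x = 0 := by simpa using h x _ e1_ne
  have h1 (x : E4) : (T 1 1).1 x = 0 := by simpa using h x _ e0_ne
  have h2 (x : E4) : (T 1 0).1 x = 0 := by
    have := h x _ e01_ne
    simpa [h0, h1, hT 0 1] using this
  funext i j
  refine Subtype.ext (funext fun x => ?_)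
  fin_cases i <;> fin_cases j
  · exact h0 x
  · exact (congrArg (fun f : SpaceFn => f.1 x) (hT 0 1)).trans (h2 x)
  · exact h2 x
  · exact h1 x

theorem eq_zero_of_con2_lu_lu {T : T2} (hT : T ∈ Sym) (h : con2 lu lu T = 0) : T = 0 :=
  eq_zero_of_quadratic hT fun x m hm => by
    -- The contraction does not involve μ; setting it equal to λ merely supplies a nonzero spinor.
    have := congrArg (fun F : AmbFn => F.1 ⟨(x, m, m), hm, hm⟩) h
    simpa [con2_value, con1_value, lu_apply] using this

theorem eq_zero_of_con2_mv_mv {T : T2} (hT : T ∈ Sym) (h : con2 mv mv T = 0) : T = 0 :=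
  eq_zero_of_quadratic hT fun x m hm => by
    have := congrArg (fun F : AmbFn => F.1 ⟨(x, m, m), hm, hm⟩) h
    simpa [con2_value, con1_value, mv_apply] using this

/-- Two applications of the ladder operator turn λ'λ' into λλ; by symmetry the first one produces a
factor 2. -/
theorem eq_zero_of_con2_lh_lh {T : T2} (hT : T ∈ Sym) (h : con2 lh lh T = 0) : T = 0 := by
  have h' : con2 lu lh T = 0 := by
    have := congrArg hatEL h
    rw [hatEL_con2, con2_symm hT lh lu, ← two_smul ℂ, map_zero] at this
    exact smul_eq_zero_of_ne two_ne_zero this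
  exact eq_zero_of_con2_lu_lu hT (by simpa [hatEL_con2] using congrArg hatEL h')

theorem eq_zero_of_con2_mh_mh {T : T2} (hT : T ∈ Sym) (h : con2 mh mh T = 0) : T = 0 := by
  have h' : con2 mv mh T = 0 := by
    have := congrArg hatER h
    rw [hatER_con2, con2_symm hT mh mv, ← two_smul ℂ, map_zero] at this
    exact smul_eq_zero_of_ne two_ne_zero this
  exact eq_zero_of_con2_mv_mv hT (by simpa [hatER_con2] using congrArg hatER h')

theorem eq_zero_of_pull {f : SpaceFn} (h : pull f = 0) : f = 0 :=
  pull_injective (h.trans (map_zero pull).symm)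

/-! ### Injectivity -/

theorem coe_finset_sum_sec {k l : ℤ} (f : Fin 3 → Sec k l) :
    ((∑ i, f i : Sec k l) : SuperFn) = ∑ i, (f i : SuperFn) :=
  map_sum (Sec k l).subtype f Finset.univ

/-- This and the next statements put the components of the image into the form of a `multiplet`,
padding with zero coefficients, so that the extraction lemmas apply. -/
theorem eSYM1_F (Φ : SYM1) : ((eSYM1 Φ).1 : SuperFn) = multiplet
    ![con2 mv lu Φ.1.1, -(con2 lu lh Φ.1.2.1 - con2 mv mh Φ.1.2.2),
      -((1 / 2 : ℂ) • con4 mh lu lh lh (dDot Φ.1.2.1) +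
        (1 / 2 : ℂ) • con4 lh mv mh mh (dUnd Φ.1.2.2)),
      -((1 / 6 : ℂ) • con6 mh mh lu lh lh lh (ddDot Φ.1.2.1) -
        (1 / 6 : ℂ) • con6 lh lh mv mh mh mh (ddUnd Φ.1.2.2))]
    (fun i => ![con1 mv (Φ.2.1 i), -con3 lh mv mh (gradUnd (Φ.2.1 i)),
      (1 / 2 : ℂ) • con5 lh lh mv mh mh (grad2Und (Φ.2.1 i)), 0])
    (fun i => ![con1 lu (Φ.2.2.1 i), con3 mh lu lh (gradDot (Φ.2.2.1 i)),
      (1 / 2 : ℂ) • con5 mh mh lu lh lh (grad2Dot (Φ.2.2.1 i)), 0])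
    ![(1 / 2 : ℂ) • con3 mv lh lh (gradDot Φ.2.2.2.1), 0, 0, 0]
    ![(1 / 2 : ℂ) • con3 lu mh mh (gradUnd Φ.2.2.2.2.1), 0, 0, 0]
    (fun k => ![con2 mv lh (grad (Φ.2.2.2.2.2.1 k)),
      -con4 mh lh mv lh (grad2 (Φ.2.2.2.2.2.1 k)), 0, 0])
    (fun k => ![con2 mh lu (grad (Φ.2.2.2.2.2.2 k)),
      con4 mh lh mh lu (grad2 (Φ.2.2.2.2.2.2 k)), 0, 0]) := by
  simp only [eSYM1, LinearMap.coprod_apply, eMatter1, sumMatter_apply, Prod.fst_add, Prod.fst_sum,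
    Submodule.coe_add, coe_finset_sum_sec]
  rfl

theorem eSYM1_L (Φ : SYM1) : ((eSYM1 Φ).2.1 : SuperFn) = multiplet
    ![0, -con2 mh lu Φ.1.1, -((3 / 2 : ℂ) • con2 mh mh Φ.1.2.2),
      (5 / 6 : ℂ) • con4 lh mh mh mh (dUnd Φ.1.2.2)]
    (fun i => ![0, -((2 : ℂ) • con1 mh (Φ.2.1 i)),
      (2 : ℂ) • con3 lh mh mh (gradUnd (Φ.2.1 i)), 0])
    0 ![con1 lh Φ.2.2.2.1, 0, 0, 0] 0
    (fun k => ![pull (Φ.2.2.2.2.2.1 k), -((3 : ℂ) • con2 mh lh (grad (Φ.2.2.2.2.2.1 k))), 0, 0])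
    0 := by
  simp only [eSYM1, LinearMap.coprod_apply, eMatter1, sumMatter_apply, Prod.snd_add, Prod.fst_add,
    Prod.fst_sum, Prod.snd_sum, Submodule.coe_add, coe_finset_sum_sec]
  simp only [multiplet, ser', Pi.zero_apply, ser_zero]
  rfl

theorem eSYM1_R (Φ : SYM1) : ((eSYM1 Φ).2.2 : SuperFn) = multiplet
    ![0, con2 mv lh Φ.1.1, -((3 / 2 : ℂ) • con2 lh lh Φ.1.2.1),
      -((5 / 6 : ℂ) • con4 mh lh lh lh (dDot Φ.1.2.1))]
    0
    (fun i => ![0, (2 : ℂ) • con1 lh (Φ.2.2.1 i),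
      (2 : ℂ) • con3 mh lh lh (gradDot (Φ.2.2.1 i)), 0])
    0 ![con1 mh Φ.2.2.2.2.1, 0, 0, 0] 0
    (fun k => ![pull (Φ.2.2.2.2.2.2 k), (3 : ℂ) • con2 mh lh (grad (Φ.2.2.2.2.2.2 k)), 0, 0]) := by
  simp only [eSYM1, LinearMap.coprod_apply, eMatter1, sumMatter_apply, Prod.snd_add, Prod.snd_sum,
    Submodule.coe_add, coe_finset_sum_sec]
  simp only [multiplet, ser', Pi.zero_apply, ser_zero]
  rfl

theorem eSYM2_LR (Φ : SYM2) : ((eSYM2 Φ).1 : SuperFn) = multiplet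
    ![0, 0, con2 lu lh Φ.1.2.1 - con2 mv mh Φ.1.2.2, con2 mh lh Φ.1.1]
    (fun i => ![0, 0, con1 lh (Φ.2.1 i), 0]) (fun i => ![0, 0, -con1 mh (Φ.2.2.1 i), 0])
    0 0 0 0 := by
  simp only [eSYM2, LinearMap.coprod_apply, eMatter2, sumMatter_apply, Prod.fst_add, Prod.fst_sum,
    Submodule.coe_add, coe_finset_sum_sec]
  simp only [multiplet, ser', Pi.zero_apply, ser_zero]
  rfl

theorem e2FL_coe (Φ : YM2) : (e2FL Φ : SuperFn) = ser 1 0 (-con2 lu lu Φ.2.1)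
    (-((5 / 6 : ℂ) • con2 mh lu Φ.1) - (1 / 2 : ℂ) • con2 mh lu (Bvec Φ))
    ((1 / 4 : ℂ) • con4 mh mh lu lh (dTraceDot (Φ.1 + Bvec Φ)) +
      (1 / 6 : ℂ) • con4 mh mh lu lh (dSymSym (Φ.1 + (2 : ℂ) • Bvec Φ))) := by
  rw [e2FL, LinearMap.coe_mk, AddHom.coe_mk]

theorem e2FR_coe (Φ : YM2) : (e2FR Φ : SuperFn) = ser 1 0 (con2 mv mv Φ.2.2)
    (-((5 / 6 : ℂ) • con2 mv lh Φ.1) + (1 / 2 : ℂ) • con2 mv lh (Bvec Φ))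
    (-((1 / 4 : ℂ) • con4 mv mh lh lh (dTraceUnd (Φ.1 - Bvec Φ)) +
      (1 / 6 : ℂ) • con4 mv mh lh lh (dSymSym (Φ.1 - (2 : ℂ) • Bvec Φ)))) := by
  rw [e2FR, LinearMap.coe_mk, AddHom.coe_mk]

theorem eSYM2_FL (Φ : SYM2) : ((eSYM2 Φ).2.1 : SuperFn) = multiplet
    ![0, -con2 lu lu Φ.1.2.1,
      -((5 / 6 : ℂ) • con2 mh lu Φ.1.1) - (1 / 2 : ℂ) • con2 mh lu (Bvec Φ.1),
      (1 / 4 : ℂ) • con4 mh mh lu lh (dTraceDot (Φ.1.1 + Bvec Φ.1)) +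
        (1 / 6 : ℂ) • con4 mh mh lu lh (dSymSym (Φ.1.1 + (2 : ℂ) • Bvec Φ.1))]
    (fun i => ![0, -((3 / 2 : ℂ) • con1 lu (Φ.2.1 i)),
      (5 / 6 : ℂ) • con3 mh lu lh (gradDot (Φ.2.1 i)) -
        (5 / 4 : ℂ) • con1 mh (diracDot (Φ.2.1 i)), 0])
    (fun i => ![0, 0, (1 / 6 : ℂ) • con3 lu mh mh (gradUnd (Φ.2.2.1 i)), 0])
    ![(1 / 2 : ℂ) • con1 mv Φ.2.2.2.1, 0, 0, 0] 0
    (fun k => ![0, -((1 / 2 : ℂ) • pull (Φ.2.2.2.2.2.1 k)), 0, 0]) 0 := by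
  simp only [eSYM2, LinearMap.coprod_apply, eMatter2, sumMatter_apply, Prod.snd_add, Prod.fst_add,
    Prod.fst_sum, Prod.snd_sum, Submodule.coe_add, coe_finset_sum_sec]
  simp only [e2, LinearMap.prod_apply, Function.prod, e2FL_coe, eXiPlus, eZetaPlus, ePhiLowPlus,
    ePhiUpPlus, ePsiPlus, eChiPlus, serLin_apply]
  simp only [multiplet, ser', Pi.zero_apply, ser_zero]
  rfl

theorem eSYM2_FR (Φ : SYM2) : ((eSYM2 Φ).2.2 : SuperFn) = multiplet
    ![0, con2 mv mv Φ.1.2.2,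
      -((5 / 6 : ℂ) • con2 mv lh Φ.1.1) + (1 / 2 : ℂ) • con2 mv lh (Bvec Φ.1),
      -((1 / 4 : ℂ) • con4 mv mh lh lh (dTraceUnd (Φ.1.1 - Bvec Φ.1)) +
        (1 / 6 : ℂ) • con4 mv mh lh lh (dSymSym (Φ.1.1 - (2 : ℂ) • Bvec Φ.1)))]
    (fun i => ![0, 0, (1 / 6 : ℂ) • con3 mv lh lh (gradDot (Φ.2.1 i)), 0])
    (fun i => ![0, (3 / 2 : ℂ) • con1 mv (Φ.2.2.1 i),
      (5 / 6 : ℂ) • con3 lh mv mh (gradUnd (Φ.2.2.1 i)) -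
        (5 / 4 : ℂ) • con1 lh (diracUnd (Φ.2.2.1 i)), 0])
    0 ![(1 / 2 : ℂ) • con1 lu Φ.2.2.2.2.1, 0, 0, 0] 0
    (fun k => ![0, (1 / 2 : ℂ) • pull (Φ.2.2.2.2.2.2 k), 0, 0]) := by
  simp only [eSYM2, LinearMap.coprod_apply, eMatter2, sumMatter_apply, Prod.snd_add, Prod.snd_sum,
    Submodule.coe_add, coe_finset_sum_sec]
  simp only [e2, LinearMap.prod_apply, Function.prod, e2FR_coe, eXiPlus, eZetaPlus, ePhiLowPlus,
    ePhiUpPlus, ePsiPlus, eChiPlus, serLin_apply]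
  simp only [multiplet, ser', Pi.zero_apply, ser_zero]
  rfl

/-- Each field is read off where it stands alone: A from order zero along v̂^F, the dotted and
undotted B from order u² along v̂^R and v̂^L, since along v̂^F they enter only in combination.
Matter fields are read off from the leading coefficient in a suitable direction. -/
theorem eSYM1_injective : Function.Injective eSYM1 := by
  rw [injective_iff_map_eq_zero]
  intro Φ h
  have hF := (eSYM1_F Φ).symm.trans (congrArg (fun A : Form1 => (A.1 : SuperFn)) h)
  have hL := (eSYM1_L Φ).symm.trans (congrArg (fun A : Form1 => (A.2.1 : SuperFn)) h)
  have hR := (eSYM1_R Φ).symm.trans (congrArg (fun A : Form1 => (A.2.2 : SuperFn)) h)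
  have h32 : (3 / 2 : ℂ) ≠ 0 := by norm_num
  have hA := eq_zero_of_con2_mv_lu (multiplet_one hF 0)
  have hB := eq_zero_of_con2_lh_lh Φ.1.2.1.2
    (smul_eq_zero_of_ne h32 (neg_eq_zero.1 (multiplet_one hR 2)))
  have hC := eq_zero_of_con2_mh_mh Φ.1.2.2.2
    (smul_eq_zero_of_ne h32 (neg_eq_zero.1 (multiplet_one hL 2)))
  refine Prod.ext (Prod.ext hA (Prod.ext (Subtype.ext hB) (Subtype.ext hC)))
    (Prod.ext (funext fun i => ?_) (Prod.ext (funext fun i => ?_) (Prod.ext ?_ (Prod.ext ?_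
      (Prod.ext (funext fun k => ?_) (funext fun k => ?_))))))
  · exact eq_zero_of_con1_mv (multiplet_eta hF i 0 (by simp))
  · exact eq_zero_of_con1_lu (multiplet_theta hF i 0 (by simp))
  · exact eq_zero_of_con1_lh (multiplet_eta3 hL)
  · exact eq_zero_of_con1_mh (multiplet_theta3 hR)
  · exact eq_zero_of_pull (multiplet_eta2 hL k 0 (by simp))
  · exact eq_zero_of_pull (multiplet_theta2 hR k 0 (by simp))

/-- A⁺ stands alone at order u³ along v̂^L ∧ v̂^R, and the two B⁺ at order u along v̂^F ∧ v̂^L and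
v̂^F ∧ v̂^R, as do, up to factors, the other anti-fields at their leading order. -/
theorem eSYM2_injective : Function.Injective eSYM2 := by
  rw [injective_iff_map_eq_zero]
  intro Φ h
  have hLR := (eSYM2_LR Φ).symm.trans (congrArg (fun A : Form2 => (A.1 : SuperFn)) h)
  have hFL := (eSYM2_FL Φ).symm.trans (congrArg (fun A : Form2 => (A.2.1 : SuperFn)) h)
  have hFR := (eSYM2_FR Φ).symm.trans (congrArg (fun A : Form2 => (A.2.2 : SuperFn)) h)
  have h32 : (3 / 2 : ℂ) ≠ 0 := by norm_num
  have h12 : (1 / 2 : ℂ) ≠ 0 := by norm_num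
  have hA := eq_zero_of_con2_mh_lh (multiplet_one hLR 3)
  have hB := eq_zero_of_con2_lu_lu Φ.1.2.1.2 (neg_eq_zero.1 (multiplet_one hFL 1))
  have hC := eq_zero_of_con2_mv_mv Φ.1.2.2.2 (multiplet_one hFR 1)
  refine Prod.ext (Prod.ext hA (Prod.ext (Subtype.ext hB) (Subtype.ext hC)))
    (Prod.ext (funext fun i => ?_) (Prod.ext (funext fun i => ?_) (Prod.ext ?_ (Prod.ext ?_
      (Prod.ext (funext fun k => ?_) (funext fun k => ?_))))))
  · exact eq_zero_of_con1_lu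
      (smul_eq_zero_of_ne h32 (neg_eq_zero.1 (multiplet_eta hFL i 1 (by simp))))
  · exact eq_zero_of_con1_mv (smul_eq_zero_of_ne h32 (multiplet_theta hFR i 1 (by simp)))
  · exact eq_zero_of_con1_mv (smul_eq_zero_of_ne h12 (multiplet_eta3 hFL))
  · exact eq_zero_of_con1_lu (smul_eq_zero_of_ne h12 (multiplet_theta3 hFR))
  · exact eq_zero_of_pull
      (smul_eq_zero_of_ne h12 (neg_eq_zero.1 (multiplet_eta2 hFL k 1 (by simp))))
  · exact eq_zero_of_pull (smul_eq_zero_of_ne h12 (multiplet_theta2 hFR k 1 (by simp)))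

theorem eSYM1_inl : eSYM1 ∘ₗ LinearMap.inl ℂ YM1 Matter1 = e1 := by
  rw [eSYM1, LinearMap.coprod_inl]

theorem eSYM2_inl : eSYM2 ∘ₗ LinearMap.inl ℂ YM2 Matter2 = e2 := by
  rw [eSYM2, LinearMap.coprod_inl]

theorem e1_injective : Function.Injective e1 := by
  rw [← eSYM1_inl]
  exact eSYM1_injective.comp LinearMap.inl_injective

theorem e2_injective : Function.Injective e2 := by
  rw [← eSYM2_inl]
  exact eSYM2_injective.comp LinearMap.inl_injective

/-- A polynomial in u alone is a multiplet without matter entries. -/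
theorem ser_one_eq_zero {f₀ f₁ f₂ f₃ : AmbFn} (h : ser 1 f₀ f₁ f₂ f₃ = 0) (n : Fin 4) :
    (![f₀, f₁, f₂, f₃] : Fin 4 → AmbFn) n = 0 :=
  multiplet_one (a := ![f₀, f₁, f₂, f₃]) (b := 0) (c := 0) (d := 0) (e := 0) (p := 0) (q := 0)
    (by simp only [multiplet, ser', Pi.zero_apply, ser_zero, Finset.sum_const_zero, add_zero]
        exact h) n

theorem e0_injective : Function.Injective e0 := by
  rw [injective_iff_map_eq_zero]
  exact fun f h => eq_zero_of_pull (ser_one_eq_zero (congrArg Subtype.val h) 0)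

theorem e3_injective : Function.Injective e3 := by
  rw [injective_iff_map_eq_zero]
  exact fun f h => eq_zero_of_pull
    (smul_eq_zero_of_ne (z := 2 / 3) (by norm_num) (ser_one_eq_zero (congrArg Subtype.val h) 3))

/-! ### Lie-algebra-valued fields -/

section tens

variable {𝕜 : Type*} [Field 𝕜] [Algebra 𝕜 ℂ] {g : Type*} [AddCommGroup g] [Module 𝕜 g]
  {L M N : Type*} [AddCommMonoid L] [Module ℂ L] [Module 𝕜 L] [IsScalarTower 𝕜 ℂ L]
  [AddCommMonoid M] [Module ℂ M] [Module 𝕜 M] [IsScalarTower 𝕜 ℂ M]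
  [AddCommMonoid N] [Module ℂ N] [Module 𝕜 N] [IsScalarTower 𝕜 ℂ N]

theorem tens_comp (f : M →ₗ[ℂ] N) (f' : L →ₗ[ℂ] M) :
    tens 𝕜 g f ∘ₗ tens 𝕜 g f' = tens 𝕜 g (f ∘ₗ f') :=
  (LinearMap.rTensor_comp g (f.restrictScalars 𝕜) (f'.restrictScalars 𝕜)).symm

theorem tens_zero : tens 𝕜 g (0 : M →ₗ[ℂ] N) = 0 := LinearMap.rTensor_zero g

/-- Every module over the field `𝕜` is flat. -/
theorem tens_injective {f : M →ₗ[ℂ] N} (hf : Function.Injective f) :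
    Function.Injective (tens 𝕜 g f) :=
  Module.Flat.rTensor_preserves_injective_linearMap (f.restrictScalars 𝕜) hf

end tens

/-- Tensoring with a vector space preserves injective morphisms of cochain complexes. -/
theorem isInjectiveCochainMap_tens (𝕜 : Type*) [Field 𝕜] [Algebra 𝕜 ℂ] (g : Type*)
    [AddCommGroup g] [Module 𝕜 g] {L₀ L₁ L₂ L₃ L₀' L₁' L₂' L₃' : Type*}
    [AddCommMonoid L₀] [Module ℂ L₀] [Module 𝕜 L₀] [IsScalarTower 𝕜 ℂ L₀]
    [AddCommMonoid L₁] [Module ℂ L₁] [Module 𝕜 L₁] [IsScalarTower 𝕜 ℂ L₁]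
    [AddCommMonoid L₂] [Module ℂ L₂] [Module 𝕜 L₂] [IsScalarTower 𝕜 ℂ L₂]
    [AddCommMonoid L₃] [Module ℂ L₃] [Module 𝕜 L₃] [IsScalarTower 𝕜 ℂ L₃]
    [AddCommMonoid L₀'] [Module ℂ L₀'] [Module 𝕜 L₀'] [IsScalarTower 𝕜 ℂ L₀']
    [AddCommMonoid L₁'] [Module ℂ L₁'] [Module 𝕜 L₁'] [IsScalarTower 𝕜 ℂ L₁']
    [AddCommMonoid L₂'] [Module ℂ L₂'] [Module 𝕜 L₂'] [IsScalarTower 𝕜 ℂ L₂']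
    [AddCommMonoid L₃'] [Module ℂ L₃'] [Module 𝕜 L₃'] [IsScalarTower 𝕜 ℂ L₃']
    {d₀ : L₀ →ₗ[ℂ] L₁} {d₁ : L₁ →ₗ[ℂ] L₂} {d₂ : L₂ →ₗ[ℂ] L₃}
    {d₀' : L₀' →ₗ[ℂ] L₁'} {d₁' : L₁' →ₗ[ℂ] L₂'} {d₂' : L₂' →ₗ[ℂ] L₃'}
    {f₀ : L₀ →ₗ[ℂ] L₀'} {f₁ : L₁ →ₗ[ℂ] L₁'} {f₂ : L₂ →ₗ[ℂ] L₂'} {f₃ : L₃ →ₗ[ℂ] L₃'}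
    (h : IsInjectiveCochainMap d₀ d₁ d₂ d₀' d₁' d₂' f₀ f₁ f₂ f₃) :
    IsInjectiveCochainMap (tens 𝕜 g d₀) (tens 𝕜 g d₁) (tens 𝕜 g d₂) (tens 𝕜 g d₀')
      (tens 𝕜 g d₁') (tens 𝕜 g d₂') (tens 𝕜 g f₀) (tens 𝕜 g f₁) (tens 𝕜 g f₂) (tens 𝕜 g f₃) where
  d₁_d₀ := by rw [tens_comp, h.d₁_d₀, tens_zero]
  d₂_d₁ := by rw [tens_comp, h.d₂_d₁, tens_zero]
  d₁_d₀' := by rw [tens_comp, h.d₁_d₀', tens_zero]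
  d₂_d₁' := by rw [tens_comp, h.d₂_d₁', tens_zero]
  comm₀ := by rw [tens_comp, tens_comp, h.comm₀]
  comm₁ := by rw [tens_comp, tens_comp, h.comm₁]
  comm₂ := by rw [tens_comp, tens_comp, h.comm₂]
  injective₀ := tens_injective h.injective₀
  injective₁ := tens_injective h.injective₁
  injective₂ := tens_injective h.injective₂
  injective₃ := tens_injective h.injective₃

theorem isInjectiveCochainMap_YM :
    IsInjectiveCochainMap dYM0 dYM1 dYM2 dbar0 dbar1 dbar2 e0 e1 e2 e3 :=
  ⟨dYM1_dYM0, dYM2_dYM1, dbar1_dbar0, dbar2_dbar1, dbar0_e0, dbar1_e1, dbar2_e2,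
    e0_injective, e1_injective, e2_injective, e3_injective⟩

theorem isInjectiveCochainMap_SYM :
    IsInjectiveCochainMap dSYM0 dSYM1 dSYM2 dbar0 dbar1 dbar2 e0 eSYM1 eSYM2 e3 :=
  ⟨dSYM1_dSYM0, dSYM2_dSYM1, dbar1_dbar0, dbar2_dbar1, dbar0_e0_susy, dbar1_eSYM1, dbar2_eSYM2,
    e0_injective, eSYM1_injective, eSYM2_injective, e3_injective⟩

end CRAmbitwistor

theorem mainTheorem8 (𝕜 : Type*) [Field 𝕜] [Algebra 𝕜 ℂ]
    (g : Type*) [LieRing g] [LieAlgebra 𝕜 g] :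
    CRAmbitwistor.IsInjectiveCochainMap
      (CRAmbitwistor.tens 𝕜 g CRAmbitwistor.dYM0)
      (CRAmbitwistor.tens 𝕜 g CRAmbitwistor.dYM1)
      (CRAmbitwistor.tens 𝕜 g CRAmbitwistor.dYM2)
      (CRAmbitwistor.tens 𝕜 g CRAmbitwistor.dbar0)
      (CRAmbitwistor.tens 𝕜 g CRAmbitwistor.dbar1)
      (CRAmbitwistor.tens 𝕜 g CRAmbitwistor.dbar2)
      (CRAmbitwistor.tens 𝕜 g CRAmbitwistor.e0)
      (CRAmbitwistor.tens 𝕜 g CRAmbitwistor.e1)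
      (CRAmbitwistor.tens 𝕜 g CRAmbitwistor.e2)
      (CRAmbitwistor.tens 𝕜 g CRAmbitwistor.e3) ∧
    CRAmbitwistor.IsInjectiveCochainMap
      (CRAmbitwistor.tens 𝕜 g CRAmbitwistor.dSYM0)
      (CRAmbitwistor.tens 𝕜 g CRAmbitwistor.dSYM1)
      (CRAmbitwistor.tens 𝕜 g CRAmbitwistor.dSYM2)
      (CRAmbitwistor.tens 𝕜 g CRAmbitwistor.dbar0)
      (CRAmbitwistor.tens 𝕜 g CRAmbitwistor.dbar1)
      (CRAmbitwistor.tens 𝕜 g CRAmbitwistor.dbar2)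
      (CRAmbitwistor.tens 𝕜 g CRAmbitwistor.e0)
      (CRAmbitwistor.tens 𝕜 g CRAmbitwistor.eSYM1)
      (CRAmbitwistor.tens 𝕜 g CRAmbitwistor.eSYM2)
      (CRAmbitwistor.tens 𝕜 g CRAmbitwistor.e3) := 
  ⟨CRAmbitwistor.isInjectiveCochainMap_tens 𝕜 g CRAmbitwistor.isInjectiveCochainMap_YM,
    CRAmbitwistor.isInjectiveCochainMap_tens 𝕜 g CRAmbitwistor.isInjectiveCochainMap_SYM⟩
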